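/- A geometric $(n_k)$ configuration consists of $n$ distinct points and $n$ distinct straight lines in the Euclidean plane such that each line passes through exactly $k$ of the points and each point lies on exactly $k$ of the lines. **Celestial configurations.** Let $m\ge 1$, $h\ge 1$, and let $S$, $T$ be multisets of $h$ integers from the open interval $(0,m/2)$ such that $\sum_{s\in S} s-\sum_{t\in T} t$ is even and $\prod_{s\in S}\cos(\pi s/m)=\prod_{t\in T}\cos(\pi t/m)$; then $m\#S;T$ is called a celestial cohort. Let $s_1,\dots,s_h$ and $t_1,\dots,t_h$ be orderings of $S$ and $T$. For a point $z\neq \mathcal O$, where $\mathcal O=0$ is the centre, let $(v_1)_i=ze^{2\pi \mathrm i\, i/m}$ ($i$ taken modulo $m$), let $(L_j)_i$ be the line joining $(v_j)_i$ and $(v_j)_{i+s_j}$, and let $(v_{j+1})_i$ be the intersection of $(L_j)_i$ and $(L_j)_{i-t_j}$ ($1\le j<h$), that is, $(v_{j+1})_i=\frac{\cos(\pi s_j/m)}{\cos(\pi t_j/m)}\,e^{\pi \mathrm i(s_j-t_j)/m}(v_j)_i$. (By the conditions on $S$ and $T$, the class $v_{h+1}$ obtained in the same way coincides with $v_1$ up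 to a shift of the index.) If the points $(v_j)_i$ and the lines $(L_j)_i$, $1\le j\le h$, form an $((mh)_4)$ configuration, then it is called the celestial configuration $m\#(s_1,t_1;\dots;s_h,t_h)$ started at $z$; we say then that $m\#(s_1,t_1;\dots;s_h,t_h)$ is a celestial configuration (this does not depend on $z$). **Two-copy nesting.** Let $m\#(s_1,t_1;\dots;s_h,t_h)$ and $m\#(s_2,t_1;s_3,t_2;\dots;s_h,t_{h-1};s_1,t_h)$ be celestial configurations. Take the first one, with classes $v^1_j$, $L^1_j$, started at $1$. Choose an integer $d$ such that the circle through $(v^1_3)_d$, $\mathcal O$ and $(v^1_3)_{d-s_2}$ meets the line $(L^1_1)_0$ (the indices of classes are taken modulo $h$, so $v^1_3$ means $v^1_1$ if $h=2$), and choose a point $w$ of intersection. Take the second configuration, started at $(v^2_1)_0=w$. The points and lines of the two copies together form $[m\#S;T]*2'$. We say that the construction *produces an $(n_5)$ configuration* if * for some choice of $d$ and $w$ the points and lines form an $(n_5)$ configuration, and * they do so for every choice of $d$ and $w$ for which there are $n$ distinct points and $n$ distinct lines and no point lies on more than five of the lines. **Statement.** Let $m\#S;T$ be a celestial cohort, with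 $|S|=|T|=h$, such that $S\cap T=\varnothing$ and, if $h$ is odd, all elements of $T$ are equal, while if $h$ is even, $T$ is the union of two multisets of size $h/2$ each of which is constant. Let $s_1,\dots,s_h$ be any ordering of $S$ and $t_1,\dots,t_h$ an alternating ordering of $T$ ($t_{j+2}=t_j$, indices modulo $h$) such that $m\#(s_1,t_1;\dots;s_h,t_h)$ and $m\#(s_2,t_1;\dots;s_h,t_{h-1};s_1,t_h)$ are celestial configurations. Then the construction $[m\#S;T]*2'$ produces a $((2mh)_5)$ configuration. In particular, for $h=3$, $[m\#\{s_1,s_2,s_3\};\{t,t,t\}]*2'$ produces a $((6m)_5)$ configuration, and for $h=4$, $[m\#\{s_1,s_2,s_3,s_4\};\{t_1,t_1,t_2,t_2\}]*2'$ produces an $((8m)_5)$ configuration (under the same hypotheses). Moreover, $9\#(4,3;2,3;1,3)$ and $9\#(2,3;1,3;4,3)$ are celestial configurations, and $\mathcal N'(9)=[9\#\{4,2,1\};\{3,3,3\}]*2'$ produces a $(54_5)$ configuration. -/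

import Mathlib

/-- A geometric `(n_k)` configuration in the Euclidean plane `ℂ`: `n` points and `n` straight lines
such that each line passes through exactly `k` of the points and each point lies on exactly `k` of
the lines. -/
structure IsGeometricConfiguration (n k : ℕ) (P : Set ℂ) (L : Set (AffineSubspace ℝ ℂ)) :
    Prop where
  finite_points : P.Finite
  finite_lines : L.Finite
  card_points : P.ncard = n
  card_lines : L.ncard = n
  isLine : ∀ l ∈ L, Module.finrank ℝ l.direction = 1
  line_incidences : ∀ l ∈ L, {p | p ∈ P ∧ p ∈ l}.ncard = k
  point_incidences : ∀ p ∈ P, {l | l ∈ L ∧ p ∈ l}.ncard = k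

/-- The numbers `cos (π x / m)`. -/
noncomputable def ccos (m x : ℕ) : ℝ := Real.cos (Real.pi * x / m)

/-- The vertex `(v_j)_i` of the celestial construction `m#(s_0, t_0; …; s_{h-1}, t_{h-1})` with
centre `0` and starting vertex `(v_0)_0 = z`. The class `v_0` consists of the vertices of a regular
`m`-gon; `(L_j)_i` is the line through `(v_j)_i` and `(v_j)_{i + s_j}`, and `(v_{j+1})_i` is the
intersection of `(L_j)_i` and `(L_j)_{i - t_j}`, so passing from `v_j` to `v_{j+1}`
multiplies the radius by `cos (π s_j / m) / cos (π t_j / m)` and adds the angle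
`(s_j - t_j) π / m` (see `celestialVertex_succ_mem`). -/
noncomputable def celestialVertex (m : ℕ) {h : ℕ} (s t : Fin h → ℕ) (z : ℂ) (j : Fin h) (i : ℤ) :
    ℂ :=
  z * ((∏ l ∈ Finset.Iio j, ccos m (s l) / ccos m (t l) : ℝ) : ℂ) *
    Complex.exp (((Real.pi * (2 * i + ∑ l ∈ Finset.Iio j, ((s l : ℝ) - t l)) / m : ℝ) : ℂ) *
      Complex.I)

/-- The line `(L_j)_i` of the celestial construction: it joins `(v_j)_i` and `(v_j)_{i + s_j}`. -/
noncomputable def celestialLine (m : ℕ) {h : ℕ} (s t : Fin h → ℕ) (z : ℂ) (j : Fin h) (i : ℤ) :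
    AffineSubspace ℝ ℂ :=
  line[ℝ, celestialVertex m s t z j i, celestialVertex m s t z j (i + s j)]

/-- Let `a`, `b` be the points at polar angles `θ - α`, `θ + α` on a circle with centre `0`. The line
joining them passes through the point at polar angle `θ + β` on the circle whose radius is
`cos α / cos β` times as large. -/
theorem chord_mem_line (c : ℂ) (θ α β : ℝ) (hα : Real.sin α ≠ 0) (hβ : Real.cos β ≠ 0) :
    c * ((Real.cos α / Real.cos β : ℝ) : ℂ) * Complex.exp (((θ + β : ℝ) : ℂ) * Complex.I) ∈
      line[ℝ, c * Complex.exp (((θ - α : ℝ) : ℂ) * Complex.I),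
        c * Complex.exp (((θ + α : ℝ) : ℂ) * Complex.I)] := by
  have hβ' : Complex.cos (β : ℂ) ≠ 0 := by exact_mod_cast hβ
  have hα' : Complex.sin (α : ℂ) ≠ 0 := by exact_mod_cast hα
  have key : c * ((Real.cos α / Real.cos β : ℝ) : ℂ) *
      Complex.exp (((θ + β : ℝ) : ℂ) * Complex.I) =
      AffineMap.lineMap (c * Complex.exp (((θ - α : ℝ) : ℂ) * Complex.I))
        (c * Complex.exp (((θ + α : ℝ) : ℂ) * Complex.I))
        ((1 + Real.cos α / Real.sin α * (Real.sin β / Real.cos β)) / 2 : ℝ) := by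
    rw [AffineMap.lineMap_apply]
    simp only [vsub_eq_sub, vadd_eq_add, Complex.real_smul, Complex.ofReal_add,
      add_mul, sub_eq_add_neg, Complex.exp_add, Complex.exp_mul_I]
    push_cast
    rw [Complex.cos_neg, Complex.sin_neg]
    field_simp
    ring
  rw [key]
  exact AffineMap.lineMap_mem_affineSpan_pair _ _ _

/-- `(v_{j+1})_i` lies on `(L_j)_i` and on `(L_j)_{i - t_j}`. -/
theorem celestialVertex_succ_mem (m : ℕ) {h : ℕ} (s t : Fin h → ℕ) (z : ℂ) (j k : Fin h)
    (hk : (k : ℕ) = j + 1) (hs : 0 < s j ∧ 2 * s j < m) (ht : 2 * t j < m) (i : ℤ) :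
    celestialVertex m s t z k i ∈ celestialLine m s t z j i ∧
      celestialVertex m s t z k i ∈ celestialLine m s t z j (i - t j) := by
  have hm : (0 : ℝ) < m := by exact_mod_cast (by omega : 0 < m)
  have hIio : Finset.Iio k = insert j (Finset.Iio j) := by
    ext x
    simp only [Finset.mem_Iio, Finset.mem_insert, Fin.lt_def, Fin.ext_iff]
    omega
  have hnot : j ∉ Finset.Iio j := by simp
  have hα : Real.sin (Real.pi * s j / m) ≠ 0 := by
    have h1 : (0 : ℝ) < s j := by exact_mod_cast hs.1
    have h2 : (2 : ℝ) * s j < m := by exact_mod_cast hs.2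
    apply ne_of_gt
    apply Real.sin_pos_of_pos_of_lt_pi
    · positivity
    · rw [div_lt_iff₀ hm]
      nlinarith [Real.pi_pos]
  have hβ : Real.cos (Real.pi * t j / m) ≠ 0 := by
    have h2 : (2 : ℝ) * t j < m := by exact_mod_cast ht
    apply ne_of_gt
    apply Real.cos_pos_of_mem_Ioo
    constructor
    · have : 0 ≤ Real.pi * t j / m := by positivity
      linarith [Real.pi_pos]
    · rw [div_lt_iff₀ hm]
      nlinarith [Real.pi_pos]
  have hβ' : Real.cos (-(Real.pi * t j / m)) ≠ 0 := by rwa [Real.cos_neg]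
  unfold celestialLine celestialVertex
  rw [hIio, Finset.prod_insert hnot, Finset.sum_insert hnot]
  generalize (∏ l ∈ Finset.Iio j, ccos m (s l) / ccos m (t l)) = r
  generalize (∑ l ∈ Finset.Iio j, ((s l : ℝ) - t l)) = σ
  constructor
  · have := chord_mem_line (z * (r : ℂ)) (Real.pi * (2 * i + σ + s j) / m) _ _ hα hβ'
    rw [Real.cos_neg] at this
    have e₁ : Real.pi * (2 * i + σ + s j) / m + -(Real.pi * t j / m) =
      Real.pi * (2 * i + (s j - t j + σ)) / m := by ring
    have e₂ : Real.pi * (2 * i + σ + s j) / m - Real.pi * s j / m =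
      Real.pi * (2 * i + σ) / m := by ring
    have e₃ : Real.pi * (2 * i + σ + s j) / m + Real.pi * s j / m =
      Real.pi * (2 * ((i + s j : ℤ) : ℝ) + σ) / m := by push_cast; ring
    rw [e₁, e₂, e₃] at this
    convert this using 2
    rw [mul_assoc z, ← Complex.ofReal_mul, mul_comm r]
    rfl
  · have := chord_mem_line (z * (r : ℂ)) (Real.pi * (2 * (i - t j) + σ + s j) / m) _ _ hα hβ
    have e₁ : Real.pi * (2 * (i - t j) + σ + s j) / m + Real.pi * t j / m =
      Real.pi * (2 * i + (s j - t j + σ)) / m := by ring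
    have e₂ : Real.pi * (2 * (i - t j) + σ + s j) / m - Real.pi * s j / m =
      Real.pi * (2 * ((i - t j : ℤ) : ℝ) + σ) / m := by push_cast; ring
    have e₃ : Real.pi * (2 * (i - t j) + σ + s j) / m + Real.pi * s j / m =
      Real.pi * (2 * ((i - t j + s j : ℤ) : ℝ) + σ) / m := by push_cast; ring
    rw [e₁, e₂, e₃] at this
    convert this using 2
    rw [mul_assoc z, ← Complex.ofReal_mul, mul_comm r]
    rfl

/-- All points of the celestial construction. -/
def celestialPoints (m : ℕ) {h : ℕ} (s t : Fin h → ℕ) (z : ℂ) : Set ℂ :=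
  {p | ∃ (j : Fin h) (i : ℤ), p = celestialVertex m s t z j i}

/-- All lines of the celestial construction. -/
def celestialLines (m : ℕ) {h : ℕ} (s t : Fin h → ℕ) (z : ℂ) : Set (AffineSubspace ℝ ℂ) :=
  {l | ∃ (j : Fin h) (i : ℤ), l = celestialLine m s t z j i}

/-- The conditions on the parameters of a celestial cohort `m#S;T`: they do not depend on
the order of the parameters. The parameters lie strictly between `0` and `m / 2`, the twist
`(∑ S - ∑ T) / 2` is an integer, and the cosine condition holds (so that the last vertex class of
the construction is the first one again). -/
structure IsCelestialCohort (m h : ℕ) (S T : Multiset ℕ) : Prop where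
  card_left : S.card = h
  card_right : T.card = h
  left_range : ∀ x ∈ S, 0 < x ∧ 2 * x < m
  right_range : ∀ x ∈ T, 0 < x ∧ 2 * x < m
  even_sum : Even (S.sum + T.sum)
  cosine : (S.map (ccos m)).prod = (T.map (ccos m)).prod

/-- `m#(s_0, t_0; …; s_{h-1}, t_{h-1})` is a celestial 4-configuration: the parameters satisfy the
conditions of a cohort and the construction, started at `(v_0)_0 = 1`, really gives an
`((mh)_4)` configuration. -/
structure IsCelestialConfiguration (m : ℕ) {h : ℕ} (s t : Fin h → ℕ) : Prop where
  cohort : IsCelestialCohort m h (Finset.univ.val.map s) (Finset.univ.val.map t)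
  configuration : IsGeometricConfiguration (m * h) 4 (celestialPoints m s t 1)
    (celestialLines m s t 1)

/-- The cyclic shift `(s_0, s_1, …, s_{h-1}) ↦ (s_1, …, s_{h-1}, s_0)`. -/
def cyclicShift {h : ℕ} [NeZero h] (s : Fin h → ℕ) : Fin h → ℕ := fun j => s (j + 1)

/-- A choice in the two-copy nesting construction: `w` is an intersection of the line `(L_0)_0` of
the first copy with the circle through `(v_2)_d`, the centre `0` and `(v_2)_{d - s_1}`. Vertex
classes are indexed from `0` and modulo `h`, so `v_2` is the third class (the first, if `h = 2`). -/
def IsNestingChoice (m : ℕ) {h : ℕ} [NeZero h] (s t : Fin h → ℕ) (d : ℤ) (w : ℂ) : Prop :=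
  w ∈ celestialLine m s t 1 0 0 ∧
    EuclideanGeometry.Cospherical
      ({celestialVertex m s t 1 2 d, 0, celestialVertex m s t 1 2 (d - s 1), w} : Set ℂ)

/-- The points of the two-copy nesting: the first copy is `m#(s_0, t_0; …; s_{h-1}, t_{h-1})` started
at `1`, the second one is `m#(s_1, t_0; …; s_{h-1}, t_{h-2}; s_0, t_{h-1})` started at `w`. -/
def nestingPoints (m : ℕ) {h : ℕ} [NeZero h] (s t : Fin h → ℕ) (w : ℂ) : Set ℂ :=
  celestialPoints m s t 1 ∪ celestialPoints m (cyclicShift s) t w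

/-- The lines of the two-copy nesting. -/
def nestingLines (m : ℕ) {h : ℕ} [NeZero h] (s t : Fin h → ℕ) (w : ℂ) :
    Set (AffineSubspace ℝ ℂ) :=
  celestialLines m s t 1 ∪ celestialLines m (cyclicShift s) t w

/-- The two-copy nesting `*2'` of `m#(s_0, t_0; …; s_{h-1}, t_{h-1})` produces an `(n_5)`
configuration: some choice of the index `d` and of the intersection `w` gives one, and so does
every choice for which there are no unintended coincidences, that is, for which
there are `n` distinct points and `n` distinct lines and no point lies on more than five lines. -/
def NestingProduces (n m : ℕ) {h : ℕ} [NeZero h] (s t : Fin h → ℕ) : Prop :=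
  (∃ (d : ℤ) (w : ℂ), IsNestingChoice m s t d w ∧
    IsGeometricConfiguration n 5 (nestingPoints m s t w) (nestingLines m s t w)) ∧
  ∀ (d : ℤ) (w : ℂ), IsNestingChoice m s t d w →
    (nestingPoints m s t w).ncard = n → (nestingLines m s t w).ncard = n →
    (∀ p ∈ nestingPoints m s t w, {l | l ∈ nestingLines m s t w ∧ p ∈ l}.ncard ≤ 5) →
    IsGeometricConfiguration n 5 (nestingPoints m s t w) (nestingLines m s t w)

/-! Since `w` lies on `(L_0)_0`, the second copy depends on one real unknown `x` (`startPoint`). It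
uses the shifted sequence of the `s_j`, and a telescoping product shows that its class `v_j` lies on
the lines `L_j` of the first copy for every `x`. Conversely, the class `v_{j+2}` of the first copy
lies on the lines `L_j` of the second one, up to a shift of the index, if and only if `x` solves a
quadratic equation in which only `cos (π t_j / m) cos (π t_{j+1} / m)` and an angle `π ψ / m` occur.
As `t` alternates, the equation is the same for all `j`, and by inversion the circle of the
construction expresses it for `j = 0`. So every choice gives each point a line of the other copy and
each line a point of the other copy; if the numbers of points and lines are right and no point is on
more than five lines, double counting yields a configuration (`union_of_le`).

It remains to find a choice without coincidences. All radii, cosines and sines lie in the real field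
`K = realCyclotomic m`. If `x ∉ K`, an incidence between the copies is a relation `α + β x = 0` over
`K` (the quadratic equation removes `x ^ 2`), so `α = β = 0`, and only the intended incidences
survive (`existsUnique_chord`, `existsUnique_chord_tail`). Hence it suffices to find `ψ`, of the
parity of `t_0 + t_1` so that it comes from an integer `d`, for which the equation has a real root
outside `K`.

Write `a = t_0`, `b = t_1`. If a root `x` is in `K`, then `z = exp (π i ψ / m) (1 + i x) / (1 - i
x)` lies in the cyclotomic field of order `4 m` and has absolute value one under every embedding. It
is integral, since `z + 1/z = 4 cos (π a / m) cos (π b / m) - 2 cos (π ψ / m)`. By Kronecker's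
theorem it is a root of unity, so half of this sum is the cosine of a rational angle, in all Galois
conjugates simultaneously (`RationalAngle`). This fails for a suitable `ψ ≤ a + b`. For even `a + b`
some conjugate would be a cosine outside `[-1, 1]`. For odd `a + b`, Galois elements that double
angles or turn cosines into sines restrict the relations between four cosines so much that a few
small `ψ` cannot all satisfy one. The few exceptional `(m, a, b)` are excluded by the cohort
condition: it is Galois invariant, so the product of all `cos² (π k s_i / m)` is the `h`-th power of
`cos (π k a / m) cos (π k b / m)`, and some `s_i`, different from `a` and `b`, has its squared
cosine on a prescribed side of the geometric mean.

For `m = 9` the incidences reduce to congruences modulo 18 and the identity `8 cos 20° cos 40° cos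
80° = 1`. -/

/-! ### The cyclotomic field of order `4 m` and its Galois action -/

/-- The root of unity `exp (2 π i / (4 m))`. -/
noncomputable def quarterRoot (m : ℕ) : ℂ := Complex.exp (2 * Real.pi * Complex.I / (4 * m : ℕ))

theorem quarterRoot_isPrimitiveRoot {m : ℕ} (hm : 0 < m) :
    IsPrimitiveRoot (quarterRoot m) (4 * m) :=
  Complex.isPrimitiveRoot_exp _ (by omega)

theorem quarterRoot_pow {m : ℕ} (a : ℕ) :
    quarterRoot m ^ a = Complex.exp ((Real.pi * a / (2 * m) : ℝ) * Complex.I) := by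
  unfold quarterRoot
  rw [← Complex.exp_nat_mul]
  congr 1
  rcases Nat.eq_zero_or_pos m with rfl | hm
  · simp
  · have : (m : ℂ) ≠ 0 := by exact_mod_cast hm.ne'
    push_cast
    field_simp
    ring

theorem quarterRoot_pow_two_mul {m : ℕ} (a : ℕ) :
    quarterRoot m ^ (2 * a) = Complex.exp ((Real.pi * a / m : ℝ) * Complex.I) := by
  rw [quarterRoot_pow]
  congr 3
  rcases Nat.eq_zero_or_pos m with rfl | hm
  · simp
  · have : (m : ℝ) ≠ 0 := by exact_mod_cast hm.ne'
    push_cast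
    field_simp

theorem quarterRoot_pow_self {m : ℕ} (hm : 0 < m) : quarterRoot m ^ m = Complex.I := by
  rw [quarterRoot_pow]
  have : (m : ℂ) ≠ 0 := by exact_mod_cast hm.ne'
  have h : ((Real.pi * m / (2 * m) : ℝ) : ℂ) = Real.pi / 2 := by
    push_cast
    field_simp
  rw [h, Complex.exp_pi_div_two_mul_I]

/-- The conjugate is the inverse; as a power with a natural exponent it can be substituted into
polynomials. -/
theorem conj_eq_pow_pred {η : ℂ} {n : ℕ} (hn : 0 < n) (h : η ^ n = 1) :
    (starRingEnd ℂ) η = η ^ (n - 1) := by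
  have hη : ‖η‖ = 1 := Complex.norm_eq_one_of_pow_eq_one h hn.ne'
  rw [← Complex.inv_eq_conj hη]
  have h0 : η ≠ 0 := by
    intro h0
    simp [h0] at hη
  field_simp
  rw [← pow_succ', Nat.sub_add_cancel hn, h]

open Polynomial in
/-- Polynomial relations between powers of a root of unity are Galois invariant. -/
theorem aeval_quarterRoot_pow {m k : ℕ} (hm : 0 < m) (hk : k.Coprime (4 * m)) {P : ℚ[X]}
    (h : aeval (quarterRoot m) P = 0) : aeval (quarterRoot m ^ k) P = 0 := by
  have h1 := quarterRoot_isPrimitiveRoot hm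
  have h2 : minpoly ℚ (quarterRoot m) = minpoly ℚ (quarterRoot m ^ k) := by
    rw [minpoly.isIntegrallyClosed_eq_field_fractions' ℚ (h1.isIntegral (by omega)),
      minpoly.isIntegrallyClosed_eq_field_fractions' ℚ ((h1.isIntegral (by omega)).pow k),
      h1.minpoly_eq_pow_coprime hk]
  obtain ⟨Q, rfl⟩ := minpoly.dvd ℚ _ h
  rw [h2, map_mul, minpoly.aeval, zero_mul]

open Polynomial in
/-- The polynomial with the value `cos (π k a / (2 m))` at the `k`-th power of the root of
unity of order `4 m`. -/
noncomputable def cosPoly (m a : ℕ) : ℚ[X] := C (1 / 2) * (X ^ a + X ^ ((4 * m - 1) * a))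

open Polynomial in
theorem aeval_cosPoly {m : ℕ} (hm : 0 < m) (k a : ℕ) :
    aeval (quarterRoot m ^ k) (cosPoly m a) = (Real.cos (Real.pi * (k * a) / (2 * m)) : ℂ) := by
  have h1 : (quarterRoot m ^ k) ^ (4 * m) = 1 := by
    rw [← pow_mul, mul_comm k, pow_mul, (quarterRoot_isPrimitiveRoot hm).pow_eq_one, one_pow]
  simp only [cosPoly, map_mul, map_add, aeval_C, map_pow, aeval_X]
  rw [pow_mul _ (4 * m - 1), ← conj_eq_pow_pred (by omega) h1, ← map_pow, Complex.add_conj,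
    ← pow_mul, quarterRoot_pow, Complex.exp_ofReal_mul_I_re]
  push_cast
  simp only [one_div, map_ofNat]
  ring

theorem aeval_cosPoly_two_mul {m : ℕ} (hm : 0 < m) (k a : ℕ) :
    Polynomial.aeval (quarterRoot m ^ k) (cosPoly m (2 * a)) =
      (Real.cos (Real.pi * (k * a) / m) : ℂ) := by
  rw [aeval_cosPoly hm]
  have : (m : ℝ) ≠ 0 := by exact_mod_cast hm.ne'
  congr 2
  push_cast
  field_simp

open IntermediateField in
/-- The real numbers in the cyclotomic field of order `4 m`. -/
noncomputable def realCyclotomic (m : ℕ) : Subfield ℝ :=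
  (ℚ⟮quarterRoot m⟯).toSubfield.comap Complex.ofRealHom

open IntermediateField in
theorem mem_realCyclotomic {m : ℕ} {x : ℝ} :
    x ∈ realCyclotomic m ↔ (x : ℂ) ∈ ℚ⟮quarterRoot m⟯ := Iff.rfl

open IntermediateField in
theorem exp_mem_adjoin {m : ℕ} (N : ℤ) :
    Complex.exp ((Real.pi * N / m : ℝ) * Complex.I) ∈ ℚ⟮quarterRoot m⟯ := by
  have h : Complex.exp ((Real.pi * N / m : ℝ) * Complex.I) = (quarterRoot m ^ 2) ^ N := by
    have := quarterRoot_pow_two_mul (m := m) 1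
    rw [mul_one] at this
    rw [this, ← Complex.exp_int_mul]
    push_cast
    congr 1
    ring
  rw [h]
  exact zpow_mem (pow_mem (mem_adjoin_simple_self ℚ _) 2) N

open IntermediateField in
theorem cos_mem_realCyclotomic {m : ℕ} (N : ℤ) :
    Real.cos (Real.pi * N / m) ∈ realCyclotomic m := by
  rw [mem_realCyclotomic]
  have h1 := exp_mem_adjoin (m := m) N
  have h2 := exp_mem_adjoin (m := m) (-N)
  have h3 : (Real.cos (Real.pi * N / m) : ℂ) = (Complex.exp ((Real.pi * N / m : ℝ) * Complex.I) +
      Complex.exp ((Real.pi * (-N : ℤ) / m : ℝ) * Complex.I)) / 2 := by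
    rw [Complex.ofReal_cos, Complex.cos]
    congr 3
    push_cast
    ring
  rw [h3]
  exact div_mem (add_mem h1 h2) (ofNat_mem _ 2)

open IntermediateField in
theorem sin_mem_realCyclotomic {m : ℕ} (hm : 0 < m) (N : ℤ) :
    Real.sin (Real.pi * N / m) ∈ realCyclotomic m := by
  rw [mem_realCyclotomic]
  have h1 := exp_mem_adjoin (m := m) N
  have h2 := cos_mem_realCyclotomic (m := m) N
  rw [mem_realCyclotomic] at h2
  -- The order is a multiple of four so that `I`, and with it the sines, belongs to the field.
  have h4 : Complex.I ∈ ℚ⟮quarterRoot m⟯ := by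
    rw [← quarterRoot_pow_self hm]
    exact pow_mem (mem_adjoin_simple_self ℚ _) m
  have h3 : (Real.sin (Real.pi * N / m) : ℂ) =
      (Complex.exp ((Real.pi * N / m : ℝ) * Complex.I) - (Real.cos (Real.pi * N / m) : ℂ)) /
        Complex.I := by
    rw [Complex.exp_mul_I, Complex.ofReal_cos, Complex.ofReal_sin]
    field_simp
    ring
  rw [h3]
  exact div_mem (sub_mem h1 h2) h4

/-! ### Kronecker's theorem and the roots of the quadratic equation -/

open IntermediateField Polynomial in
/-- Real numbers in a cyclotomic field have only real conjugates. -/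
theorem conj_embedding_eq {m : ℕ} (hm : 0 < m) {x : ℝ} (hx : (x : ℂ) ∈ ℚ⟮quarterRoot m⟯)
    (φ : ℚ⟮quarterRoot m⟯ →+* ℂ) : (starRingEnd ℂ) (φ ⟨x, hx⟩) = φ ⟨x, hx⟩ := by
  have hprim := quarterRoot_isPrimitiveRoot hm
  have hint : IsIntegral ℚ (quarterRoot m) := (hprim.isIntegral (by omega)).tower_top
  set g : ℚ⟮quarterRoot m⟯ := AdjoinSimple.gen ℚ (quarterRoot m) with hg
  have hgc : (g : ℂ) = quarterRoot m := AdjoinSimple.coe_gen ℚ _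
  have hpow : g ^ (4 * m) = 1 := by
    apply Subtype.ext
    simpa [hgc] using hprim.pow_eq_one
  obtain ⟨P, hP⟩ := (adjoin.powerBasis hint).exists_eq_aeval' ⟨x, hx⟩
  rw [adjoin.powerBasis_gen, ← hg] at hP
  -- Being real, `x` is also the value of `P` at the inverse of the generator. Every embedding
  -- preserves this, and it sends the generator to a root of unity, whose inverse is its conjugate.
  have hconj : aeval (g ^ (4 * m - 1)) P = (⟨x, hx⟩ : ℚ⟮quarterRoot m⟯) := by
    apply Subtype.ext
    have e1 : ((aeval (g ^ (4 * m - 1)) P : ℚ⟮quarterRoot m⟯) : ℂ) =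
        aeval (quarterRoot m ^ (4 * m - 1)) P := by
      have := aeval_algHom_apply (ℚ⟮quarterRoot m⟯).val (g ^ (4 * m - 1)) P
      rw [map_pow] at this
      exact this.symm
    have e2 : (x : ℂ) = aeval (quarterRoot m) P :=
      (congrArg (ℚ⟮quarterRoot m⟯).val hP).trans
        (aeval_algHom_apply (ℚ⟮quarterRoot m⟯).val g P).symm
    rw [e1, ← conj_eq_pow_pred (by omega) hprim.pow_eq_one]
    have e3 := aeval_algHom_apply (Complex.conjAe.toAlgHom.restrictScalars ℚ) (quarterRoot m) P
    have e4 : aeval ((starRingEnd ℂ) (quarterRoot m)) P =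
      (starRingEnd ℂ) (aeval (quarterRoot m) P) := e3
    rw [e4, ← e2, Complex.conj_ofReal]
  have hφ : (φ g) ^ (4 * m) = 1 := by rw [← map_pow, hpow, map_one]
  let φ' : ℚ⟮quarterRoot m⟯ →ₐ[ℚ] ℂ := { φ with commutes' := fun q => by simp }
  have k1 : φ ⟨x, hx⟩ = aeval (φ g) P :=
    (congrArg φ hP).trans (aeval_algHom_apply φ' g P).symm
  have k2 : φ ⟨x, hx⟩ = aeval (φ g ^ (4 * m - 1)) P := by
    have := (congrArg φ hconj.symm).trans (aeval_algHom_apply φ' (g ^ (4 * m - 1)) P).symm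
    rwa [show φ' (g ^ (4 * m - 1)) = φ g ^ (4 * m - 1) from map_pow φ g _] at this
  have e3 := aeval_algHom_apply (Complex.conjAe.toAlgHom.restrictScalars ℚ) (φ g) P
  have e4 : aeval ((starRingEnd ℂ) (φ g)) P = (starRingEnd ℂ) (aeval (φ g) P) := e3
  rw [conj_eq_pow_pred (by omega) hφ, ← k1, ← k2] at e4
  exact e4.symm

open IntermediateField in
theorem isCyclotomicExtension_adjoin_quarterRoot {m : ℕ} (hm : 0 < m) :
    IsCyclotomicExtension {4 * m} ℚ ℚ⟮quarterRoot m⟯ := by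
  have : NeZero (4 * m) := ⟨by omega⟩
  have hprim := quarterRoot_isPrimitiveRoot hm
  have hint : IsIntegral ℚ (quarterRoot m) := (hprim.isIntegral (by omega)).tower_top
  change IsCyclotomicExtension {4 * m} ℚ ℚ⟮quarterRoot m⟯.toSubalgebra
  rw [adjoin_simple_toSubalgebra_of_isAlgebraic hint.isAlgebraic]
  exact hprim.adjoin_isCyclotomicExtension ℚ

theorem isIntegral_two_cos {m : ℕ} (hm : 0 < m) (a : ℕ) :
    IsIntegral ℤ (2 * Real.cos (Real.pi * a / m) : ℂ) := by
  have hprim := quarterRoot_isPrimitiveRoot hm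
  have h := aeval_cosPoly_two_mul hm 1 a
  have h2 : (2 * Real.cos (Real.pi * a / m) : ℂ) =
      quarterRoot m ^ (2 * a) + quarterRoot m ^ ((4 * m - 1) * (2 * a)) := by
    rw [Nat.cast_one, one_mul] at h
    rw [← h]
    simp only [cosPoly, map_mul, map_add, Polynomial.aeval_C, map_pow, Polynomial.aeval_X, pow_one,
      one_div, map_inv₀, map_ofNat]
    ring
  rw [h2]
  exact ((hprim.isIntegral (by omega)).pow _).add ((hprim.isIntegral (by omega)).pow _)

open Polynomial in
-- `z` is a root of the monic polynomial `X ^ 2 - (z + z⁻¹) X + 1` over the integral closure.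
theorem IsIntegral.of_add_inv {K : Type*} [Field K] {z : K} (hz : z ≠ 0)
    (h : IsIntegral ℤ (z + z⁻¹)) : IsIntegral ℤ z := by
  let s : integralClosure ℤ K := ⟨z + z⁻¹, h⟩
  apply isIntegral_trans (A := integralClosure ℤ K)
  refine ⟨X ^ 2 - C s * X + 1, ?_, ?_⟩
  · have : (X ^ 2 - C s * X + 1 : (integralClosure ℤ K)[X]) = X ^ 2 + (C (-s) * X + C 1) := by
      simp only [map_neg, map_one]
      ring
    rw [this]
    exact monic_X_pow_add (by compute_degree!)
  · have hs : algebraMap (integralClosure ℤ K) K s = z + z⁻¹ := rfl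
    simp only [eval₂_add, eval₂_sub, eval₂_mul, eval₂_pow, eval₂_X, eval₂_C, eval₂_one, hs]
    field_simp
    ring

/-- Roots of unity in a cyclotomic field of order divisible by four. -/
theorem pow_eq_one_of_isCyclotomicExtension {K : Type*} [Field K] [NumberField K] {n : ℕ}
    [NeZero n] [IsCyclotomicExtension {n} ℚ K] (hn : 2 ∣ n) {z : K} (hz : IsOfFinOrder z) :
    z ^ n = 1 := by
  have h1 := IsPrimitiveRoot.orderOf z
  have hl : orderOf z ≠ 0 := hz.orderOf_pos.ne'
  have hd := h1.dvd_of_isCyclotomicExtension n hl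
  have hpos : 0 < n := NeZero.pos n
  have hroot := IsCyclotomicExtension.zeta_spec n ℚ K
  have : NeZero (orderOf z) := ⟨hl⟩
  -- The field contains a root of unity whose order is the lcm of `orderOf z` and `n`, so the
  -- totient of the lcm is at most that of `n`. As `n` is even, passing from `n` to `2 n` would
  -- double the totient.
  have key := IsPrimitiveRoot.lcm_totient_le_finrank h1 hroot
    (Polynomial.cyclotomic.irreducible_rat <| Nat.lcm_pos (Nat.pos_of_ne_zero hl) hpos)
  rw [IsCyclotomicExtension.finrank K (Polynomial.cyclotomic.irreducible_rat hpos)] at key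
  obtain ⟨r, hr⟩ := Nat.dvd_lcm_right (orderOf z) n
  have hr2 : r ∣ 2 := by
    have : Nat.lcm (orderOf z) n ∣ 2 * n := Nat.lcm_dvd hd (Dvd.intro_left 2 rfl)
    rw [hr, mul_comm] at this
    exact Nat.dvd_of_mul_dvd_mul_right hpos this
  rcases (Nat.dvd_prime Nat.prime_two).1 hr2 with rfl | rfl
  · rw [mul_one] at hr
    exact orderOf_dvd_iff_pow_eq_one.1 (hr ▸ Nat.dvd_lcm_left (orderOf z) n)
  · exfalso
    have hle : (n * 2).totient ≤ n.totient := by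
      rw [← hr]
      exact key
    rw [mul_comm, Nat.totient_mul_of_prime_of_dvd Nat.prime_two hn] at hle
    have := Nat.totient_pos.2 hpos
    omega

open IntermediateField Polynomial in
/-- If a root `x` of the quadratic equation lies in the cyclotomic field, then
`2 cos (π a / m) cos (π b / m) - cos (π ψ / m)` is the cosine of a multiple of `π / (2 m)`,
compatibly with the Galois action. -/
theorem exists_cos_eq_of_root_mem {m : ℕ} (hm : 0 < m) (a b ψ : ℕ) {x : ℝ}
    (hx : x ∈ realCyclotomic m)
    (h : Real.cos (Real.pi * a / m) * Real.cos (Real.pi * b / m) * (1 + x ^ 2) +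
      Real.sin (Real.pi * ψ / m) * x = Real.cos (Real.pi * ψ / m)) :
    ∃ n : ℕ, ∀ k : ℕ, k.Coprime (4 * m) →
      2 * Real.cos (Real.pi * (k * a) / m) * Real.cos (Real.pi * (k * b) / m) =
        Real.cos (Real.pi * (k * ψ) / m) + Real.cos (Real.pi * (k * n) / (2 * m)) := by
  rw [mem_realCyclotomic] at hx
  have hprim := quarterRoot_isPrimitiveRoot hm
  have hint : IsIntegral ℚ (quarterRoot m) := (hprim.isIntegral (by omega)).tower_top
  have : FiniteDimensional ℚ ℚ⟮quarterRoot m⟯ := adjoin.finiteDimensional hint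
  have : NumberField ℚ⟮quarterRoot m⟯ := ⟨⟩
  have : NeZero (4 * m) := ⟨by omega⟩
  set g : ℚ⟮quarterRoot m⟯ := AdjoinSimple.gen ℚ (quarterRoot m) with hg
  have hgc : (g : ℂ) = quarterRoot m := AdjoinSimple.coe_gen ℚ _
  have hgprim : IsPrimitiveRoot g (4 * m) := by
    apply IsPrimitiveRoot.of_map_of_injective (f := algebraMap ℚ⟮quarterRoot m⟯ ℂ) _
      (algebraMap ℚ⟮quarterRoot m⟯ ℂ).injective
    exact hprim
  have hcyc : IsCyclotomicExtension {4 * m} ℚ ℚ⟮quarterRoot m⟯ :=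
    isCyclotomicExtension_adjoin_quarterRoot hm
  set X : ℚ⟮quarterRoot m⟯ := ⟨x, hx⟩ with hX
  -- A rotated Cayley transform of `x`; here `g ^ m` plays the role of `I`.
  set z : ℚ⟮quarterRoot m⟯ := g ^ (2 * ψ) * ((1 + g ^ m * X) / (1 - g ^ m * X)) with hz
  have hgm : ((g ^ m : ℚ⟮quarterRoot m⟯) : ℂ) = Complex.I := by
    change (g : ℂ) ^ m = _
    rw [hgc, quarterRoot_pow_self hm]
  have hzc : (z : ℂ) = Complex.exp ((Real.pi * ψ / m : ℝ) * Complex.I) *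
      ((1 + Complex.I * x) / (1 - Complex.I * x)) := by
    change (g : ℂ) ^ (2 * ψ) * ((1 + (g : ℂ) ^ m * x) / (1 - (g : ℂ) ^ m * x)) = _
    rw [hgc, quarterRoot_pow_two_mul, quarterRoot_pow_self hm]
  -- An embedding sends `X` to a real number and `g ^ m` to `I` or `-I`, so the fraction becomes a
  -- number divided by its conjugate.
  have hnorm : ∀ φ : ℚ⟮quarterRoot m⟯ →+* ℂ, ‖φ z‖ = 1 := by
    intro φ
    have h1 : (φ g) ^ (4 * m) = 1 := by rw [← map_pow, hgprim.pow_eq_one, map_one]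
    have h2 : ‖φ g‖ = 1 := Complex.norm_eq_one_of_pow_eq_one h1 (by omega)
    have h3 : (starRingEnd ℂ) (φ X) = φ X := conj_embedding_eq hm hx φ
    have h4 : (φ (g ^ m)) ^ 2 = -1 := by
      rw [← map_pow]
      have : (g ^ m) ^ 2 = -1 := by
        apply Subtype.ext
        push_cast
        have := hgm
        push_cast at this
        rw [this, Complex.I_sq]
      rw [this, map_neg, map_one]
    have h5 : (starRingEnd ℂ) (φ (g ^ m)) = - φ (g ^ m) := by
      have : (φ (g ^ m) - Complex.I) * (φ (g ^ m) + Complex.I) = 0 := by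
        linear_combination h4 - Complex.I_sq
      rcases mul_eq_zero.1 this with h | h
      · rw [sub_eq_zero.1 h, Complex.conj_I]
      · rw [eq_neg_of_add_eq_zero_left h, map_neg, Complex.conj_I]
    have h6 : φ X * φ X = (‖φ X‖ : ℂ) ^ 2 := by
      have := Complex.mul_conj' (φ X)
      rwa [h3] at this
    have h7 : (1 - φ (g ^ m) * φ X) ≠ 0 := by
      intro h0
      have h8 : (1 + (‖φ X‖ : ℂ) ^ 2) = 0 := by
        rw [← h6]
        linear_combination (1 + φ (g ^ m) * φ X) * h0 + φ X ^ 2 * h4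
      have h9 : (1 + ‖φ X‖ ^ 2 : ℝ) = 0 := by exact_mod_cast h8
      nlinarith [sq_nonneg ‖φ X‖]
    rw [hz, map_mul, map_pow, norm_mul, norm_pow, h2, one_pow, one_mul, map_div₀, norm_div,
      map_add, map_sub, map_one, map_mul]
    rw [div_eq_one_iff_eq (norm_ne_zero_iff.2 h7)]
    rw [← Complex.norm_conj (1 + _), map_add, map_mul, map_one, h3, h5, neg_mul, sub_eq_add_neg]
  have hI : ∀ (ε : ℂ), ε ^ 2 = 1 → 1 + ε * Complex.I * x ≠ 0 := by
    intro ε hε h0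
    have : ((1 + x ^ 2 : ℝ) : ℂ) = 0 := by
      push_cast
      linear_combination (1 - ε * Complex.I * x) * h0 + (x : ℂ) ^ 2 * Complex.I ^ 2 * hε +
        (x : ℂ) ^ 2 * Complex.I_sq
    have : 1 + x ^ 2 = 0 := by exact_mod_cast this
    nlinarith [sq_nonneg x]
  have hI1 : 1 + Complex.I * x ≠ 0 := by simpa using hI 1 (by norm_num)
  have hI2 : 1 - Complex.I * x ≠ 0 := by simpa [sub_eq_add_neg] using hI (-1) (by norm_num)
  have hzinv : (z : ℂ)⁻¹ = Complex.exp (-((Real.pi * ψ / m : ℝ) * Complex.I)) *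
      ((1 - Complex.I * x) / (1 + Complex.I * x)) := by
    rw [hzc, mul_inv, inv_div, Complex.exp_neg]
  have hz0 : (z : ℂ) ≠ 0 := by
    rw [hzc]
    exact mul_ne_zero (Complex.exp_ne_zero _) (div_ne_zero hI1 hI2)
  -- This is the quadratic equation for `x`, rewritten in terms of `z`.
  have hsum : (z : ℂ) + (z : ℂ)⁻¹ = 4 * Real.cos (Real.pi * a / m) * Real.cos (Real.pi * b / m) -
      2 * Real.cos (Real.pi * ψ / m) := by
    have h' : (Real.cos (Real.pi * a / m) * Real.cos (Real.pi * b / m) * (1 + x ^ 2) +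
      Real.sin (Real.pi * ψ / m) * x : ℂ) = Real.cos (Real.pi * ψ / m) := by exact_mod_cast h
    rw [hzinv, hzc, ← neg_mul, Complex.exp_mul_I, Complex.exp_mul_I, Complex.cos_neg,
      Complex.sin_neg, ← Complex.ofReal_cos, ← Complex.ofReal_sin]
    field_simp
    linear_combination (-4) * h' + (4 * (x : ℂ) ^ 2 * Real.cos (Real.pi * a / m) *
      Real.cos (Real.pi * b / m) + 4 * x * Real.sin (Real.pi * ψ / m)) * Complex.I_sq
  have hzint : IsIntegral ℤ z := by
    have h1 : IsIntegral ℤ (z : ℂ) := by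
      apply IsIntegral.of_add_inv hz0
      rw [hsum]
      have : (4 * Real.cos (Real.pi * a / m) * Real.cos (Real.pi * b / m) -
          2 * Real.cos (Real.pi * ψ / m) : ℂ) =
          (2 * Real.cos (Real.pi * a / m)) * (2 * Real.cos (Real.pi * b / m)) -
          2 * Real.cos (Real.pi * ψ / m) := by ring
      rw [this]
      exact ((isIntegral_two_cos hm a).mul (isIntegral_two_cos hm b)).sub (isIntegral_two_cos hm ψ)
    exact (isIntegral_algebraMap_iff (algebraMap ℚ⟮quarterRoot m⟯ ℂ).injective).1 h1
  -- Kronecker: an algebraic integer all of whose conjugates have absolute value one is a root of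
  -- unity.
  obtain ⟨r, hr, hzr⟩ := NumberField.Embeddings.pow_eq_one_of_norm_eq_one _ ℂ hzint hnorm
  have hzone : z ^ (4 * m) = 1 :=
    pow_eq_one_of_isCyclotomicExtension (Dvd.intro (2 * m) (by ring))
      (isOfFinOrder_iff_pow_eq_one.2 ⟨r, hr, hzr⟩)
  obtain ⟨n, -, hn⟩ := hgprim.eq_pow_of_pow_eq_one hzone
  have hznc : (z : ℂ) = quarterRoot m ^ n := by
    rw [← hn]
    change (g : ℂ) ^ n = _
    rw [hgc]
  refine ⟨n, fun k hk => ?_⟩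
  -- The relation becomes a polynomial equation over `ℚ` for the root of unity, hence holds at all
  -- its conjugates.
  set P : ℚ[X] := C 2 * cosPoly m (2 * a) * cosPoly m (2 * b) - cosPoly m (2 * ψ) - cosPoly m n
  have hP : ∀ k : ℕ, aeval (quarterRoot m ^ k) P =
      ((2 * Real.cos (Real.pi * (k * a) / m) * Real.cos (Real.pi * (k * b) / m) -
        Real.cos (Real.pi * (k * ψ) / m) - Real.cos (Real.pi * (k * n) / (2 * m)) : ℝ) : ℂ) := by
    intro k
    simp only [P, map_mul, map_sub, aeval_cosPoly_two_mul hm, aeval_cosPoly hm, map_ofNat]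
    push_cast
    ring
  have h1 : aeval (quarterRoot m) P = 0 := by
    have h2 := hP 1
    rw [pow_one] at h2
    rw [h2]
    have h3 : (z : ℂ) + (z : ℂ)⁻¹ = 2 * Real.cos (Real.pi * n / (2 * m)) := by
      rw [hznc, quarterRoot_pow, ← Complex.exp_neg, Complex.ofReal_cos, Complex.cos]
      ring_nf
    rw [h3] at hsum
    simp only [Nat.cast_one, one_mul]
    push_cast at hsum ⊢
    linear_combination (-1 / 2) * hsum
  have h2 := aeval_quarterRoot_pow hm hk h1
  rw [hP] at h2
  have h3 := Complex.ofReal_eq_zero.1 h2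
  linarith

/-! ### Cosines of multiples of `π / m` -/

/-- The cosine of `x` units of angle, where the unit is `π / m`. -/
noncomputable def cosi (m : ℕ) (x : ℤ) : ℝ := Real.cos (Real.pi * x / m)

theorem ccos_eq_cosi (m x : ℕ) : ccos m x = cosi m x := by
  simp [ccos, cosi]

theorem cosi_neg (m : ℕ) (x : ℤ) : cosi m (-x) = cosi m x := by
  unfold cosi
  rw [← Real.cos_neg]
  congr 1
  push_cast
  ring

theorem cosi_add_mul {m : ℕ} (hm : 0 < m) (x j : ℤ) :
    cosi m (x + m * j) = (-1) ^ j.natAbs * cosi m x := by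
  have h0 : (m : ℝ) ≠ 0 := by exact_mod_cast hm.ne'
  have h1 : Real.pi * ((x + m * j : ℤ) : ℝ) / m = Real.pi * x / m + j * Real.pi := by
    push_cast
    field_simp
  unfold cosi
  rw [h1, Real.cos_add_int_mul_pi]
  congr 1
  rcases Int.even_or_odd j with h | h
  · rw [h.neg_one_zpow, (Int.natAbs_even.2 h).neg_one_pow]
  · rw [h.neg_one_zpow, (Int.natAbs_odd.2 h).neg_one_pow]

theorem cosi_add_two_mul {m : ℕ} (hm : 0 < m) (x j : ℤ) : cosi m (x + 2 * m * j) = cosi m x := by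
  have := cosi_add_mul hm x (2 * j)
  rw [Int.natAbs_mul, pow_mul] at this
  simpa [show x + 2 * m * j = x + m * (2 * j) by ring] using this

theorem abs_cosi_add_mul {m : ℕ} (hm : 0 < m) (x j : ℤ) : |cosi m (x + m * j)| = |cosi m x| := by
  rw [cosi_add_mul hm, abs_mul, abs_pow, abs_neg, abs_one, one_pow, one_mul]

theorem cosi_two_mul (m : ℕ) (x : ℤ) : cosi m (2 * x) = 2 * cosi m x ^ 2 - 1 := by
  unfold cosi
  rw [← Real.cos_two_mul]
  congr 1
  push_cast
  ring

theorem cosi_three_mul (m : ℕ) (x : ℤ) : cosi m (3 * x) = 4 * cosi m x ^ 3 - 3 * cosi m x := by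
  unfold cosi
  rw [← Real.cos_three_mul]
  congr 1
  push_cast
  ring

theorem two_mul_cosi_mul_cosi (m : ℕ) (x y : ℤ) :
    2 * cosi m x * cosi m y = cosi m (x + y) + cosi m (y - x) := by
  unfold cosi
  rw [Real.two_mul_cos_mul_cos, add_comm]
  congr 1
  · congr 1
    push_cast
    ring
  · rw [← Real.cos_neg]
    congr 1
    push_cast
    ring

theorem cosi_lt_cosi {m : ℕ} (hm : 0 < m) {x y : ℤ} (hx : 0 ≤ x) (hxy : x < y) (hy : y ≤ m) :
    cosi m y < cosi m x := by
  have h0 : (0 : ℝ) < m := by exact_mod_cast hm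
  have hx' : (0 : ℝ) ≤ x := by exact_mod_cast hx
  have hxy' : (x : ℝ) < y := by exact_mod_cast hxy
  have hy' : (y : ℝ) ≤ m := by exact_mod_cast hy
  apply Real.cos_lt_cos_of_nonneg_of_le_pi
  · positivity
  · rw [div_le_iff₀ h0]
    exact mul_le_mul_of_nonneg_left hy' Real.pi_pos.le
  · gcongr

theorem cosi_le_cosi {m : ℕ} (hm : 0 < m) {x y : ℤ} (hx : 0 ≤ x) (hxy : x ≤ y) (hy : y ≤ m) :
    cosi m y ≤ cosi m x := by
  rcases hxy.eq_or_lt with rfl | h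
  · rfl
  · exact (cosi_lt_cosi hm hx h hy).le

theorem cosi_inj {m : ℕ} (hm : 0 < m) {x y : ℤ} (hx : 0 ≤ x) (hxm : x ≤ m) (hy : 0 ≤ y)
    (hym : y ≤ m) (h : cosi m x = cosi m y) : x = y := by
  rcases lt_trichotomy x y with h' | h' | h'
  · exact absurd h (cosi_lt_cosi hm hx h' hym).ne'
  · exact h'
  · exact absurd h (cosi_lt_cosi hm hy h' hxm).ne

theorem cosi_pos {m : ℕ} (hm : 0 < m) {x : ℤ} (hx : 0 ≤ x) (hxm : 2 * x < m) : 0 < cosi m x := by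
  have h0 : (0 : ℝ) < m := by exact_mod_cast hm
  have hx' : (0 : ℝ) ≤ x := by exact_mod_cast hx
  have hxm' : (2 : ℝ) * x < m := by exact_mod_cast hxm
  apply Real.cos_pos_of_mem_Ioo
  constructor
  · have : 0 ≤ Real.pi * x / m := by positivity
    linarith [Real.pi_pos]
  · rw [div_lt_iff₀ h0]
    nlinarith [Real.pi_pos]

theorem cosi_nonneg {m : ℕ} (hm : 0 < m) {x : ℤ} (hx : 0 ≤ x) (hxm : 2 * x ≤ m) :
    0 ≤ cosi m x := by
  rcases hxm.eq_or_lt with h | h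
  · have h0 : (m : ℝ) ≠ 0 := by exact_mod_cast hm.ne'
    have h1 : (m : ℝ) = 2 * x := by exact_mod_cast h.symm
    have h2 : Real.pi * x / m = Real.pi / 2 := by
      rw [div_eq_div_iff h0 (by norm_num), h1]
      ring
    unfold cosi
    rw [h2, Real.cos_pi_div_two]
  · exact (cosi_pos hm hx h).le

theorem abs_cosi_of_dist {m : ℕ} (hm : 0 < m) {x r q : ℤ} (hr : 0 ≤ r) (hrm : 2 * r ≤ m)
    (h : x = m * q + r ∨ x = m * q - r) : |cosi m x| = cosi m r := by
  rcases h with rfl | rfl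
  · rw [add_comm, abs_cosi_add_mul hm, abs_of_nonneg (cosi_nonneg hm hr hrm)]
  · rw [sub_eq_neg_add, abs_cosi_add_mul hm, cosi_neg, abs_of_nonneg (cosi_nonneg hm hr hrm)]

/-! ### Rational angles: the case of an even sum `a + b` -/

/-- The number `2 cos (π a / m) cos (π b / m) - cos (π ψ / m)` is the cosine of a rational angle,
compatibly with the Galois action. -/
def RationalAngle (m a b ψ : ℕ) : Prop :=
  ∃ n : ℕ, ∀ k : ℕ, k.Coprime (4 * m) →
    2 * cosi m (k * a) * cosi m (k * b) =
      cosi m (k * ψ) + Real.cos (Real.pi * (k * n) / (2 * m))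

theorem rationalAngle_of_root_mem {m : ℕ} (hm : 0 < m) {a b ψ : ℕ} {x : ℝ}
    (hx : x ∈ realCyclotomic m)
    (h : cosi m a * cosi m b * (1 + x ^ 2) + Real.sin (Real.pi * ψ / m) * x = cosi m ψ) :
    RationalAngle m a b ψ := by
  obtain ⟨n, hn⟩ := exists_cos_eq_of_root_mem hm a b ψ hx (by simpa [cosi] using h)
  exact ⟨n, fun k hk => by simpa [cosi] using hn k hk⟩

/-- Equality of products of cosines is Galois invariant. -/
theorem prod_cosi_galois {m h k : ℕ} (hm : 0 < m) (hk : k.Coprime (4 * m)) (s t : Fin h → ℕ)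
    (heq : ∏ i, ccos m (s i) = ∏ i, ccos m (t i)) :
    ∏ i, cosi m (k * s i) = ∏ i, cosi m (k * t i) := by
  let P := ∏ i, cosPoly m (2 * s i) - ∏ i, cosPoly m (2 * t i)
  have hP : ∀ k : ℕ, Polynomial.aeval (quarterRoot m ^ k) P =
      ((∏ i, cosi m (k * s i) - ∏ i, cosi m (k * t i) : ℝ) : ℂ) := by
    intro k
    simp only [P, map_sub, map_prod, aeval_cosPoly_two_mul hm, cosi]
    push_cast
    rfl
  have h1 : Polynomial.aeval (quarterRoot m) P = 0 := by
    have := hP 1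
    rw [pow_one] at this
    rw [this]
    simp only [ccos_eq_cosi] at heq
    simp [heq]
  have h2 := aeval_quarterRoot_pow hm hk h1
  rw [hP] at h2
  have h3 := Complex.ofReal_eq_zero.1 h2
  linarith

/-- With `ψ = 0` the remaining cosine would be less than `-1`. -/
theorem not_rationalAngle_zero {m a b k : ℕ} (hk : k.Coprime (4 * m))
    (h : cosi m (k * a) * cosi m (k * b) < 0) : ¬ RationalAngle m a b 0 := by
  rintro ⟨n, hn⟩
  have h1 := hn k hk
  have h2 := Real.neg_one_le_cos (Real.pi * (k * n) / (2 * m))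
  have h3 : cosi m (k * (0 : ℕ)) = 1 := by simp [cosi]
  rw [h3] at h1
  linarith

/-- As `cos ψ = 2 cos² p - 1`, the remaining cosine would exceed `1`. -/
theorem not_rationalAngle_of_lt {m a b k p : ℕ} (hk : k.Coprime (4 * m))
    (h : cosi m (k * p) ^ 2 < cosi m (k * a) * cosi m (k * b)) :
    ¬ RationalAngle m a b (2 * p) := by
  rintro ⟨n, hn⟩
  have h1 := hn k hk
  have h2 := Real.cos_le_one (Real.pi * (k * n) / (2 * m))
  have h3 : cosi m (k * (2 * p : ℕ)) = 2 * cosi m (k * p) ^ 2 - 1 := by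
    rw [← cosi_two_mul]
    congr 1
    push_cast
    ring
  rw [h3] at h1
  linarith

/-- `ra`, `rb`, `rp` are the distances of `k a`, `k b`, `k p` from multiples of `m`. The absolute
value of the cosine decreases as the distance grows to `m / 2`, so `cos² (k p)` is less than the
absolute value of the product. If the product is nonnegative, `ψ = 2 p` works; otherwise `ψ = 0`
does. -/
theorem exists_not_rationalAngle_of_residues {m a b k p : ℕ} (hm : 0 < m)
    (hk : k.Coprime (4 * m)) (hp : 2 * p ≤ a + b)
    (ra rb rp qa qb qp : ℤ) (ha : (k * a : ℤ) = m * qa + ra ∨ (k * a : ℤ) = m * qa - ra)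
    (hb : (k * b : ℤ) = m * qb + rb ∨ (k * b : ℤ) = m * qb - rb)
    (hkp : (k * p : ℤ) = m * qp + rp ∨ (k * p : ℤ) = m * qp - rp)
    (ha0 : 0 ≤ ra) (hb0 : 0 ≤ rb) (hap : ra ≤ rp) (hbp : rb < rp) (hpm : 2 * rp < m)
    (heven : Even (a + b)) :
    ∃ ψ : ℕ, Even (ψ + (a + b)) ∧ ψ ≤ a + b ∧ ¬ RationalAngle m a b ψ := by
  by_cases hneg : cosi m (k * a) * cosi m (k * b) < 0
  · exact ⟨0, by simpa using heven, by omega, not_rationalAngle_zero hk hneg⟩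
  refine ⟨2 * p, (even_two_mul p).add heven, hp, not_rationalAngle_of_lt hk ?_⟩
  have h1 := abs_cosi_of_dist hm ha0 (by omega) ha
  have h2 := abs_cosi_of_dist hm hb0 (by omega) hb
  have h3 := abs_cosi_of_dist hm (by omega) (by omega) hkp
  rw [← abs_of_nonneg (not_lt.1 hneg), abs_mul, h1, h2, ← sq_abs, h3, sq]
  have h4 : 0 < cosi m rp := cosi_pos hm (by omega) hpm
  have h5 : cosi m rp ≤ cosi m ra := cosi_le_cosi hm ha0 hap (by omega)
  have h6 : cosi m rp < cosi m rb := cosi_lt_cosi hm hb0 hbp (by omega)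
  exact mul_lt_mul' h5 h6 h4.le (h4.trans_le h5)

theorem coprime_four_mul {k m : ℕ} (h2 : Odd k) (h : k.Coprime m) : k.Coprime (4 * m) := by
  have h4 : k.Coprime (2 ^ 2) := (Nat.coprime_two_right.2 h2).pow_right 2
  exact Nat.Coprime.mul_right h4 h

/-- In each case a Galois element `k` moves a small number `p` (1 or 2) farther away from the
multiples of `m` than it moves `a` and `b`. -/
theorem exists_not_rationalAngle_even {m a b : ℕ} (ha : 0 < a) (hab : a ≤ b) (hb : 2 * b < m)
    (h11 : ¬ (a = 1 ∧ b = 1)) (h22 : ¬ (a = 2 ∧ b = 2 ∧ (m = 6 ∨ m = 10)))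
    (heven : Even (a + b)) :
    ∃ ψ : ℕ, Even (ψ + (a + b)) ∧ ψ ≤ a + b ∧ ¬ RationalAngle m a b ψ := by
  have hm : 0 < m := by omega
  obtain ⟨e, he⟩ := heven
  rcases Nat.even_or_odd' m with ⟨M, rfl | rfl⟩
  · rcases Nat.even_or_odd' M with ⟨l, rfl | rfl⟩
    · -- `4 ∣ m`
      have hres : ∀ x : ℕ, 0 < x → x < 2 * l → ∃ r q : ℤ,
          (((2 * l - 1 : ℕ) * x : ℤ) = (2 * (2 * l) : ℕ) * q + r ∨
            ((2 * l - 1 : ℕ) * x : ℤ) = (2 * (2 * l) : ℕ) * q - r) ∧ 0 ≤ r ∧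
          (x = 1 → r = 2 * l - 1) ∧ (x ≠ 1 → r < 2 * l - 1) := by
        intro x hx0 hxl
        have hl : ((2 * l - 1 : ℕ) : ℤ) = 2 * l - 1 := by omega
        -- Multiplication by `m / 2 - 1` keeps the distance of an even `x` from the multiples of `m`
        -- and makes that of an odd `x` equal to `m / 2 - x`. So `1` moves farthest.
        rcases Nat.even_or_odd' x with ⟨y, rfl | rfl⟩
        · refine ⟨2 * y, y, Or.inr ?_, by omega, by omega, by omega⟩
          rw [hl]
          push_cast
          ring
        · refine ⟨2 * l - (2 * y + 1), y, Or.inl ?_, by omega, by omega, by omega⟩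
          rw [hl]
          push_cast
          ring
      obtain ⟨ra, qa, h1, h2, h3, h4⟩ := hres a ha (by omega)
      obtain ⟨rb, qb, h5, h6, h7, h8⟩ := hres b (by omega) (by omega)
      refine exists_not_rationalAngle_of_residues hm (k := 2 * l - 1) (p := 1) ?_ (by omega) ra rb
        (2 * l - 1) qa qb 0 h1 h5 (Or.inl (by push_cast; omega)) h2 h6 (by omega) (by omega)
        (by push_cast; omega) ⟨e, he⟩
      apply coprime_four_mul ⟨l - 1, by omega⟩
      have : (2 * l - 1).Coprime (2 * l) := by
        rw [Nat.coprime_comm]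
        exact (Nat.coprime_self_sub_right (by omega)).2 (by simp)
      exact Nat.Coprime.mul_right (Nat.coprime_two_right.2 ⟨l - 1, by omega⟩) this
    · rcases Nat.even_or_odd' a with ⟨a', rfl | rfl⟩
      · obtain ⟨b', rfl⟩ : ∃ b', b = 2 * b' := ⟨e - a', by omega⟩
        by_cases h2 : b' = 1
        · -- `a = b = 2`
          obtain rfl : b' = 1 := h2
          obtain rfl : a' = 1 := by omega
          -- `k = m / 2 - 2` moves `1` to distance `m / 2 - 2` and `2` to distance `4`; the required
          -- `4 < m / 2 - 2` fails exactly for the excluded moduli 6 and 10.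
          refine exists_not_rationalAngle_of_residues hm (k := 2 * l - 1) (p := 1) ?_ (by omega)
            4 4 (2 * l - 1) 1 1 0 (Or.inr (by push_cast; omega)) (Or.inr (by push_cast; omega))
            (Or.inl (by push_cast; omega)) (by omega) (by omega) (by omega) (by omega)
            (by push_cast; omega) ⟨e, he⟩
          have h3 : Odd (2 * l - 1) := ⟨l - 1, by omega⟩
          apply coprime_four_mul h3
          apply Nat.Coprime.mul_right (Nat.coprime_two_right.2 h3)
          rw [show 2 * l + 1 = 2 * l - 1 + 2 by omega]
          simpa using h3
        · have hres : ∀ k x : ℕ, ∀ i : ℤ, (k : ℤ) = l + (2 * l + 1) * i → 0 < x → x ≤ l → ∃ r q : ℤ,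
              ((k * (2 * x : ℕ) : ℤ) = (2 * (2 * l + 1) : ℕ) * q + r ∨
                (k * (2 * x : ℕ) : ℤ) = (2 * (2 * l + 1) : ℕ) * q - r) ∧ 0 ≤ r ∧
              (x = 1 → r = 2 * l) ∧ (x ≠ 1 → r < 2 * l) := by
            intro k x i hk hx0 hxl
            rcases Nat.even_or_odd' x with ⟨y, rfl | rfl⟩
            · refine ⟨2 * y, y + 2 * y * i, Or.inr ?_, by omega, by omega, by omega⟩
              rw [hk]
              push_cast
              ring
            · refine ⟨2 * l + 1 - (2 * y + 1), y + (2 * y + 1) * i, Or.inl ?_, by omega, by omega,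
                by omega⟩
              rw [hk]
              push_cast
              ring
          -- Here `2 k` is `m / 2 - 1` modulo `m`, so `p = 2` moves farthest; adding `m / 2` makes
          -- `k` odd if `l` is even.
          obtain ⟨k, i, hki, hodd, hcop⟩ : ∃ (k : ℕ) (i : ℤ), (k : ℤ) = l + (2 * l + 1) * i ∧
              Odd k ∧ k.Coprime (2 * l + 1) := by
            have hl : l.Coprime (2 * l + 1) := by simp
            rcases Nat.even_or_odd l with h | h
            · refine ⟨l + (2 * l + 1), 1, by push_cast; ring, h.add_odd ⟨l, rfl⟩, ?_⟩
              exact Nat.coprime_add_self_left.2 hl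
            · exact ⟨l, 0, by simp, h, hl⟩
          obtain ⟨ra, qa, h1, h2, h3, h4⟩ := hres k a' i hki (by omega) (by omega)
          obtain ⟨rb, qb, h5, h6, h7, h8⟩ := hres k b' i hki (by omega) (by omega)
          obtain ⟨rp, qp, h9, h10, h11, h12⟩ := hres k 1 i hki (by omega) (by omega)
          exact exists_not_rationalAngle_of_residues hm (k := k) (p := 2 * 1)
            (coprime_four_mul hodd ((Nat.coprime_two_right.2 hodd).mul_right hcop)) (by omega)
            ra rb rp qa qb qp h1 h5 h9 h2 h6 (by omega) (by omega) (by push_cast; omega) ⟨e, he⟩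
      · obtain ⟨b', rfl⟩ : ∃ b', b = 2 * b' + 1 := ⟨e - a' - 1, by omega⟩
        have h3 : Odd (2 * l - 1) := ⟨l - 1, by omega⟩
        have hl : ((2 * l - 1 : ℕ) : ℤ) = 2 * l - 1 := by omega
        -- With `k = m / 2 - 2` an odd `x` moves to the distance `|m / 2 - 2 x|`, which is largest
        -- for `x = 1`.
        have key : ∀ y : ℕ, (((2 * l - 1 : ℕ) : ℤ) * (2 * y + 1 : ℕ) : ℤ) =
            (2 * (2 * l + 1) : ℕ) * y + (2 * l + 1 - 2 * (2 * y + 1)) := by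
          intro y
          rw [hl]
          push_cast
          ring
        refine exists_not_rationalAngle_of_residues hm (k := 2 * l - 1) (p := 1) ?_ (by omega)
          |2 * l + 1 - 2 * (2 * a' + 1)| |2 * l + 1 - 2 * (2 * b' + 1)| (2 * l - 1) a' b' 0
          ?_ ?_ (Or.inl (by push_cast; omega)) (abs_nonneg _) (abs_nonneg _) ?_ ?_
          (by push_cast; omega) ⟨e, he⟩
        · apply coprime_four_mul h3
          apply Nat.Coprime.mul_right (Nat.coprime_two_right.2 h3)
          rw [show 2 * l + 1 = 2 * l - 1 + 2 by omega]
          simpa using h3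
        · rw [key]
          rcases abs_choice (2 * l + 1 - 2 * (2 * a' + 1) : ℤ) with h | h <;> rw [h]
          · left; rfl
          · right; ring
        · rw [key]
          rcases abs_choice (2 * l + 1 - 2 * (2 * b' + 1) : ℤ) with h | h <;> rw [h]
          · left; rfl
          · right; ring
        · rw [abs_le]
          constructor <;> omega
        · rw [abs_lt]
          constructor <;> omega
  · have hres : ∀ k x : ℕ, ∀ i : ℤ, (k : ℤ) = M + (2 * M + 1) * i → 0 < x → x ≤ M → ∃ r q : ℤ,
        ((k * x : ℤ) = (2 * M + 1 : ℕ) * q + r ∨ (k * x : ℤ) = (2 * M + 1 : ℕ) * q - r) ∧ 0 ≤ r ∧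
        (x = 1 → r = M) ∧ (x ≠ 1 → r < M) := by
      intro k x i hk hx0 hxl
      rcases Nat.even_or_odd' x with ⟨y, rfl | rfl⟩
      · refine ⟨y, y + 2 * y * i, Or.inr ?_, by omega, by omega, by omega⟩
        rw [hk]
        push_cast
        ring
      · refine ⟨M - y, y + (2 * y + 1) * i, Or.inl ?_, by omega, by omega, by omega⟩
        rw [hk]
        push_cast
        ring
    -- `k` is `(m - 1) / 2` modulo `m`, so `1` moves farthest; adding `m` makes `k` odd if
    -- necessary.
    obtain ⟨k, i, hki, hodd, hcop⟩ : ∃ (k : ℕ) (i : ℤ), (k : ℤ) = M + (2 * M + 1) * i ∧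
        Odd k ∧ k.Coprime (2 * M + 1) := by
      have hl : M.Coprime (2 * M + 1) := by simp
      rcases Nat.even_or_odd M with h | h
      · refine ⟨M + (2 * M + 1), 1, by push_cast; ring, h.add_odd ⟨M, rfl⟩, ?_⟩
        exact Nat.coprime_add_self_left.2 hl
      · exact ⟨M, 0, by simp, h, hl⟩
    obtain ⟨ra, qa, h1, h2, h3, h4⟩ := hres k a i hki (by omega) (by omega)
    obtain ⟨rb, qb, h5, h6, h7, h8⟩ := hres k b i hki (by omega) (by omega)
    obtain ⟨rp, qp, h9, h10, h11, h12⟩ := hres k 1 i hki (by omega) (by omega)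
    exact exists_not_rationalAngle_of_residues hm (k := k) (p := 1)
      (coprime_four_mul hodd hcop) (by omega)
      ra rb rp qa qb qp h1 h5 h9 h2 h6 (by omega) (by omega) (by push_cast; omega) ⟨e, he⟩

/-! ### Rational angles: odd sum `a + b`, odd modulus -/

theorem mul_eq_of_cosi_eq_cos {m : ℕ} (hm : 0 < m) {x : ℤ} (hx : 0 ≤ x) (hxm : x ≤ m)
    (p q : ℤ) (hq : 0 < q) (hp : 0 ≤ p) (hpq : p ≤ q)
    (h : cosi m x = Real.cos (Real.pi * p / q)) : q * x = p * m := by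
  have hm' : (0 : ℝ) < m := by exact_mod_cast hm
  have hq' : (0 : ℝ) < q := by exact_mod_cast hq
  have hx' : (0 : ℝ) ≤ x := by exact_mod_cast hx
  have hxm' : (x : ℝ) ≤ m := by exact_mod_cast hxm
  have hp' : (0 : ℝ) ≤ p := by exact_mod_cast hp
  have hpq' : (p : ℝ) ≤ q := by exact_mod_cast hpq
  have h1 : Real.pi * x / m = Real.pi * p / q := by
    apply Real.injOn_cos _ _ h
    · constructor
      · positivity
      · rw [div_le_iff₀ hm']
        exact mul_le_mul_of_nonneg_left hxm' Real.pi_pos.le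
    · constructor
      · positivity
      · rw [div_le_iff₀ hq']
        exact mul_le_mul_of_nonneg_left hpq' Real.pi_pos.le
  rw [div_eq_div_iff hm'.ne' hq'.ne', mul_assoc, mul_assoc] at h1
  have h2 := mul_left_cancel₀ Real.pi_ne_zero h1
  have h3 : x * q = p * (m : ℤ) := by exact_mod_cast h2
  linarith

theorem cos_two_pi_div_three : Real.cos (Real.pi * (2 : ℤ) / (3 : ℤ)) = -(1 / 2) := by
  rw [show Real.pi * ((2 : ℤ) : ℝ) / ((3 : ℤ) : ℝ) = Real.pi - Real.pi / 3 by push_cast; ring,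
    Real.cos_pi_sub, Real.cos_pi_div_three]

theorem cos_two_pi_div_five : Real.cos (Real.pi * (2 : ℤ) / (5 : ℤ)) = (√5 - 1) / 4 := by
  rw [show Real.pi * ((2 : ℤ) : ℝ) / ((5 : ℤ) : ℝ) = 2 * (Real.pi / 5) by push_cast; ring,
    Real.cos_two_mul, Real.cos_pi_div_five]
  have : √5 ^ 2 = 5 := Real.sq_sqrt (by norm_num)
  linear_combination (1 / 8) * this

theorem cos_four_pi_div_five : Real.cos (Real.pi * (4 : ℤ) / (5 : ℤ)) = -((√5 + 1) / 4) := by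
  rw [show Real.pi * ((4 : ℤ) : ℝ) / ((5 : ℤ) : ℝ) = Real.pi - Real.pi / 5 by push_cast; ring,
    Real.cos_pi_sub, Real.cos_pi_div_five]
  ring

theorem cubic_roots {c : ℝ} (h : 8 * c ^ 3 + 8 * c ^ 2 = 1) :
    c = -(1 / 2) ∨ c = (√5 - 1) / 4 ∨ c = -((√5 + 1) / 4) := by
  have h5 : √5 ^ 2 = 5 := Real.sq_sqrt (by norm_num)
  have : (c - -(1 / 2)) * ((c - (√5 - 1) / 4) * (c - -((√5 + 1) / 4))) = 0 := by
    linear_combination (1 / 8) * h - (1 / 16) * (c + 1 / 2) * h5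
  rcases mul_eq_zero.1 this with h | h
  · exact Or.inl (sub_eq_zero.1 h)
  · rcases mul_eq_zero.1 h with h | h
    · exact Or.inr (Or.inl (sub_eq_zero.1 h))
    · exact Or.inr (Or.inr (sub_eq_zero.1 h))

/-- A relation `X + Y + V = W` that is preserved by three iterations of `x ↦ 2 x² - 1`. -/
theorem doubling_cubic {X Y V W : ℝ} {T : ℝ → ℝ} (hT : ∀ x, T x = 2 * x ^ 2 - 1)
    (h0 : X + Y + V = W) (h1 : T X + T Y + T V = T W) (h2 : T (T X) + T (T Y) + T (T V) = T (T W))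
    (h3 : T (T (T X)) + T (T (T Y)) + T (T (T V)) = T (T (T W))) :
    8 * T W ^ 3 + 8 * T W ^ 2 = 1 := by
  -- Comparing the sum of the squares with the square of the sum fixes the second elementary
  -- symmetric function of `X`, `Y`, `V`. The next doubling expresses their product by `W`, and a
  -- further one leaves an equation in `W` alone.
  have step : ∀ X Y V W, X + Y + V = W → T X + T Y + T V = T W →
      X * Y + X * V + Y * V = -(1 / 2) := by
    intro X Y V W h0 h1
    simp only [hT] at h1
    rw [← h0] at h1
    linear_combination (-1 / 4) * h1
  have step2 : ∀ X Y V W, X + Y + V = W → T X + T Y + T V = T W → T (T X) + T (T Y) + T (T V) =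
      T (T W) → 8 * (W * (X * Y * V)) = 1 / 2 - 4 * W ^ 2 := by
    intro X Y V W h0 h1 h2
    have e1 := step X Y V W h0 h1
    have e2 := step _ _ _ _ h1 h2
    simp only [hT] at e2
    rw [← h0]
    linear_combination (-1) * e2 + (4 * (X * Y + X * V + Y * V - 1 / 2) + 8) * e1
  have e2 := step X Y V W h0 h1
  have e3 := step2 X Y V W h0 h1 h2
  have e3' := step2 _ _ _ _ h1 h2 h3
  have hprod : T X * T Y * T V = 2 * (2 * (X * Y * V) + W) ^ 2 := by
    simp only [hT]
    rw [← h0]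
    linear_combination (-4 * (X * Y + X * V + Y * V) - 2) * e2
  have h32 : 32 * W ^ 2 * (T X * T Y * T V) = 1 := by
    rw [hprod]
    linear_combination (8 * (2 * (W * (X * Y * V)) + W ^ 2) + 1) * (2 * e3)
  have hW : T W = 2 * W ^ 2 - 1 := hT W
  linear_combination (4 * W ^ 2) * e3' - T W * h32 - (1 - 8 * T W ^ 2) * hW

/-- For odd `m` this Galois element doubles angles up to a sign; it replaces `2`, which is not
coprime to `4 m`. -/
theorem cosi_mul_add_two {m : ℕ} (hm : 0 < m) (y : ℤ) :
    cosi m ((m + 2) * y) = (-1) ^ y.natAbs * (2 * cosi m y ^ 2 - 1) := by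
  rw [← cosi_two_mul, ← cosi_add_mul hm]
  congr 1
  ring

/-- The two forms of the relation between cosines: the rational angle is a multiple of `π / m`, or
its cosine vanishes. -/
theorem RationalAngle.cases {m a b ψ : ℕ} (hm : 0 < m) (h : RationalAngle m a b ψ) :
    (∃ c : ℕ, ∀ k : ℕ, k.Coprime (4 * m) →
      cosi m (k * (a + b)) + cosi m (k * (b - a)) = cosi m (k * ψ) + cosi m (k * c)) ∨
    (∀ k : ℕ, k.Coprime (4 * m) →
      cosi m (k * (a + b)) + cosi m (k * (b - a)) = cosi m (k * ψ)) := by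
  have hmr : (m : ℝ) ≠ 0 := by exact_mod_cast hm.ne'
  obtain ⟨n, hn⟩ := h
  have rel : ∀ k : ℕ, k.Coprime (4 * m) → cosi m (k * (a + b)) + cosi m (k * (b - a)) =
      cosi m (k * ψ) + Real.cos (Real.pi * (k * n) / (2 * m)) := by
    intro k hk
    rw [← hn k hk, two_mul_cosi_mul_cosi, mul_add, mul_sub]
  rcases Nat.even_or_odd' n with ⟨c, rfl | rfl⟩
  · refine Or.inl ⟨c, fun k hk => ?_⟩
    rw [rel k hk]
    congr 1
    unfold cosi
    congr 1
    push_cast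
    field_simp
  · right
    intro k hk
    -- The element `1 + 2 m` fixes the cosines of multiples of `π / m` but negates those of odd
    -- multiples of `π / (2 m)`, so here the cosine vanishes.
    have hper : ∀ y : ℤ, cosi m ((k * (1 + 2 * m) : ℕ) * y) = cosi m (k * y) := by
      intro y
      rw [← cosi_add_two_mul hm (k * y) (k * y)]
      congr 1
      push_cast
      ring
    have h1m : (1 + 2 * m).Coprime (4 * m) := by
      apply coprime_four_mul ⟨m, by ring⟩
      simp
    have e1 := rel k hk
    have e2 := rel (k * (1 + 2 * m)) (hk.mul_left h1m)
    rw [hper, hper, hper] at e2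
    have hko : Odd k := by
      have : k.Coprime (2 * (2 * m)) := by rwa [← mul_assoc]
      exact Nat.coprime_two_right.1 (Nat.Coprime.coprime_mul_right_right this)
    have e3 : Real.cos (Real.pi * ((k * (1 + 2 * m) : ℕ) * (2 * c + 1 : ℕ)) / (2 * m)) =
        -Real.cos (Real.pi * (k * (2 * c + 1 : ℕ)) / (2 * m)) := by
      have e4 : Real.pi * ((k * (1 + 2 * m) : ℕ) * (2 * c + 1 : ℕ)) / (2 * m) =
          Real.pi * (k * (2 * c + 1 : ℕ)) / (2 * m) + (k * (2 * c + 1) : ℕ) * Real.pi := by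
        push_cast
        field_simp
      rw [e4, Real.cos_add_nat_mul_pi, (hko.mul ⟨c, rfl⟩).neg_one_pow]
      ring
    rw [e3] at e2
    linarith

/-- Apply `m + 2` repeatedly to `cos A + cos B = cos ψ + cos c`, where `A = a + b`, `B = b - a`. If
`c` is odd, all signs agree, the two sides have equal sums and equal sums of squares, and the terms
match. If `c` is even, `doubling_cubic` gives a cubic equation for `cos (2 ψ)`, with the roots `cos
(2π/3)`, `cos (2π/5)`, `cos (4π/5)`. Without the fourth cosine, `cos ψ` is `1/2` or `-1/2`. -/
theorem rationalAngle_odd_modulus {m a b ψ : ℕ} (hm : Odd m) (ha : 0 < a) (hab : a ≤ b)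
    (hb : 2 * b < m) (hodd : Odd (a + b)) (hψ : Odd ψ) (hψA : ψ ≤ a + b)
    (h : RationalAngle m a b ψ) :
    ψ = a + b ∨ ψ + a = b ∨ 3 * ψ = m ∨ 3 * ψ = 2 * m ∨ 5 * ψ = m ∨ 5 * ψ = 2 * m ∨
      5 * ψ = 3 * m ∨ 5 * ψ = 4 * m := by
  have hm0 : 0 < m := by omega
  set A : ℤ := a + b with hA
  set B : ℤ := b - a with hB
  have hAo : Odd A := by
    rw [hA]
    exact_mod_cast hodd
  have hBo : Odd B := by
    have : B = A - 2 * a := by omega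
    rw [this]
    exact hAo.sub_even (even_two_mul _)
  have hψo : Odd (ψ : ℤ) := by exact_mod_cast hψ
  have hm2 : (m + 2).Coprime (4 * m) := by
    apply coprime_four_mul (hm.add_even even_two)
    simpa [Nat.coprime_comm] using hm
  have hflip : ∀ y : ℤ, Odd y → cosi m ((m + 2) * y) = -(2 * cosi m y ^ 2 - 1) := by
    intro y hy
    rw [cosi_mul_add_two hm0, (Int.natAbs_odd.2 hy).neg_one_pow]
    ring
  have hm2o : Odd ((m : ℤ) + 2) := by exact_mod_cast hm.add_even even_two
  have h1c : (1 : ℕ).Coprime (4 * m) := Nat.coprime_one_left _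
  have htriv : cosi m A = cosi m ψ ∨ cosi m B = cosi m ψ → ψ = a + b ∨ ψ + a = b := by
    rintro (h | h)
    · have := cosi_inj hm0 (by omega) (by omega) (by omega) (by omega) h
      omega
    · have := cosi_inj hm0 (by omega) (by omega) (by omega) (by omega) h
      omega
  rcases h.cases hm0 with ⟨c, rel⟩ | rel
  · rw [← hA, ← hB] at rel
    have hrel1 := rel 1 h1c
    have hrel2 := rel (m + 2) hm2
    simp only [Nat.cast_one, one_mul] at hrel1
    push_cast at hrel2
    rw [hflip _ hAo, hflip _ hBo, hflip _ hψo] at hrel2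
    rcases Int.even_or_odd (c : ℤ) with hce | hco
    · have hstep : ∀ y : ℤ, Even y → cosi m ((m + 2) * y) = 2 * cosi m y ^ 2 - 1 := by
        intro y hy
        rw [cosi_mul_add_two hm0, (Int.natAbs_even.2 hy).neg_one_pow, one_mul]
      have hrel3 := rel ((m + 2) ^ 2) (hm2.pow_left 2)
      have hrel4 := rel ((m + 2) ^ 3) (hm2.pow_left 3)
      push_cast at hrel3 hrel4
      simp only [pow_succ, pow_zero, one_mul, mul_assoc] at hrel3 hrel4
      have ho : ∀ y : ℤ, Odd y → Odd (((m : ℤ) + 2) * y) := fun y hy => hm2o.mul hy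
      have hev : ∀ y : ℤ, Even y → Even (((m : ℤ) + 2) * y) := fun y hy => hy.mul_left _
      rw [hflip _ (ho _ hAo), hflip _ (ho _ hBo), hflip _ (ho _ hψo), hstep _ (hev _ hce),
        hflip _ hAo, hflip _ hBo, hflip _ hψo, hstep _ hce] at hrel3
      rw [hflip _ (ho _ (ho _ hAo)), hflip _ (ho _ (ho _ hBo)), hflip _ (ho _ (ho _ hψo)),
        hstep _ (hev _ (hev _ hce)), hflip _ (ho _ hAo), hflip _ (ho _ hBo), hflip _ (ho _ hψo),
        hstep _ (hev _ hce), hflip _ hAo, hflip _ hBo, hflip _ hψo, hstep _ hce] at hrel4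
      rw [hstep _ hce] at hrel2
      have key := doubling_cubic (X := -cosi m A) (Y := -cosi m B) (V := cosi m c)
        (W := -cosi m ψ) (T := fun x => 2 * x ^ 2 - 1) (fun _ => rfl) (by linarith)
        (by linear_combination -hrel2) (by linear_combination -hrel3) (by linear_combination -hrel4)
      simp only [neg_sq] at key
      rw [← cosi_two_mul] at key
      have hroots : ∀ y : ℤ, 0 ≤ y → y ≤ m → 8 * cosi m y ^ 3 + 8 * cosi m y ^ 2 = 1 →
          3 * y = 2 * m ∨ 5 * y = 2 * m ∨ 5 * y = 4 * m := by
        intro y hy hym hcub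
        rcases cubic_roots hcub with h | h | h
        · left
          rw [← cos_two_pi_div_three] at h
          exact mul_eq_of_cosi_eq_cos hm0 hy hym 2 3 (by norm_num) (by norm_num) (by norm_num) h
        · right; left
          rw [← cos_two_pi_div_five] at h
          exact mul_eq_of_cosi_eq_cos hm0 hy hym 2 5 (by norm_num) (by norm_num) (by norm_num) h
        · right; right
          rw [← cos_four_pi_div_five] at h
          exact mul_eq_of_cosi_eq_cos hm0 hy hym 4 5 (by norm_num) (by norm_num) (by norm_num) h
      -- The roots are identified only for arguments in `[0, m]`; a larger `2 ψ` is reflected to `2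
      -- m - 2 ψ`.
      rcases le_total (2 * (ψ : ℤ)) m with hle | hle
      · have := hroots _ (by omega) hle key
        omega
      · have h2 : cosi m (2 * ψ) = cosi m (2 * m - 2 * ψ) := by
          rw [← cosi_neg, ← cosi_add_two_mul hm0 _ 1]
          congr 1
          ring
        rw [h2] at key
        have := hroots _ (by omega) (by omega) key
        omega
    · rw [hflip _ hco] at hrel2
      have : (cosi m A - cosi m ψ) * (cosi m B - cosi m ψ) = 0 := by
        have h3 : cosi m c = cosi m A + cosi m B - cosi m ψ := by linarith
        rw [h3] at hrel2
        linear_combination (1 / 4) * hrel2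
      have := htriv (by
        rcases mul_eq_zero.1 this with h | h
        · exact Or.inl (sub_eq_zero.1 h)
        · exact Or.inr (sub_eq_zero.1 h))
      tauto
  · rw [← hA, ← hB] at rel
    have hrel1 := rel 1 h1c
    have hrel2 := rel (m + 2) hm2
    have hrel3 := rel ((m + 2) ^ 2) (hm2.pow_left 2)
    simp only [Nat.cast_one, one_mul] at hrel1
    push_cast at hrel2 hrel3
    rw [hflip _ hAo, hflip _ hBo, hflip _ hψo] at hrel2
    simp only [pow_succ, pow_zero, one_mul, mul_assoc] at hrel3
    have ho : ∀ y : ℤ, Odd y → Odd (((m : ℤ) + 2) * y) := fun y hy => hm2o.mul hy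
    rw [hflip _ (ho _ hAo), hflip _ (ho _ hBo), hflip _ (ho _ hψo),
      hflip _ hAo, hflip _ hBo, hflip _ hψo] at hrel3
    have hW : cosi m ψ = cosi m A + cosi m B := by linarith
    have hXY : cosi m A * cosi m B = -(1 / 4) := by
      rw [hW] at hrel2
      linear_combination (1 / 4) * hrel2
    have hsq : cosi m ψ ^ 2 = 1 / 4 := by
      have h5 : 2 * cosi m ψ ^ 2 - 1 = 2 * cosi m A ^ 2 - 1 + (2 * cosi m B ^ 2 - 1) := by linarith
      have h6 : (2 * cosi m A ^ 2 - 1) * (2 * cosi m B ^ 2 - 1) = -(1 / 4) := by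
        have : 2 * (-(2 * cosi m ψ ^ 2 - 1)) ^ 2 - 1 = 2 * (-(2 * cosi m A ^ 2 - 1)) ^ 2 - 1 +
          (2 * (-(2 * cosi m B ^ 2 - 1)) ^ 2 - 1) := by linarith
        rw [h5] at this
        linear_combination (1 / 4) * this
      rw [hW]
      linear_combination (-1 / 2) * h6 + (2 * cosi m A * cosi m B + 3 / 2) * hXY
    have : (cosi m ψ - 1 / 2) * (cosi m ψ - -(1 / 2)) = 0 := by linear_combination hsq
    rcases mul_eq_zero.1 this with h | h
    · have h7 : cosi m ψ = Real.cos (Real.pi * (1 : ℤ) / (3 : ℤ)) := by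
        rw [sub_eq_zero.1 h, ← Real.cos_pi_div_three]
        congr 1
        push_cast
        ring
      have := mul_eq_of_cosi_eq_cos hm0 (by omega) (by omega) 1 3 (by norm_num) (by norm_num)
        (by norm_num) h7
      omega
    · have h7 : cosi m ψ = Real.cos (Real.pi * (2 : ℤ) / (3 : ℤ)) := by
        rw [sub_eq_zero.1 h, cos_two_pi_div_three]
      have := mul_eq_of_cosi_eq_cos hm0 (by omega) (by omega) 2 3 (by norm_num) (by norm_num)
        (by norm_num) h7
      omega

/-! ### Rational angles: odd sum, modulus divisible by four -/

theorem cosi_eq_cosi {m : ℕ} (hm : 0 < m) {x y : ℤ} (h : cosi m x = cosi m y) :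
    ∃ j : ℤ, x - y = 2 * m * j ∨ x + y = 2 * m * j := by
  have hm' : (m : ℝ) ≠ 0 := by exact_mod_cast hm.ne'
  unfold cosi at h
  obtain ⟨k, hk⟩ := Real.cos_eq_cos_iff.1 h
  rcases hk with hk | hk
  · refine ⟨-k, Or.inl ?_⟩
    field_simp at hk
    have : (y : ℤ) = (2 * m * k + x : ℤ) := by
      have h2 : (y : ℝ) = 2 * m * k + x := by linarith
      exact_mod_cast h2
    rw [this]
    ring
  · refine ⟨k, Or.inr ?_⟩
    field_simp at hk
    have : (y : ℤ) = (2 * m * k - x : ℤ) := by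
      have h2 : (y : ℝ) = 2 * m * k - x := by linarith
      exact_mod_cast h2
    rw [this]
    ring

theorem odd_multiple_cases {m : ℕ} {x j : ℤ} (h0 : 0 < x) (h6 : x < 6 * m)
    (h : x = m * (2 * j + 1)) : x = m ∨ x = 3 * m ∨ x = 5 * m := by
  have hm : (0 : ℤ) < m := by omega
  have h1 : 0 ≤ j := by
    by_contra hj
    nlinarith
  have h2 : j ≤ 2 := by
    by_contra hj
    nlinarith
  interval_cases j <;> omega

/-- Two sums of two complex numbers of norm one. -/
theorem unit_add_eq_add {p q r s : ℂ} (hp : ‖p‖ = 1) (hq : ‖q‖ = 1) (hr : ‖r‖ = 1) (hs : ‖s‖ = 1)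
    (h : p + q = r + s) : p + q = 0 ∨ p = r ∨ q = r := by
  have conj : ∀ {z : ℂ}, ‖z‖ = 1 → z * (starRingEnd ℂ) z = 1 := by
    intro z hz
    rw [Complex.mul_conj', hz]
    norm_num
  -- Conjugation inverts numbers of norm one. So unless the sum vanishes, both pairs have the same
  -- product as well as the same sum.
  have h' : (starRingEnd ℂ) p + (starRingEnd ℂ) q = (starRingEnd ℂ) r + (starRingEnd ℂ) s := by
    rw [← map_add, ← map_add, h]
  have key : (p + q) * ((p - r) * (q - r)) = 0 := by
    have e1 : (p + q) * (r * s) = (r + s) * (p * q) := by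
      linear_combination (p * q * r * s) * h' - (q * r * s) * conj hp - (p * r * s) * conj hq +
        (p * q * s) * conj hr + (p * q * r) * conj hs
    have e2 : s = p + q - r := by rw [h]; ring
    subst e2
    linear_combination (-1 : ℂ) * e1
  rcases mul_eq_zero.1 key with h | h
  · exact Or.inl h
  · rcases mul_eq_zero.1 h with h | h
    · exact Or.inr (Or.inl (sub_eq_zero.1 h))
    · exact Or.inr (Or.inr (sub_eq_zero.1 h))

/-- Two complex numbers of norm one whose sum has norm one. -/
theorem unit_add_eq_unit {p q r : ℂ} (hp : ‖p‖ = 1) (hq : ‖q‖ = 1) (hr : ‖r‖ = 1)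
    (h : p + q = r) : p ^ 3 = q ^ 3 := by
  have conj : ∀ {z : ℂ}, ‖z‖ = 1 → z * (starRingEnd ℂ) z = 1 := by
    intro z hz
    rw [Complex.mul_conj', hz]
    norm_num
  have h' : (starRingEnd ℂ) p + (starRingEnd ℂ) q = (starRingEnd ℂ) r := by
    rw [← map_add, h]
  have e1 : (p + q) * r = p * q := by
    linear_combination (p * q * r) * h' - (q * r) * conj hp - (p * r) * conj hq +
      (p * q) * conj hr
  rw [← h] at e1
  linear_combination (p - q) * e1

theorem re_pow_three {z : ℂ} (hz : ‖z‖ = 1) : (z ^ 3).re = 4 * z.re ^ 3 - 3 * z.re := by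
  have h := Complex.sq_norm z
  rw [hz, Complex.normSq_apply] at h
  simp only [pow_succ, pow_zero, one_mul, Complex.mul_re, Complex.mul_im]
  linear_combination 3 * z.re * h

theorem im_pow_three {z : ℂ} (hz : ‖z‖ = 1) : (z ^ 3).im = 3 * z.im - 4 * z.im ^ 3 := by
  have h := Complex.sq_norm z
  rw [hz, Complex.normSq_apply] at h
  simp only [pow_succ, pow_zero, one_mul, Complex.mul_re, Complex.mul_im]
  linear_combination (-3) * z.im * h

/-- For an even modulus and odd arguments, the rational angle may be assumed to be an odd multiple
of `π / m`, unless its cosine vanishes. -/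
theorem RationalAngle.cases_even {m a b ψ : ℕ} (hm : 0 < m) (hme : Even m) (hodd : Odd (a + b))
    (hψ : Odd ψ) (h : RationalAngle m a b ψ) :
    (∃ c : ℕ, Odd c ∧ ∀ k : ℕ, k.Coprime (4 * m) →
      cosi m (k * (a + b)) + cosi m (k * (b - a)) = cosi m (k * ψ) + cosi m (k * c)) ∨
    (∀ k : ℕ, k.Coprime (4 * m) →
      cosi m (k * (a + b)) + cosi m (k * (b - a)) = cosi m (k * ψ)) := by
  rcases h.cases hm with ⟨c, rel⟩ | rel
  · rcases Nat.even_or_odd c with hc | hc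
    · right
      intro k hk
      have hodd' : Odd ((a : ℤ) + b) := by exact_mod_cast hodd
      have hψ' : Odd (ψ : ℤ) := by exact_mod_cast hψ
      have hodd'' : Odd ((b : ℤ) - a) := by
        rw [show (b : ℤ) - a = a + b - 2 * a by ring]
        exact hodd'.sub_even (even_two_mul _)
      have hc' : Even (c : ℤ) := by exact_mod_cast hc
      -- The Galois element `m + 1` negates the three cosines with odd arguments and fixes the one
      -- with even `c`, which must therefore vanish.
      have hm1 : (m + 1).Coprime (4 * m) := by
        apply coprime_four_mul hme.add_one
        simp
      have hko : Odd (k : ℤ) := by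
        have : k.Coprime (2 * (2 * m)) := by rwa [← mul_assoc]
        exact_mod_cast Nat.coprime_two_right.1 (Nat.Coprime.coprime_mul_right_right this)
      have e1 := rel k hk
      have e2 := rel (k * (m + 1)) (hk.mul_left hm1)
      have key : ∀ y : ℤ, cosi m ((k * (m + 1) : ℕ) * y) =
          (-1) ^ (k * y).natAbs * cosi m (k * y) := by
        intro y
        rw [← cosi_add_mul hm]
        congr 1
        push_cast
        ring
      rw [key, key, key, key, (Int.natAbs_odd.2 (hko.mul hodd')).neg_one_pow,
        (Int.natAbs_odd.2 (hko.mul hodd'')).neg_one_pow,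
        (Int.natAbs_odd.2 (hko.mul hψ')).neg_one_pow,
        (Int.natAbs_even.2 (hc'.mul_left _)).neg_one_pow] at e2
      linarith
    · exact Or.inl ⟨c, hc, rel⟩
  · exact Or.inr rel

/-- The Galois element `1 + m / 2` adds a quarter turn, up to half turns, to an odd argument, so it
turns the cosine into the sine up to sign. -/
theorem cosi_sq_add_sq {l : ℕ} (hl : 0 < l) {y : ℤ} (hy : Odd y) :
    cosi (4 * l) y ^ 2 + cosi (4 * l) ((1 + 2 * l) * y) ^ 2 = 1 := by
  obtain ⟨j, rfl⟩ := hy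
  have hl' : (l : ℝ) ≠ 0 := by exact_mod_cast hl.ne'
  have h1 : Real.pi * (((1 + 2 * l) * (2 * j + 1) : ℤ) : ℝ) / ((4 * l : ℕ) : ℝ) =
      Real.pi * ((2 * j + 1 : ℤ) : ℝ) / ((4 * l : ℕ) : ℝ) + Real.pi / 2 + j * Real.pi := by
    push_cast
    field_simp
    ring
  unfold cosi
  rw [h1, Real.cos_add_int_mul_pi, Real.cos_add_pi_div_two, mul_pow, neg_sq,
    ← zpow_natCast ((-1 : ℝ) ^ j), ← zpow_mul, mul_comm j, zpow_mul]
  norm_num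

/-- A cosine together with its conjugate under `1 + 2 * l` forms a point of the unit circle, so the
relation equates two sums of two unit vectors and the terms match; the sum is nonzero because `cos A
+ cos B = 2 cos a cos b > 0`. If the fourth cosine vanishes, the cubes of the two unit vectors
agree, so `3 a` or `3 b` is the modulus. -/
theorem rationalAngle_four_dvd {l a b ψ : ℕ} (hab : a ≤ b) (ha : 0 < a)
    (hb : 2 * b < 4 * l) (hodd : Odd (a + b)) (hψ : Odd ψ) (hψA : ψ ≤ a + b)
    (h : RationalAngle (4 * l) a b ψ) :
    ψ = a + b ∨ ψ + a = b ∨ (3 * a = 4 * l ∧ ψ = b) ∨ (3 * b = 4 * l ∧ ψ = a) := by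
  set m := 4 * l with hm
  have hm0 : 0 < m := by omega
  have hl : 0 < l := by omega
  have hAo : Odd ((a : ℤ) + b) := by exact_mod_cast hodd
  have hψo : Odd (ψ : ℤ) := by exact_mod_cast hψ
  have hBo : Odd ((b : ℤ) - a) := by
    rw [show (b : ℤ) - a = a + b - 2 * a by ring]
    exact hAo.sub_even (even_two_mul _)
  let P : ℤ → ℂ := fun y => ⟨cosi m y, cosi m ((1 + 2 * l) * y)⟩
  have hP : ∀ y : ℤ, Odd y → ‖P y‖ = 1 := by
    intro y hy
    have : ‖P y‖ ^ 2 = 1 := by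
      rw [Complex.sq_norm, Complex.normSq_apply, ← sq, ← sq]
      exact cosi_sq_add_sq hl hy
    nlinarith [norm_nonneg (P y)]
  have hk : (1 + 2 * l).Coprime (4 * m) := by
    have h2 : Odd (1 + 2 * l) := ⟨l, by ring⟩
    apply coprime_four_mul h2
    apply coprime_four_mul h2
    simp
  have h1c : (1 : ℕ).Coprime (4 * m) := Nat.coprime_one_left _
  have ha' : 0 < cosi m a := cosi_pos hm0 (by omega) (by omega)
  have hb' : 0 < cosi m b := cosi_pos hm0 (by omega) (by omega)
  have hsum := two_mul_cosi_mul_cosi m a b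
  rcases h.cases_even hm0 ⟨2 * l, by omega⟩ hodd hψ with ⟨c, hc, rel⟩ | rel
  · have hco : Odd (c : ℤ) := by exact_mod_cast hc
    have e1 := rel 1 h1c
    have e2 := rel _ hk
    push_cast at e1 e2
    simp only [one_mul] at e1
    rcases unit_add_eq_add (hP _ hAo) (hP _ hBo) (hP _ hψo) (hP _ hco)
      (Complex.ext e1 e2) with h | h | h
    · have := congrArg Complex.re h
      change cosi m (a + b) + cosi m (b - a) = 0 at this
      rw [← hsum] at this
      have : 0 < 2 * cosi m a * cosi m b := by positivity
      linarith
    · have h' : (P (a + b)).re = (P ψ).re := by rw [h]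
      have h'' : cosi m (a + b) = cosi m ψ := h'
      have := cosi_inj (x := a + b) (y := ψ) hm0 (by omega) (by omega) (by omega) (by omega) h''
      omega
    · have h' : (P (b - a)).re = (P ψ).re := by rw [h]
      have h'' : cosi m (b - a) = cosi m ψ := h'
      have := cosi_inj (x := b - a) (y := ψ) hm0 (by omega) (by omega) (by omega) (by omega) h''
      omega
  · have e1 := rel 1 h1c
    have e2 := rel _ hk
    push_cast at e1 e2
    simp only [one_mul] at e1
    have h3 := unit_add_eq_unit (hP _ hAo) (hP _ hBo) (hP _ hψo) (Complex.ext e1 e2)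
    have h4 := congrArg Complex.re h3
    rw [re_pow_three (hP _ hAo), re_pow_three (hP _ hBo)] at h4
    change 4 * cosi m _ ^ 3 - 3 * cosi m _ = 4 * cosi m _ ^ 3 - 3 * cosi m _ at h4
    rw [← cosi_three_mul, ← cosi_three_mul] at h4
    have hhalf : ∀ y : ℕ, 3 * y = m → cosi m y = 1 / 2 := by
      intro y hy
      have h3 : (m : ℝ) = 3 * y := by exact_mod_cast hy.symm
      have hy0 : (y : ℝ) ≠ 0 := by
        have : y ≠ 0 := by omega
        exact_mod_cast this
      rw [← Real.cos_pi_div_three]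
      unfold cosi
      congr 1
      rw [h3]
      push_cast
      field_simp
    obtain ⟨j, hj | hj⟩ := cosi_eq_cosi hm0 h4
    · have hj1 : (3 * a : ℤ) = m * j := by linarith
      have hj2 : j = 1 := by
        have h5 : 0 < j := by
          by_contra h
          nlinarith
        have h6 : j < 2 := by
          by_contra h
          nlinarith
        omega
      have h3a : 3 * a = m := by
        rw [hj2] at hj1
        omega
      rw [hhalf a h3a] at hsum
      have := cosi_inj (x := ψ) (y := b) hm0 (by omega) (by omega) (by omega) (by omega)
        (by linarith)
      omega
    · have hj1 : (3 * b : ℤ) = m * j := by linarith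
      have hj2 : j = 1 := by
        have h5 : 0 < j := by
          by_contra h
          nlinarith
        have h6 : j < 2 := by
          by_contra h
          nlinarith
        omega
      have h3b : 3 * b = m := by
        rw [hj2] at hj1
        omega
      rw [hhalf b h3b] at hsum
      have := cosi_inj (x := ψ) (y := a) hm0 (by omega) (by omega) (by omega) (by omega)
        (by linarith)
      omega

/-! ### Rational angles: odd sum, modulus twice an odd number -/

/-- Four roots of unity of odd order whose sum, sum of squares and sum of fourth powers are
invariant under inversion. -/
theorem four_roots_of_unity {M : ℕ} (hM : Odd M) {a b c d : ℂ} (ha : a ^ M = 1) (hb : b ^ M = 1)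
    (hc : c ^ M = 1) (hd : d ^ M = 1)
    (h1 : a + b + c + d = a⁻¹ + b⁻¹ + c⁻¹ + d⁻¹)
    (h2 : a ^ 2 + b ^ 2 + c ^ 2 + d ^ 2 = a⁻¹ ^ 2 + b⁻¹ ^ 2 + c⁻¹ ^ 2 + d⁻¹ ^ 2)
    (h4 : a ^ 4 + b ^ 4 + c ^ 4 + d ^ 4 = a⁻¹ ^ 4 + b⁻¹ ^ 4 + c⁻¹ ^ 4 + d⁻¹ ^ 4) :
    a * b = 1 ∨ a * c = 1 ∨ b * c = 1 ∨
      ∃ E : ℂ, (a = 1 ∨ a ^ 3 = E) ∧ (b = 1 ∨ b ^ 3 = E) ∧ (c = 1 ∨ c ^ 3 = E) := by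
  have hM0 : M ≠ 0 := by
    rintro rfl
    simp at hM
  have ne0 : ∀ {z : ℂ}, z ^ M = 1 → z ≠ 0 := by
    rintro z hz rfl
    rw [zero_pow hM0] at hz
    exact zero_ne_one hz
  have ha0 := ne0 ha
  have hb0 := ne0 hb
  have hc0 := ne0 hc
  have hd0 := ne0 hd
  -- In terms of elementary symmetric functions, the first relation says `e3 = e1 E` and the second
  -- one `e2 = 0` unless `E = 1`.
  set E := a * b * c * d with hE
  have hEM : E ^ M = 1 := by simp [hE, mul_pow, ha, hb, hc, hd]
  have hE0 := ne0 hEM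
  set e1 := a + b + c + d with he1
  set e2 := a * b + a * c + a * d + b * c + b * d + c * d with he2
  have g1 : b * c * d + a * c * d + a * b * d + a * b * c = e1 * E := by
    rw [h1, hE]
    field_simp
  have g2 : e2 * (E - 1) = 0 := by
    have h2' : (a ^ 2 + b ^ 2 + c ^ 2 + d ^ 2) * E ^ 2 =
        (b * c * d) ^ 2 + (a * c * d) ^ 2 + (a * b * d) ^ 2 + (a * b * c) ^ 2 := by
      rw [h2, hE]
      field_simp
    have h3 : E * (e2 * (E - 1)) = 0 := by
      have e3 : (b * c * d + a * c * d + a * b * d + a * b * c) ^ 2 = e1 ^ 2 * E ^ 2 := by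
        rw [g1, mul_pow]
      simp only [hE, he1, he2] at *
      linear_combination (-1 / 2) * h2' - (1 / 2) * e3
    exact (mul_eq_zero.1 h3).resolve_left hE0
  by_cases hE1 : E = 1
  · have key : (a * b - 1) * ((a * c - 1) * (b * c - 1)) = 0 := by
      rw [hE1] at g1
      simp only [hE, he1] at g1 hE1
      linear_combination (a * b * c) * g1 - (a * b + a * c + b * c - 1) * hE1
    rcases mul_eq_zero.1 key with h | h
    · exact Or.inl (sub_eq_zero.1 h)
    · rcases mul_eq_zero.1 h with h | h
      · exact Or.inr (Or.inl (sub_eq_zero.1 h))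
      · exact Or.inr (Or.inr (Or.inl (sub_eq_zero.1 h)))
  · have he20 : e2 = 0 := (mul_eq_zero.1 g2).resolve_right (sub_ne_zero.2 hE1)
    have g4 : (e1 ^ 2 - 1) * ((E - 1) * (E + 1)) = 0 := by
      have h4' : (a ^ 4 + b ^ 4 + c ^ 4 + d ^ 4) * E ^ 4 =
          (b * c * d) ^ 4 + (a * c * d) ^ 4 + (a * b * d) ^ 4 + (a * b * c) ^ 4 := by
        rw [h4, hE]
        field_simp
      have n1 : a ^ 4 + b ^ 4 + c ^ 4 + d ^ 4 = e1 ^ 4 - 4 * e1 ^ 2 * e2 + 2 * e2 ^ 2 +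
          4 * e1 * (b * c * d + a * c * d + a * b * d + a * b * c) - 4 * E := by
        simp only [hE, he1, he2]
        ring
      have n2 : (b * c * d) ^ 4 + (a * c * d) ^ 4 + (a * b * d) ^ 4 + (a * b * c) ^ 4 =
          (b * c * d + a * c * d + a * b * d + a * b * c) ^ 4 -
          4 * (b * c * d + a * c * d + a * b * d + a * b * c) ^ 2 * (e2 * E) +
          2 * (e2 * E) ^ 2 + 4 * (b * c * d + a * c * d + a * b * d + a * b * c) * (e1 * E ^ 2) -
          4 * E ^ 3 := by
        simp only [hE, he1, he2]
        ring
      rw [n1, n2, g1, he20] at h4'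
      have h5 : E ^ 3 * ((e1 ^ 2 - 1) * ((E - 1) * (E + 1))) = 0 := by
        linear_combination (1 / 4) * h4'
      exact (mul_eq_zero.1 h5).resolve_left (pow_ne_zero 3 hE0)
    have neg : ∀ {z : ℂ}, z ^ M = 1 → (-z) ^ M ≠ 1 := by
      intro z hz h
      rw [hM.neg_pow, hz] at h
      norm_num at h
    have hEneg : E + 1 ≠ 0 := by
      intro h
      apply neg (one_pow M)
      rw [← eq_neg_of_add_eq_zero_left h, hEM]
    have he12 : (e1 - 1) * (e1 + 1) = 0 := by
      have := (mul_eq_zero.1 g4).resolve_right (mul_ne_zero (sub_ne_zero.2 hE1) hEneg)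
      linear_combination this
    -- Since `e2 = 0` and `e1 ^ 2 = 1`, the polynomial with the roots `a`, `b`, `c`, `d` factors as
    -- `(z - e1) (z ^ 3 - e1 E)`. The value `e1 = -1` is impossible, because the negative of an
    -- `M`-th root of unity is not one for odd `M`.
    have root : ∀ z : ℂ, (z - a) * ((z - b) * ((z - c) * (z - d))) = 0 →
        (z - e1) * (z ^ 3 - e1 * E) = 0 := by
      intro z hz
      have e3 : z ^ 4 - e1 * z ^ 3 + e2 * z ^ 2 -
          (b * c * d + a * c * d + a * b * d + a * b * c) * z + E = 0 := by
        rw [← hz]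
        simp only [hE, he1, he2]
        ring
      rw [g1, he20] at e3
      linear_combination e3 + E * he12
    have ra := root a (by ring)
    have rb := root b (by ring)
    have rc := root c (by ring)
    right; right; right
    rcases mul_eq_zero.1 he12 with h | h
    · rw [sub_eq_zero.1 h] at ra rb rc
      refine ⟨E, ?_, ?_, ?_⟩
      · rcases mul_eq_zero.1 ra with h | h
        · exact Or.inl (sub_eq_zero.1 h)
        · exact Or.inr (by linear_combination h)
      · rcases mul_eq_zero.1 rb with h | h
        · exact Or.inl (sub_eq_zero.1 h)
        · exact Or.inr (by linear_combination h)
      · rcases mul_eq_zero.1 rc with h | h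
        · exact Or.inl (sub_eq_zero.1 h)
        · exact Or.inr (by linear_combination h)
    · exfalso
      rw [eq_neg_of_add_eq_zero_left h] at ra
      rcases mul_eq_zero.1 ra with h | h
      · apply neg (one_pow M)
        rw [← sub_eq_zero.1 h, ha]
      · apply neg hEM
        have : -E = a ^ 3 := by linear_combination (-1 : ℂ) * h
        rw [this, ← pow_mul, mul_comm, pow_mul, ha, one_pow]

/-- A sign `σ` makes `M - σ x` divisible by four, so the cosine of `π x / (2 M)` is the sine of a
multiple of `2 π / M`. For `k` congruent to 1 modulo 4, `k π / 2` is `π / 2` modulo `2 π`, so the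
formula persists under `k`. -/
theorem exists_root_of_unity_im {M : ℕ} (hM : Odd M) {x : ℤ} (hx : Odd x) :
    ∃ p : ℂ, p ^ M = 1 ∧ ∀ k : ℕ, k % 4 = 1 → (p ^ k).im = cosi (2 * M) (k * x) := by
  have hM0 : (M : ℝ) ≠ 0 := by
    have : M ≠ 0 := by
      rintro rfl
      simp at hM
    exact_mod_cast this
  obtain ⟨σ, hσ, j, hj⟩ : ∃ σ : ℤ, (σ = 1 ∨ σ = -1) ∧ ∃ j : ℤ, M - σ * x = 4 * j := by
    obtain ⟨u, hu⟩ := hM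
    obtain ⟨v, hv⟩ := hx
    rcases Int.even_or_odd' ((u : ℤ) - v) with ⟨w, hw | hw⟩
    · exact ⟨1, Or.inl rfl, w, by omega⟩
    · exact ⟨-1, Or.inr rfl, u - w, by omega⟩
  have hj' : (M : ℝ) - σ * x = 4 * j := by exact_mod_cast hj
  refine ⟨Complex.exp ((Real.pi * (M - σ * x) / (2 * M) : ℝ) * Complex.I), ?_, ?_⟩
  · rw [← Complex.exp_nat_mul, Complex.exp_eq_one_iff]
    refine ⟨j, ?_⟩
    rw [hj']
    have : (M : ℂ) ≠ 0 := by exact_mod_cast hM0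
    push_cast
    field_simp
    ring
  · intro k hk
    obtain ⟨q, rfl⟩ : ∃ q, k = 4 * q + 1 := ⟨k / 4, by omega⟩
    rw [← Complex.exp_nat_mul]
    have e1 : ((4 * q + 1 : ℕ) : ℂ) * ((Real.pi * (M - σ * x) / (2 * M) : ℝ) * Complex.I) =
        ((Real.pi / 2 - Real.pi * ((4 * q + 1 : ℕ) * (σ * x)) / (2 * M) + q * (2 * Real.pi) : ℝ) : ℂ) *
          Complex.I := by
      have : (M : ℂ) ≠ 0 := by exact_mod_cast hM0
      push_cast
      field_simp
      ring
    rw [e1, Complex.exp_ofReal_mul_I_im, Real.sin_add_nat_mul_two_pi, Real.sin_pi_div_two_sub]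
    unfold cosi
    rcases hσ with rfl | rfl
    · push_cast
      rw [one_mul]
    · rw [← Real.cos_neg]
      congr 1
      push_cast
      ring

/-- As imaginary parts of `M`-th roots of unity `p`, `q`, `r`, `s`, the cosines satisfy a relation
saying that `p + q + r⁻¹ + s⁻¹` is invariant under inversion. Galois conjugates give the same for
squares and fourth powers, so `four_roots_of_unity` applies; its last alternative compares cubes,
that is, the angles `3 x` and `3 ψ`. -/
theorem rationalAngle_two_mul_odd {M a b ψ : ℕ} (hM : Odd M) (ha : 0 < a) (hab : a < b)
    (hb : b < M) (hodd : Odd (a + b)) (hψ : Odd ψ) (hψA : ψ ≤ a + b)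
    (h : RationalAngle (2 * M) a b ψ) :
    ψ = a + b ∨ ψ + a = b ∨ ψ = M ∨
      ∀ x : ℤ, (x = a + b ∨ x = b - a) → x = M ∨ 3 * x + 3 * ψ = 2 * M ∨
        3 * x + 3 * ψ = 6 * M ∨ 3 * x + 3 * ψ = 10 * M ∨ 3 * x = 3 * ψ + 2 * M ∨
          3 * ψ = 3 * x + 2 * M := by
  have hm0 : 0 < 2 * M := by omega
  have hAo : Odd ((a : ℤ) + b) := by exact_mod_cast hodd
  have hψo : Odd (ψ : ℤ) := by exact_mod_cast hψ
  have hBo : Odd ((b : ℤ) - a) := by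
    rw [show (b : ℤ) - a = a + b - 2 * a by ring]
    exact hAo.sub_even (even_two_mul _)
  have hM0 : (M : ℝ) ≠ 0 := by
    have : M ≠ 0 := by omega
    exact_mod_cast this
  have cosM : ∀ k : ℕ, Odd k → cosi (2 * M) (k * M) = 0 := by
    rintro k ⟨j, rfl⟩
    unfold cosi
    have : Real.pi * (((2 * j + 1 : ℕ) * M : ℤ) : ℝ) / (2 * M : ℕ) = Real.pi / 2 + j * Real.pi := by
      push_cast
      field_simp
      ring
    rw [this, Real.cos_add_nat_mul_pi, Real.cos_pi_div_two, mul_zero]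
  obtain ⟨c, hc, rel⟩ : ∃ c : ℕ, Odd c ∧ ∀ k : ℕ, k.Coprime (4 * (2 * M)) →
      cosi (2 * M) (k * (a + b)) + cosi (2 * M) (k * (b - a)) =
        cosi (2 * M) (k * ψ) + cosi (2 * M) (k * c) := by
    rcases h.cases_even hm0 (even_two_mul M) hodd hψ with h | rel
    · exact h
    -- A missing fourth cosine is the cosine of the right angle `π M / (2 M)`.
    · refine ⟨M, hM, fun k hk => ?_⟩
      have hko : Odd k := by
        have : k.Coprime (2 * (2 * (2 * M))) := by rwa [← mul_assoc]
        exact Nat.coprime_two_right.1 (Nat.Coprime.coprime_mul_right_right this)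
      rw [rel k hk, cosM k hko, add_zero]
  have hco : Odd (c : ℤ) := by exact_mod_cast hc
  -- `k` is 2 modulo `M`, so it squares `M`-th roots of unity, and 1 modulo 4, as needed for the
  -- imaginary parts.
  obtain ⟨k, i, hk4, hki⟩ : ∃ k i : ℕ, k % 4 = 1 ∧ k = M * i + 2 := by
    obtain ⟨u, hu⟩ := hM
    rcases Nat.even_or_odd' u with ⟨v, hv | hv⟩
    · exact ⟨3 * M + 2, 3, by omega, by ring⟩
    · exact ⟨M + 2, 1, by omega, by ring⟩
  have hkc : k.Coprime (4 * (2 * M)) := by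
    have hko : Odd k := Nat.odd_iff.2 (by omega)
    apply coprime_four_mul hko
    apply (Nat.coprime_two_right.2 hko).mul_right
    rw [hki]
    simpa [Nat.coprime_comm] using hM
  obtain ⟨p, hpM, hp⟩ := exists_root_of_unity_im hM hAo
  obtain ⟨q, hqM, hq⟩ := exists_root_of_unity_im hM hBo
  obtain ⟨r, hrM, hr⟩ := exists_root_of_unity_im hM hψo
  obtain ⟨s, hsM, hs⟩ := exists_root_of_unity_im hM hco
  have hMne : M ≠ 0 := by omega
  have norm1 : ∀ {z : ℂ}, z ^ M = 1 → ‖z‖ = 1 := fun hz => Complex.norm_eq_one_of_pow_eq_one hz hMne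
  have hpow2 : ∀ {z : ℂ}, z ^ M = 1 → z ^ k = z ^ 2 := by
    intro z hz
    rw [hki, pow_add, pow_mul, hz, one_pow, one_mul]
  have hpow4 : ∀ {z : ℂ}, z ^ M = 1 → z ^ (k * k) = z ^ 4 := by
    intro z hz
    rw [pow_mul, hpow2 hz, ← pow_mul, mul_comm, pow_mul, hpow2 hz, ← pow_mul]
  have him : ∀ {z : ℂ}, ‖z‖ = 1 → ∀ j : ℕ, 2 * Complex.I * ((z ^ j).im : ℂ) = z ^ j - z⁻¹ ^ j := by
    intro z hz j
    rw [inv_pow, Complex.inv_eq_conj (by rw [norm_pow, hz, one_pow]), Complex.sub_conj]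
    push_cast
    ring
  have hk2 : k * k % 4 = 1 := by
    rw [Nat.mul_mod, hk4]
  have imrel : ∀ j : ℕ, j % 4 = 1 → j.Coprime (4 * (2 * M)) →
      p ^ j - p⁻¹ ^ j + (q ^ j - q⁻¹ ^ j) = r ^ j - r⁻¹ ^ j + (s ^ j - s⁻¹ ^ j) := by
    intro j hj hjc
    rw [← him (norm1 hpM), ← him (norm1 hqM), ← him (norm1 hrM), ← him (norm1 hsM),
      hp j hj, hq j hj, hr j hj, hs j hj]
    have := rel j hjc
    rw [← mul_add, ← mul_add, ← Complex.ofReal_add, ← Complex.ofReal_add, this]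
  have inv1 : ∀ {z : ℂ}, z ^ M = 1 → z⁻¹ ^ M = 1 := by
    intro z hz
    rw [inv_pow, hz, inv_one]
  have f1 := imrel 1 rfl (Nat.coprime_one_left _)
  have f2 := imrel k hk4 hkc
  have f4 := imrel (k * k) hk2 (hkc.mul_left hkc)
  rw [hpow2 hpM, hpow2 hqM, hpow2 hrM, hpow2 hsM, hpow2 (inv1 hpM), hpow2 (inv1 hqM),
    hpow2 (inv1 hrM), hpow2 (inv1 hsM)] at f2
  rw [hpow4 hpM, hpow4 hqM, hpow4 hrM, hpow4 hsM, hpow4 (inv1 hpM), hpow4 (inv1 hqM),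
    hpow4 (inv1 hrM), hpow4 (inv1 hsM)] at f4
  simp only [pow_one] at f1
  have hp1 := hp 1 rfl
  have hq1 := hq 1 rfl
  have hr1 := hr 1 rfl
  simp only [pow_one, Nat.cast_one, one_mul] at hp1 hq1 hr1
  have hr0 : r ≠ 0 := by
    rintro rfl
    have := norm1 hrM
    simp at this
  rcases four_roots_of_unity hM hpM hqM (inv1 hrM) (inv1 hsM)
    (by rw [inv_inv, inv_inv]; linear_combination f1)
    (by rw [inv_inv, inv_inv]; linear_combination f2)
    (by rw [inv_inv, inv_inv]; linear_combination f4) with h | h | h | ⟨E, h1, h2, h3⟩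
  · exfalso
    have e1 : q = (starRingEnd ℂ) p := by
      rw [← Complex.inv_eq_conj (norm1 hpM)]
      exact eq_inv_of_mul_eq_one_right h
    have e2 := congrArg Complex.im e1
    rw [Complex.conj_im, hp1, hq1] at e2
    have hsum := two_mul_cosi_mul_cosi (2 * M) a b
    have ha' : 0 < cosi (2 * M) a := cosi_pos hm0 (by omega) (by push_cast; omega)
    have hb' : 0 < cosi (2 * M) b := cosi_pos hm0 (by omega) (by push_cast; omega)
    have : 0 < 2 * cosi (2 * M) a * cosi (2 * M) b := by positivity
    linarith
  · have e1 : p = r := by rw [← mul_inv_eq_one₀ hr0, h]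
    have e2 := congrArg Complex.im e1
    rw [hp1, hr1] at e2
    have := cosi_inj hm0 (by omega) (by push_cast; omega) (by omega) (by push_cast; omega) e2
    omega
  · have e1 : q = r := by rw [← mul_inv_eq_one₀ hr0, h]
    have e2 := congrArg Complex.im e1
    rw [hq1, hr1] at e2
    have := cosi_inj hm0 (by omega) (by push_cast; omega) (by omega) (by push_cast; omega) e2
    omega
  · have cosM1 := cosM 1 odd_one
    rw [Nat.cast_one, one_mul] at cosM1
    rcases h3 with h3 | h3
    · right; right; left
      have e1 : r = 1 := inv_eq_one.1 h3
      rw [e1, Complex.one_im, ← cosM1] at hr1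
      have := cosi_inj hm0 (by omega) (by push_cast; omega) (by omega) (by push_cast; omega) hr1
      omega
    · right; right; right
      have main : ∀ (x : ℤ) (w : ℂ), w ^ M = 1 → w.im = cosi (2 * M) x → (w = 1 ∨ w ^ 3 = E) →
          0 < x → x < 2 * M → x = M ∨ 3 * x + 3 * ψ = 2 * M ∨
          3 * x + 3 * ψ = 6 * M ∨ 3 * x + 3 * ψ = 10 * M ∨ 3 * x = 3 * ψ + 2 * M ∨
          3 * ψ = 3 * x + 2 * M := by
        intro x w hwM hwim hw hx0 hx
        rcases hw with hw | hw
        · left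
          rw [hw, Complex.one_im, ← cosM1] at hwim
          have := cosi_inj hm0 (by omega) (by push_cast; omega) (by omega) (by push_cast; omega) hwim
          omega
        · right
          have e1 : w ^ 3 = (starRingEnd ℂ) (r ^ 3) := by
            rw [hw, ← h3, inv_pow, Complex.inv_eq_conj (by rw [norm_pow, norm1 hrM, one_pow])]
          have e2 := congrArg Complex.im e1
          rw [Complex.conj_im, im_pow_three (norm1 hwM), im_pow_three (norm1 hrM), hwim, hr1] at e2
          -- The cubes are conjugate, so `cos (3 x) = -cos (3 ψ)`; adding `2 M`, a half turn,
          -- absorbs the sign.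
          have e3 : cosi (2 * M) (3 * x) = cosi (2 * M) (3 * ψ + (2 * M : ℕ) * 1) := by
            rw [cosi_add_mul hm0, cosi_three_mul, cosi_three_mul]
            simp only [Int.natAbs_one, pow_one]
            linarith
          obtain ⟨j, hj | hj⟩ := cosi_eq_cosi hm0 e3
          · rcases lt_trichotomy (3 * x - 3 * ψ) 0 with h0 | h0 | h0
            · have := odd_multiple_cases (m := 2 * M) (x := 3 * ψ - 3 * x) (j := -j - 1)
                (by omega) (by push_cast; omega) (by linear_combination -hj)
              push_cast at this
              omega
            · exfalso
              have h5 : (2 * M : ℤ) * (2 * j + 1) = 0 := by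
                push_cast at hj
                linarith
              rcases mul_eq_zero.1 h5 with h5 | h5 <;> omega
            · have := odd_multiple_cases (m := 2 * M) (x := 3 * x - 3 * ψ) (j := j)
                (by omega) (by push_cast; omega) (by linear_combination hj)
              push_cast at this
              omega
          · have := odd_multiple_cases (m := 2 * M) (x := 3 * x + 3 * ψ) (j := j - 1)
                (by omega) (by push_cast; omega) (by linear_combination hj)
            push_cast at this
            omega
      rintro x (rfl | rfl)
      · exact main _ p hpM hp1 h1 (by omega) (by omega)
      · exact main _ q hqM hq1 h2 (by omega) (by omega)

/-! ### The choice of `ψ` -/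

/-- Each `ψ` leaves six linear relations for `A` and six for `B`; for two different small `ψ` they
are incompatible. -/
theorem two_candidates {M A B ψ ψ' : ℤ} (hψ : ψ = 1 ∧ ψ' = 3 ∨ ψ = 1 ∧ ψ' = 5 ∨ ψ = 3 ∧ ψ' = 5)
    (hM : 6 ≤ M) (hBA : B < A) (hAB : A + B < 2 * M) (hB : 0 < B) (hA : 7 ≤ A) (hMo : M % 2 = 1)
    (h1 : ∀ x : ℤ, (x = A ∨ x = B) → x = M ∨ 3 * x + 3 * ψ = 2 * M ∨
        3 * x + 3 * ψ = 6 * M ∨ 3 * x + 3 * ψ = 10 * M ∨ 3 * x = 3 * ψ + 2 * M ∨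
          3 * ψ = 3 * x + 2 * M)
    (h2 : ∀ x : ℤ, (x = A ∨ x = B) → x = M ∨ 3 * x + 3 * ψ' = 2 * M ∨
        3 * x + 3 * ψ' = 6 * M ∨ 3 * x + 3 * ψ' = 10 * M ∨ 3 * x = 3 * ψ' + 2 * M ∨
          3 * ψ' = 3 * x + 2 * M) : False := by
  have a1 := h1 A (Or.inl rfl)
  have a2 := h2 A (Or.inl rfl)
  have b1 := h1 B (Or.inr rfl)
  have b2 := h2 B (Or.inr rfl)
  clear h1 h2
  rcases hψ with ⟨rfl, rfl⟩ | ⟨rfl, rfl⟩ | ⟨rfl, rfl⟩ <;>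
  rcases a1 with h | h | h | h | h | h <;> rcases a2 with h' | h' | h' | h' | h' | h' <;>
    first
    | (exfalso; clear b1 b2; omega)
    | (rcases b1 with k | k | k | k | k | k <;> omega)

/-- `ψ = 1` forces `b = a + 1` or a modulus of at most 5, then `ψ = 3` forces the modulus 9 or 15,
and `ψ = 5` or `ψ = 7` respectively finishes. -/
theorem exists_not_rationalAngle_odd_aux {M a b : ℕ} (ha : 0 < a) (hab : a ≤ b)
    (hb : 2 * b < 2 * M + 1) (h12 : ¬ (a = 1 ∧ b = 2))
    (h9 : ¬ (2 * M + 1 = 9 ∧ a = 2 ∧ b = 3)) (h15 : ¬ (2 * M + 1 = 15 ∧ a = 2 ∧ b = 3))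
    (h15' : ¬ (2 * M + 1 = 15 ∧ a = 3 ∧ b = 4)) (hodd : Odd (a + b))
    (hbad : ∀ ψ : ℕ, Odd ψ → ψ ≤ 5 ∨ ψ ≤ a + b → RationalAngle (2 * M + 1) a b ψ) : False := by
  obtain ⟨e, he⟩ := id hodd
  have o1 : Odd 1 := odd_one
  have hmo : Odd (2 * M + 1) := ⟨M, rfl⟩
  have e1 : 1 + a = b ∨ 2 * M + 1 ≤ 5 := by
    have := rationalAngle_odd_modulus hmo ha hab hb hodd o1 (by omega) (hbad 1 o1 (by omega))
    omega
  have o3 : Odd 3 := ⟨1, rfl⟩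
  have e3 : 2 * M + 1 = 9 ∨ 2 * M + 1 = 15 := by
    have := rationalAngle_odd_modulus hmo ha hab hb hodd o3 (by omega) (hbad 3 o3 (by omega))
    omega
  rcases e3 with e3 | e3
  · have o5 : Odd 5 := ⟨2, rfl⟩
    have := rationalAngle_odd_modulus hmo ha hab hb hodd o5 (by omega) (hbad 5 o5 (by omega))
    omega
  · have o7 : Odd 7 := ⟨3, rfl⟩
    have := rationalAngle_odd_modulus hmo ha hab hb hodd o7 (by omega) (hbad 7 o7 (by omega))
    omega

/-- The excluded triples are those that the test values 1, 3, 5, 7 of `ψ` do not settle. -/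
theorem exists_not_rationalAngle_odd {m a b : ℕ} (ha : 0 < a) (hab : a ≤ b) (hb : 2 * b < m)
    (h12 : ¬ (a = 1 ∧ b = 2)) (h14 : ¬ (m = 12 ∧ a = 1 ∧ b = 4))
    (h9 : ¬ (m = 9 ∧ a = 2 ∧ b = 3)) (h15 : ¬ (m = 15 ∧ a = 2 ∧ b = 3))
    (h15' : ¬ (m = 15 ∧ a = 3 ∧ b = 4)) (hodd : Odd (a + b)) :
    ∃ ψ : ℕ, Even (ψ + (a + b)) ∧ ψ ≤ a + b ∧ ¬ RationalAngle m a b ψ := by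
  obtain ⟨e, he⟩ := id hodd
  by_contra! hcon
  -- `a + b` is odd, and only `(1, 2)` has a sum less than 5, so all odd `ψ ≤ 5` are admissible.
  have hbad : ∀ ψ : ℕ, Odd ψ → ψ ≤ 5 ∨ ψ ≤ a + b → RationalAngle m a b ψ :=
    fun ψ h1 h2 => hcon ψ (h1.add_odd hodd) (by omega)
  rcases Nat.even_or_odd' m with ⟨M, rfl | rfl⟩
  · have o1 : Odd 1 := odd_one
    have o3 : Odd 3 := ⟨1, rfl⟩
    have o5 : Odd 5 := ⟨2, rfl⟩
    have r1 := hbad 1 o1 (by omega)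
    have r3 := hbad 3 o3 (by omega)
    have r5 := hbad 5 o5 (by omega)
    rcases Nat.even_or_odd' M with ⟨l, rfl | hl⟩
    · have h4 : 2 * (2 * l) = 4 * l := by ring
      rw [h4] at r1 r3 r5 hb
      have e1 := rationalAngle_four_dvd hab ha hb hodd o1 (by omega) r1
      have e3 := rationalAngle_four_dvd hab ha hb hodd o3 (by omega) r3
      have e5 := rationalAngle_four_dvd hab ha hb hodd o5 (by omega) r5
      omega
    · have hMo : Odd M := ⟨l, hl⟩
      have hab' : a < b := by omega
      have hbM : b < M := by omega
      have h5 : 5 ≤ a + b := by omega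
      clear hcon hbad
      have hf : ∀ ψ : ℕ, Odd ψ → ψ ≤ 5 → RationalAngle (2 * M) a b ψ →
          ψ = a + b ∨ ψ + a = b ∨ ψ = M ∨
          ∀ x : ℤ, (x = a + b ∨ x = b - a) → x = M ∨ 3 * x + 3 * ψ = 2 * M ∨
            3 * x + 3 * ψ = 6 * M ∨ 3 * x + 3 * ψ = 10 * M ∨ 3 * x = 3 * ψ + 2 * M ∨
            3 * ψ = 3 * x + 2 * M := fun ψ h1 h2 h3 =>
        rationalAngle_two_mul_odd hMo ha hab' hbM hodd h1 (h2.trans h5) h3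
      by_cases hsmall : a + b = 5 ∨ M = 5
      · have hab' : (a = 1 ∧ b = 4) ∨ (a = 2 ∧ b = 3) ∨ (a = 3 ∧ b = 4) := by omega
        rcases hab' with ⟨rfl, rfl⟩ | ⟨rfl, rfl⟩ | ⟨rfl, rfl⟩
        · rcases hf 1 o1 (by norm_num) r1 with h | h | h | h
          · omega
          · omega
          · omega
          · have := h _ (Or.inl rfl)
            have := h _ (Or.inr rfl)
            omega
        · rcases hf 3 o3 (by norm_num) r3 with h | h | h | h
          · omega
          · omega
          · omega
          · have := h _ (Or.inl rfl)
            have := h _ (Or.inr rfl)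
            omega
        · rcases hf 3 o3 (by norm_num) r3 with h | h | h | h
          · omega
          · omega
          · omega
          · have := h _ (Or.inl rfl)
            have := h _ (Or.inr rfl)
            omega
      · have key : ∀ ψ : ℕ, Odd ψ → ψ ≤ 5 → RationalAngle (2 * M) a b ψ → ψ + a ≠ b →
            ∀ x : ℤ, (x = a + b ∨ x = b - a) → x = M ∨ 3 * x + 3 * ψ = 2 * M ∨
              3 * x + 3 * ψ = 6 * M ∨ 3 * x + 3 * ψ = 10 * M ∨ 3 * x = 3 * ψ + 2 * M ∨
              3 * ψ = 3 * x + 2 * M := by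
          intro ψ hψ h5 hr hne
          rcases hf ψ hψ h5 hr with h | h | h | h
          · omega
          · omega
          · omega
          · exact h
        -- At most one of 1, 3, 5 equals `b - a`; two of the others contradict each other.
        by_cases hB1 : 1 + a = b
        · exact two_candidates (Or.inr (Or.inr ⟨rfl, rfl⟩)) (by omega) (by omega) (by omega)
            (by omega) (by omega) (by omega) (key 3 o3 (by norm_num) r3 (by omega))
            (key 5 o5 (by norm_num) r5 (by omega))
        · by_cases hB3 : 3 + a = b
          · exact two_candidates (Or.inr (Or.inl ⟨rfl, rfl⟩)) (by omega) (by omega) (by omega)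
              (by omega) (by omega) (by omega) (key 1 o1 (by norm_num) r1 (by omega))
              (key 5 o5 (by norm_num) r5 (by omega))
          · exact two_candidates (Or.inl ⟨rfl, rfl⟩) (by omega) (by omega) (by omega)
              (by omega) (by omega) (by omega) (key 1 o1 (by norm_num) r1 (by omega))
              (key 3 o3 (by norm_num) r3 (by omega))
  · exact exists_not_rationalAngle_odd_aux ha hab hb h12 h9 h15 h15' hodd hbad

theorem RationalAngle.symm {m a b ψ : ℕ} (h : RationalAngle m a b ψ) : RationalAngle m b a ψ := by
  obtain ⟨n, hn⟩ := h
  refine ⟨n, fun k hk => ?_⟩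
  rw [← hn k hk]
  ring

theorem abs_mul_lt_sq_of_residues {m : ℕ} (hm : 0 < m) {x y z : ℤ} (rx ry rz qx qy qz : ℤ)
    (hx : x = m * qx + rx ∨ x = m * qx - rx) (hy : y = m * qy + ry ∨ y = m * qy - ry)
    (hz : z = m * qz + rz ∨ z = m * qz - rz) (hz0 : 0 ≤ rz) (hzx : rz ≤ rx) (hzy : rz < ry)
    (hxm : 2 * rx ≤ m) (hym : 2 * ry ≤ m) : |cosi m x * cosi m y| < cosi m z ^ 2 := by
  rw [abs_mul, abs_cosi_of_dist hm (by omega) hxm hx, abs_cosi_of_dist hm (by omega) hym hy,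
    ← sq_abs, abs_cosi_of_dist hm hz0 (by omega) hz, sq]
  have h1 : 0 ≤ cosi m rx := cosi_nonneg hm (by omega) hxm
  have h2 : 0 ≤ cosi m ry := cosi_nonneg hm (by omega) hym
  have h3 : cosi m rx ≤ cosi m rz := cosi_le_cosi hm hz0 hzx (by omega)
  have h4 : cosi m ry < cosi m rz := cosi_lt_cosi hm hz0 hzy (by omega)
  have h5 : 0 < cosi m rz := h2.trans_lt h4
  exact mul_lt_mul' h3 h4 h2 h5

/-- Needed for `(15; 2, 3)`, where comparing distances is not enough: 7 is beyond 6, but 3 is not.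
The proof bounds `cos 84° = sin (π / 30)` by `π / 30` and uses `√5` for the other two cosines. -/
theorem cosi_fifteen_lt : cosi 15 7 * cosi 15 3 < cosi 15 6 ^ 2 := by
  have e6 : cosi 15 6 = (√5 - 1) / 4 := by
    rw [← cos_two_pi_div_five]
    unfold cosi
    congr 1
    push_cast
    ring
  have e3 : cosi 15 3 = (1 + √5) / 4 := by
    rw [← Real.cos_pi_div_five]
    unfold cosi
    congr 1
    push_cast
    ring
  have e7 : cosi 15 7 ≤ Real.pi / 30 := by
    have : cosi 15 7 = Real.sin (Real.pi / 30) := by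
      rw [← Real.cos_pi_div_two_sub]
      unfold cosi
      congr 1
      push_cast
      ring
    rw [this]
    exact Real.sin_le (by positivity)
  have h5 : √5 ^ 2 = 5 := Real.sq_sqrt (by norm_num)
  have h5' : 0 ≤ √5 := Real.sqrt_nonneg 5
  have hlo : 2.236 < √5 := Real.lt_sqrt_of_sq_lt (by norm_num)
  have hhi : √5 < 2.2361 := by
    rw [Real.sqrt_lt' (by norm_num)]
    norm_num
  have hpi := Real.pi_lt_d2
  rw [e6, e3]
  calc cosi 15 7 * ((1 + √5) / 4) ≤ 0.105 * 0.8091 := by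
        apply mul_le_mul <;> linarith
    _ < ((√5 - 1) / 4) ^ 2 := by nlinarith

/-- If no Galois conjugate of `cos (π a / m) cos (π b / m)` is separated from all the numbers
`cos² (π s / m)`, then some `ψ` gives an irrational angle. -/
theorem exists_not_rationalAngle_of_le {m a b : ℕ} (ha : 0 < a) (hab : a ≤ b) (hb : 2 * b < m)
    (hgt : ∀ k : ℕ, k.Coprime (4 * m) → ∃ s : ℕ, 0 < s ∧ 2 * s < m ∧ s ≠ a ∧ s ≠ b ∧
      cosi m (k * s) ^ 2 ≤ |cosi m (k * a) * cosi m (k * b)|)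
    (hlt : ∃ s : ℕ, 0 < s ∧ 2 * s < m ∧ s ≠ a ∧ s ≠ b ∧ cosi m a * cosi m b ≤ cosi m s ^ 2) :
    ∃ ψ : ℕ, Even (ψ + (a + b)) ∧ ψ ≤ a + b ∧ ¬ RationalAngle m a b ψ := by
  have hm : 0 < m := by omega
  -- If `a`, `b` are `1, 1` or `1, 2`, every other parameter has a smaller cosine than both, against
  -- `hlt`.
  have h11 : ¬ (a = 1 ∧ b = 1) := by
    rintro ⟨rfl, rfl⟩
    obtain ⟨s, hs0, hsm, hsa, -, hs⟩ := hlt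
    have h1 : cosi m s < cosi m (1 : ℕ) := cosi_lt_cosi hm (by omega) (by omega) (by omega)
    have h2 : 0 < cosi m s := cosi_pos hm (by omega) (by omega)
    nlinarith
  have h12 : ¬ (a = 1 ∧ b = 2) := by
    rintro ⟨rfl, rfl⟩
    obtain ⟨s, hs0, hsm, hsa, hsb, hs⟩ := hlt
    have h1 : cosi m s < cosi m (1 : ℕ) := cosi_lt_cosi hm (by omega) (by omega) (by omega)
    have h3 : cosi m s < cosi m (2 : ℕ) := cosi_lt_cosi hm (by omega) (by omega) (by omega)
    have h2 : 0 < cosi m s := cosi_pos hm (by omega) (by omega)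
    nlinarith
  rcases Nat.even_or_odd (a + b) with heven | hodd
  · apply exists_not_rationalAngle_even ha hab hb h11 _ heven
    -- For each exceptional triple here and below, the `k` inserted in `hgt` is a conjugate in which
    -- every admissible `s` has its squared cosine strictly above the absolute value of the product.
    rintro ⟨rfl, rfl, rfl | rfl⟩
    · obtain ⟨s, hs0, hsm, hsa, -, hs⟩ := hgt 1 (by norm_num)
      obtain rfl : s = 1 := by omega
      refine absurd hs (not_le.2 ?_)
      exact abs_mul_lt_sq_of_residues hm 2 2 1 0 0 0 (by norm_num) (by norm_num) (by norm_num)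
        (by norm_num) (by norm_num) (by norm_num) (by norm_num) (by norm_num)
    · obtain ⟨s, hs0, hsm, hsa, -, hs⟩ := hgt 3 (by norm_num)
      refine absurd hs (not_le.2 ?_)
      have h : s = 1 ∨ s = 3 ∨ s = 4 := by omega
      rcases h with rfl | rfl | rfl
      · exact abs_mul_lt_sq_of_residues hm 4 4 3 1 1 0 (by norm_num) (by norm_num) (by norm_num)
          (by norm_num) (by norm_num) (by norm_num) (by norm_num) (by norm_num)
      · exact abs_mul_lt_sq_of_residues hm 4 4 1 1 1 1 (by norm_num) (by norm_num) (by norm_num)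
          (by norm_num) (by norm_num) (by norm_num) (by norm_num) (by norm_num)
      · exact abs_mul_lt_sq_of_residues hm 4 4 2 1 1 1 (by norm_num) (by norm_num) (by norm_num)
          (by norm_num) (by norm_num) (by norm_num) (by norm_num) (by norm_num)
  · apply exists_not_rationalAngle_odd ha hab hb h12 _ _ _ _ hodd
    · rintro ⟨rfl, rfl, rfl⟩
      obtain ⟨s, hs0, hsm, hsa, hsb, hs⟩ := hgt 5 (by norm_num)
      refine absurd hs (not_le.2 ?_)
      have h : s = 2 ∨ s = 3 ∨ s = 5 := by omega
      rcases h with rfl | rfl | rfl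
      · exact abs_mul_lt_sq_of_residues hm 5 4 2 0 2 1 (by norm_num) (by norm_num) (by norm_num)
          (by norm_num) (by norm_num) (by norm_num) (by norm_num) (by norm_num)
      · exact abs_mul_lt_sq_of_residues hm 5 4 3 0 2 1 (by norm_num) (by norm_num) (by norm_num)
          (by norm_num) (by norm_num) (by norm_num) (by norm_num) (by norm_num)
      · exact abs_mul_lt_sq_of_residues hm 5 4 1 0 2 2 (by norm_num) (by norm_num) (by norm_num)
          (by norm_num) (by norm_num) (by norm_num) (by norm_num) (by norm_num)
    · rintro ⟨rfl, rfl, rfl⟩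
      obtain ⟨s, hs0, hsm, hsa, hsb, hs⟩ := hgt 11 (by norm_num)
      refine absurd hs (not_le.2 ?_)
      have h : s = 1 ∨ s = 4 := by omega
      rcases h with rfl | rfl
      · exact abs_mul_lt_sq_of_residues hm 4 3 2 2 4 1 (by norm_num) (by norm_num) (by norm_num)
          (by norm_num) (by norm_num) (by norm_num) (by norm_num) (by norm_num)
      · exact abs_mul_lt_sq_of_residues hm 4 3 1 2 4 5 (by norm_num) (by norm_num) (by norm_num)
          (by norm_num) (by norm_num) (by norm_num) (by norm_num) (by norm_num)
    · rintro ⟨rfl, rfl, rfl⟩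
      obtain ⟨s, hs0, hsm, hsa, hsb, hs⟩ := hgt 19 (by norm_num)
      refine absurd hs (not_le.2 ?_)
      have key : ∀ (x r q : ℤ), (x = (15 : ℕ) * q + r ∨ x = (15 : ℕ) * q - r) → 0 ≤ r → r ≤ 6 →
          |cosi 15 ((19 : ℕ) * (2 : ℕ)) * cosi 15 ((19 : ℕ) * (3 : ℕ))| < cosi 15 x ^ 2 := by
        intro x r q hx hr hr6
        rw [abs_mul, abs_cosi_of_dist (r := 7) (q := 3) hm (by norm_num) (by norm_num)
          (by norm_num), abs_cosi_of_dist (r := 3) (q := 4) hm (by norm_num) (by norm_num)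
          (by norm_num), ← sq_abs, abs_cosi_of_dist hm hr (by push_cast; omega) hx]
        refine cosi_fifteen_lt.trans_le ?_
        have h1 : cosi 15 6 ≤ cosi 15 r := cosi_le_cosi hm hr hr6 (by norm_num)
        have h2 : 0 ≤ cosi 15 6 := cosi_nonneg hm (by norm_num) (by norm_num)
        exact pow_le_pow_left₀ h2 h1 2
      have h : s = 1 ∨ s = 4 ∨ s = 5 ∨ s = 6 ∨ s = 7 := by omega
      rcases h with rfl | rfl | rfl | rfl | rfl
      · exact key _ 4 1 (by norm_num) (by norm_num) (by norm_num)
      · exact key _ 1 5 (by norm_num) (by norm_num) (by norm_num)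
      · exact key _ 5 6 (by norm_num) (by norm_num) (by norm_num)
      · exact key _ 6 8 (by norm_num) (by norm_num) (by norm_num)
      · exact key _ 2 9 (by norm_num) (by norm_num) (by norm_num)
    · rintro ⟨rfl, rfl, rfl⟩
      obtain ⟨s, hs0, hsm, hsa, hsb, hs⟩ := hgt 17 (by norm_num)
      refine absurd hs (not_le.2 ?_)
      have key : ∀ (x r q : ℤ), (x = (15 : ℕ) * q + r ∨ x = (15 : ℕ) * q - r) → 0 ≤ r → r ≤ 5 →
          |cosi 15 ((17 : ℕ) * (3 : ℕ)) * cosi 15 ((17 : ℕ) * (4 : ℕ))| < cosi 15 x ^ 2 := by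
        intro x r q hx hr hr5
        exact abs_mul_lt_sq_of_residues hm 6 7 r 3 5 q (by norm_num) (by norm_num) hx hr
          (by omega) (by omega) (by norm_num) (by norm_num)
      have h : s = 1 ∨ s = 2 ∨ s = 5 ∨ s = 6 ∨ s = 7 := by omega
      rcases h with rfl | rfl | rfl | rfl | rfl
      · exact key _ 2 1 (by norm_num) (by norm_num) (by norm_num)
      · exact key _ 4 2 (by norm_num) (by norm_num) (by norm_num)
      · exact key _ 5 6 (by norm_num) (by norm_num) (by norm_num)
      · exact key _ 3 7 (by norm_num) (by norm_num) (by norm_num)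
      · exact key _ 1 8 (by norm_num) (by norm_num) (by norm_num)

/-- There are a real number outside the cyclotomic field and an integer `ψ` of the parity of `a + b`
that solve the quadratic equation of the nesting. -/
theorem exists_irrational_root {m a b : ℕ} (ha : 0 < a) (hb0 : 0 < b) (ham : 2 * a < m)
    (hb : 2 * b < m)
    (hgt : ∀ k : ℕ, k.Coprime (4 * m) → ∃ s : ℕ, 0 < s ∧ 2 * s < m ∧ s ≠ a ∧ s ≠ b ∧
      cosi m (k * s) ^ 2 ≤ |cosi m (k * a) * cosi m (k * b)|)
    (hlt : ∃ s : ℕ, 0 < s ∧ 2 * s < m ∧ s ≠ a ∧ s ≠ b ∧ cosi m a * cosi m b ≤ cosi m s ^ 2) :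
    ∃ (ψ : ℕ) (x : ℝ), Even (ψ + (a + b)) ∧ x ∉ realCyclotomic m ∧
      cosi m a * cosi m b * (1 + x ^ 2) + Real.sin (Real.pi * ψ / m) * x = cosi m ψ := by
  have hm : 0 < m := by omega
  have hex : ∃ ψ : ℕ, Even (ψ + (a + b)) ∧ ψ ≤ a + b ∧ ¬ RationalAngle m a b ψ := by
    rcases le_total a b with hab | hab
    · exact exists_not_rationalAngle_of_le ha hab hb hgt hlt
    · obtain ⟨ψ, h1, h2, h3⟩ := exists_not_rationalAngle_of_le hb0 hab ham
        (fun k hk => by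
          obtain ⟨s, h1, h2, h3, h4, h5⟩ := hgt k hk
          exact ⟨s, h1, h2, h4, h3, by rwa [mul_comm (cosi m _)]⟩)
        (by
          obtain ⟨s, h1, h2, h3, h4, h5⟩ := hlt
          exact ⟨s, h1, h2, h4, h3, by rwa [mul_comm (cosi m _)]⟩)
      exact ⟨ψ, by rwa [add_comm a b], by omega, fun h => h3 h.symm⟩
  obtain ⟨ψ, hψ1, hψ2, hψ3⟩ := hex
  have ha' : 0 < cosi m a := cosi_pos hm (by omega) (by omega)
  have hb' : 0 < cosi m b := cosi_pos hm (by omega) (by omega)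
  set c := cosi m a * cosi m b with hc
  have hc0 : 0 < c := mul_pos ha' hb'
  have hsq := Real.sin_sq_add_cos_sq (Real.pi * ψ / m)
  set σ := Real.sin (Real.pi * ψ / m)
  have hcos : Real.cos (Real.pi * ψ / m) = cosi m ψ := by simp [cosi]
  rw [hcos] at hsq
  -- Here `ψ ≤ a + b` is used: it makes the discriminant nonnegative, so that the roots are real.
  have hle : 2 * c ≤ 1 + cosi m ψ := by
    have h1 := two_mul_cosi_mul_cosi m a b
    have h2 : cosi m (a + b) ≤ cosi m ψ := cosi_le_cosi hm (by omega) (by omega) (by omega)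
    have h3 : cosi m (b - a) ≤ 1 := Real.cos_le_one _
    rw [hc]
    linarith
  have hle2 : cosi m ψ ≤ 1 := Real.cos_le_one _
  have hdisc : 0 ≤ σ ^ 2 - 4 * c * (c - cosi m ψ) := by
    have : σ ^ 2 - 4 * c * (c - cosi m ψ) = (1 + cosi m ψ - 2 * c) * (1 - cosi m ψ + 2 * c) := by
      linear_combination hsq
    rw [this]
    apply mul_nonneg <;> linarith
  have hs := Real.mul_self_sqrt hdisc
  set δ := √(σ ^ 2 - 4 * c * (c - cosi m ψ))
  have heq : c * (1 + ((-σ + δ) / (2 * c)) ^ 2) + σ * ((-σ + δ) / (2 * c)) = cosi m ψ := by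
    field_simp
    linear_combination hs
  exact ⟨ψ, (-σ + δ) / (2 * c), hψ1, fun hx => hψ3 (rationalAngle_of_root_mem hm hx heq), heq⟩

/-! ### Complex coordinates of points, lines and incidences -/

open scoped ComplexConjugate

/-- The numbers `exp (π i N / m)`. -/
noncomputable def rot (m : ℕ) (N : ℤ) : ℂ :=
  Complex.exp (((Real.pi * N / m : ℝ) : ℂ) * Complex.I)

theorem rot_re (m : ℕ) (N : ℤ) : (rot m N).re = cosi m N := by
  unfold rot cosi
  rw [Complex.exp_ofReal_mul_I_re]

theorem rot_im (m : ℕ) (N : ℤ) : (rot m N).im = Real.sin (Real.pi * N / m) := by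
  unfold rot
  rw [Complex.exp_ofReal_mul_I_im]

theorem rot_zero (m : ℕ) : rot m 0 = 1 := by simp [rot]

theorem rot_add (m : ℕ) (M N : ℤ) : rot m (M + N) = rot m M * rot m N := by
  unfold rot
  rw [← Complex.exp_add]
  congr 1
  push_cast
  ring

theorem rot_ne_zero (m : ℕ) (N : ℤ) : rot m N ≠ 0 := Complex.exp_ne_zero _

theorem rot_neg_mul (m : ℕ) (N : ℤ) : rot m (-N) * rot m N = 1 := by
  rw [← rot_add, neg_add_cancel, rot_zero]

theorem rot_neg_re (m : ℕ) (N : ℤ) : (rot m (-N)).re = (rot m N).re := by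
  rw [rot_re, rot_re, cosi_neg]

theorem rot_neg_im (m : ℕ) (N : ℤ) : (rot m (-N)).im = -(rot m N).im := by
  rw [rot_im, rot_im, ← Real.sin_neg]
  congr 1
  push_cast
  ring

theorem rot_re_sq_add_im_sq (m : ℕ) (N : ℤ) : (rot m N).re ^ 2 + (rot m N).im ^ 2 = 1 := by
  rw [rot_re, rot_im]
  exact Real.cos_sq_add_sin_sq _

theorem rot_im_pos {m : ℕ} {N : ℕ} (h0 : 0 < N) (h : 2 * N < m) : 0 < (rot m N).im := by
  have hm : (0 : ℝ) < m := by exact_mod_cast (by omega : 0 < m)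
  have h1 : (0 : ℝ) < N := by exact_mod_cast h0
  have h2 : (2 : ℝ) * N < m := by exact_mod_cast h
  rw [rot_im]
  push_cast
  apply Real.sin_pos_of_pos_of_lt_pi
  · positivity
  · rw [div_lt_iff₀ hm]
    nlinarith [Real.pi_pos]

theorem rot_eq_of_re_of_mul_eq_one {m : ℕ} {M N : ℤ} (h : rot m (M - N) = 1) :
    rot m M = rot m N := by
  rw [← sub_add_cancel M N, rot_add, h, one_mul]

/-- The radii of the vertex classes of a celestial construction started at `1`. -/
noncomputable def rad (m : ℕ) (s t : ℕ → ℕ) (j : ℕ) : ℝ :=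
  ∏ l ∈ Finset.range j, ccos m (s l) / ccos m (t l)

/-- The angles of the vertices with index `0` of a celestial construction started at `1`. -/
def pha (s t : ℕ → ℕ) (j : ℕ) : ℤ := ∑ l ∈ Finset.range j, ((s l : ℤ) - t l)

/-- The vertices of the celestial construction for sequences of parameters. -/
noncomputable def vert (m : ℕ) (s t : ℕ → ℕ) (z : ℂ) (j : ℕ) (i : ℤ) : ℂ :=
  z * (rad m s t j : ℂ) * rot m (2 * i + pha s t j)

/-- The lines of the celestial construction for sequences of parameters. -/
noncomputable def chord (m : ℕ) (s t : ℕ → ℕ) (z : ℂ) (j : ℕ) (i : ℤ) : AffineSubspace ℝ ℂ :=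
  line[ℝ, vert m s t z j i, vert m s t z j (i + s j)]

theorem rad_succ (m : ℕ) (s t : ℕ → ℕ) (j : ℕ) :
    rad m s t (j + 1) = rad m s t j * (ccos m (s j) / ccos m (t j)) :=
  Finset.prod_range_succ _ _

theorem pha_succ (s t : ℕ → ℕ) (j : ℕ) : pha s t (j + 1) = pha s t j + (s j - t j) :=
  Finset.sum_range_succ _ _

theorem ccos_pos {m x : ℕ} (h : 2 * x < m) : 0 < ccos m x := by
  rw [ccos_eq_cosi]
  exact cosi_pos (by omega) (by omega) (by omega)

theorem rad_pos {m : ℕ} {s t : ℕ → ℕ} (hs : ∀ j, 2 * s j < m) (ht : ∀ j, 2 * t j < m) (j : ℕ) :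
    0 < rad m s t j :=
  Finset.prod_pos fun l _ => div_pos (ccos_pos (hs l)) (ccos_pos (ht l))

/-- After division by `g` the line is vertical. -/
theorem mem_line_pair_iff {g A : ℂ} (hg : g ≠ 0) (hA : A.im ≠ 0) (p : ℂ) :
    p ∈ line[ℝ, g * conj A, g * A] ↔ (p / g).re = A.re := by
  rw [mem_affineSpan_pair_iff_exists_lineMap_eq]
  constructor
  · rintro ⟨r, rfl⟩
    have : AffineMap.lineMap (g * conj A) (g * A) r / g = conj A + r * (A - conj A) := by
      rw [AffineMap.lineMap_apply]
      simp only [vsub_eq_sub, vadd_eq_add, Complex.real_smul]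
      field_simp
      ring
    rw [this]
    simp
  · intro h
    obtain ⟨q, rfl⟩ : ∃ q, p = g * q := ⟨p / g, by field_simp⟩
    rw [mul_div_cancel_left₀ q hg] at h
    refine ⟨(q.im / A.im + 1) / 2, ?_⟩
    rw [AffineMap.lineMap_apply]
    simp only [vsub_eq_sub, vadd_eq_add, Complex.real_smul]
    have : q = conj A + (((q.im / A.im + 1) / 2 : ℝ) : ℂ) * (A - conj A) := by
      apply Complex.ext
      · simp [h]
      · simp
        field_simp
        ring
    conv_rhs => rw [this]
    ring

section

variable {m : ℕ} {s t : ℕ → ℕ}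

/-- The normal form of the line: `2 i + pha s t j + s j` gives the direction of the midpoint of the
chord, and the right side is its distance from the centre for `z = 1`. All incidences are read off
from this. -/
theorem mem_chord_iff (hs : ∀ j, 0 < s j ∧ 2 * s j < m) (ht : ∀ j, 2 * t j < m)
    {z : ℂ} (hz : z ≠ 0) (j : ℕ) (i : ℤ) (p : ℂ) :
    p ∈ chord m s t z j i ↔
      (rot m (-(2 * i + pha s t j + s j)) * (p / z)).re = rad m s t j * ccos m (s j) := by
  have hr := rad_pos (fun j => (hs j).2) ht j
  have key := mem_line_pair_iff (g := z * rot m (2 * i + pha s t j + s j))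
    (A := rad m s t j * rot m (s j)) (mul_ne_zero hz (rot_ne_zero _ _))
    (by simpa using ⟨hr.ne', (rot_im_pos (hs j).1 (hs j).2).ne'⟩) p
  have hc : conj (rot m (s j)) = rot m (-(s j : ℤ)) := by
    apply Complex.ext
    · simp [rot_neg_re]
    · simp [rot_neg_im]
  have e1 : z * rot m (2 * i + pha s t j + s j) * conj (rad m s t j * rot m (s j)) =
      vert m s t z j i := by
    rw [map_mul, hc, Complex.conj_ofReal, vert, rot_add m _ (s j : ℤ)]
    linear_combination z * rad m s t j * rot m (2 * i + pha s t j) * rot_neg_mul m (s j : ℤ)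
  have e2 : z * rot m (2 * i + pha s t j + s j) * (rad m s t j * rot m (s j)) =
      vert m s t z j (i + s j) := by
    rw [vert, show 2 * (i + s j : ℤ) + pha s t j = (2 * i + pha s t j + s j) + s j by ring,
      rot_add m (2 * i + pha s t j + s j)]
    ring
  rw [e1, e2] at key
  unfold chord
  rw [key]
  have e3 : p / (z * rot m (2 * i + pha s t j + s j)) =
      rot m (-(2 * i + pha s t j + s j)) * (p / z) := by
    rw [div_eq_iff (mul_ne_zero hz (rot_ne_zero _ _))]
    have := rot_neg_mul m (2 * i + pha s t j + s j)
    field_simp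
    linear_combination -p * this
  rw [e3, Complex.re_ofReal_mul, rot_re m (s j), ← ccos_eq_cosi]

theorem chord_eq_chord (hs : ∀ j, 0 < s j ∧ 2 * s j < m) (ht : ∀ j, 2 * t j < m)
    {z : ℂ} (hz : z ≠ 0) {j k : ℕ} {i l : ℤ}
    (h : rad m s t j * ccos m (s j) = rad m s t k * ccos m (s k))
    (h' : rot m (2 * i + pha s t j + s j) = rot m (2 * l + pha s t k + s k)) :
    chord m s t z j i = chord m s t z k l := by
  have hn : rot m (-(2 * i + pha s t j + s j)) = rot m (-(2 * l + pha s t k + s k)) := by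
    apply mul_right_cancel₀ (rot_ne_zero m (2 * i + pha s t j + s j))
    rw [rot_neg_mul, h', rot_neg_mul]
  ext p
  rw [mem_chord_iff hs ht hz, mem_chord_iff hs ht hz, h, hn]

/-- The sequence without its first term. -/
def tail (s : ℕ → ℕ) : ℕ → ℕ := fun j => s (j + 1)

/-- Both sides are the product of the first `j + 1` cosines of `s` divided by that of the first `j`
cosines of `t`. So the distance of `L_j` from the centre is the radius of the class `v_j` of the
shifted construction started at the foot of the perpendicular on `(L_0)_0`. -/
theorem ccos_mul_rad_tail (ht : ∀ j, 2 * t j < m) (j : ℕ) :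
    ccos m (s 0) * rad m (tail s) t j = rad m s t j * ccos m (s j) := by
  induction j with
  | zero => simp [rad]
  | succ j ih =>
    rw [rad_succ, rad_succ, ← mul_assoc, ih, tail]
    have := (ccos_pos (ht j)).ne'
    ring

theorem pha_tail_add (s t : ℕ → ℕ) (j : ℕ) : pha (tail s) t j + s 0 = pha s t j + s j := by
  induction j with
  | zero => simp [pha]
  | succ j ih =>
    rw [pha_succ, pha_succ, tail]
    linear_combination ih

/-- The distance of `L_j` in the shifted copy and the radius of `v_{j+2}` in the first one differ
only by two consecutive cosines of `t`, whose product is constant for alternating `t`. -/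
theorem rad_tail_mul_ccos (ht : ∀ j, 2 * t j < m) (j : ℕ) :
    rad m (tail s) t j * ccos m (tail s j) * ccos m (s 0) =
      rad m s t (j + 2) * (ccos m (t j) * ccos m (t (j + 1))) := by
  have h1 := (ccos_pos (ht j)).ne'
  have h2 := (ccos_pos (ht (j + 1))).ne'
  rw [rad_succ, rad_succ, mul_right_comm, mul_comm (rad m (tail s) t j), ccos_mul_rad_tail ht,
    tail]
  field_simp

theorem pha_add_two (s t : ℕ → ℕ) (j : ℕ) :
    pha s t (j + 2) = pha (tail s) t j + s 0 + tail s j - (t j + t (j + 1)) := by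
  rw [pha_succ, pha_succ, pha_tail_add, tail]
  ring

/-- The points of the line `(L_0)_0`. -/
noncomputable def startPoint (m : ℕ) (s : ℕ → ℕ) (x : ℝ) : ℂ :=
  ccos m (s 0) * rot m (s 0) * (1 + x * Complex.I)

theorem one_add_mul_I_ne_zero (x : ℝ) : 1 + x * Complex.I ≠ 0 := by
  intro h
  have := congrArg Complex.re h
  simp at this

theorem startPoint_ne_zero (hs : ∀ j, 2 * s j < m) (x : ℝ) : startPoint m s x ≠ 0 :=
  mul_ne_zero (mul_ne_zero (by exact_mod_cast (ccos_pos (hs 0)).ne') (rot_ne_zero _ _))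
    (one_add_mul_I_ne_zero x)

theorem mem_chord_zero_iff (hs : ∀ j, 0 < s j ∧ 2 * s j < m) (ht : ∀ j, 2 * t j < m) (w : ℂ) :
    w ∈ chord m s t 1 0 0 ↔ ∃ x : ℝ, w = startPoint m s x := by
  have h0 := (ccos_pos (hs 0).2).ne'
  rw [mem_chord_iff hs ht one_ne_zero, div_one, mul_zero, zero_add,
    show pha s t 0 = 0 from rfl, zero_add, show rad m s t 0 = 1 from rfl, one_mul]
  constructor
  · intro h
    refine ⟨(rot m (-(s 0 : ℤ)) * w).im / ccos m (s 0), ?_⟩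
    have e : rot m (-(s 0 : ℤ)) * w = ccos m (s 0) *
        (1 + ((rot m (-(s 0 : ℤ)) * w).im / ccos m (s 0) : ℝ) * Complex.I) := by
      apply Complex.ext
      · rw [h]
        simp
      · simp
        field_simp
    apply mul_left_cancel₀ (rot_ne_zero m (-(s 0 : ℤ)))
    rw [startPoint]
    conv_lhs => rw [e]
    generalize (1 + (((rot m (-(s 0 : ℤ)) * w).im / ccos m (s 0) : ℝ) : ℂ) * Complex.I) = g
    linear_combination -(ccos m (s 0) : ℂ) * g * rot_neg_mul m (s 0)
  · rintro ⟨x, rfl⟩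
    have : rot m (-(s 0 : ℤ)) * startPoint m s x = ccos m (s 0) * (1 + x * Complex.I) := by
      rw [startPoint]
      linear_combination (ccos m (s 0) : ℂ) * (1 + x * Complex.I) * rot_neg_mul m (s 0)
    rw [this, Complex.re_ofReal_mul]
    simp

/-- The condition is linear in `x`; for the intended incidence `N = 0`, and `x` drops out. -/
theorem vert_tail_mem_chord_iff (hs : ∀ j, 0 < s j ∧ 2 * s j < m) (ht : ∀ j, 2 * t j < m)
    (x : ℝ) (j k : ℕ) (i l N : ℤ)
    (hN : N = 2 * i + pha s t j + s j - (2 * l + pha s t k + s k)) :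
    vert m (tail s) t (startPoint m s x) j i ∈ chord m s t 1 k l ↔
      rad m s t j * ccos m (s j) * ((rot m N).re - x * (rot m N).im) =
        rad m s t k * ccos m (s k) := by
  rw [mem_chord_iff hs ht one_ne_zero, div_one]
  have e : rot m (-(2 * l + pha s t k + s k)) * vert m (tail s) t (startPoint m s x) j i =
      ((rad m s t j * ccos m (s j) : ℝ) : ℂ) * (rot m N * (1 + x * Complex.I)) := by
    rw [← ccos_mul_rad_tail ht, vert, startPoint,
      show N = -(2 * l + pha s t k + s k) + s 0 + (2 * i + pha (tail s) t j) by
        rw [hN]; linear_combination -pha_tail_add s t j,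
      rot_add _ (-(2 * l + pha s t k + s k) + s 0), rot_add _ (-(2 * l + pha s t k + s k))]
    push_cast
    ring
  rw [e, Complex.re_ofReal_mul]
  simp [mul_comm x]

/-- The second copy is scaled by `startPoint m s x`, and dividing by `1 + x I` brings in the factor
`(1 - x I) / (1 + x ^ 2)`. Hence the condition is quadratic in `x`. -/
theorem vert_mem_chord_tail_iff (hs : ∀ j, 0 < s j ∧ 2 * s j < m) (ht : ∀ j, 2 * t j < m)
    (x : ℝ) (j k : ℕ) (i l N : ℤ)
    (hN : N = 2 * i + pha s t k - s 0 - (2 * l + pha (tail s) t j + tail s j)) :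
    vert m s t 1 k i ∈ chord m (tail s) t (startPoint m s x) j l ↔
      rad m s t k * ((rot m N).re + x * (rot m N).im) =
        rad m (tail s) t j * ccos m (tail s j) * ccos m (s 0) * (1 + x ^ 2) := by
  have h0 := ccos_pos (hs 0).2
  have hx := one_add_mul_I_ne_zero x
  have hx' : (0 : ℝ) < 1 + x ^ 2 := by positivity
  rw [mem_chord_iff (s := tail s) (fun j => hs (j + 1)) ht (startPoint_ne_zero (fun j => (hs j).2) x)]
  have e : rot m (-(2 * l + pha (tail s) t j + tail s j)) *
      (vert m s t 1 k i / startPoint m s x) =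
      ((rad m s t k / (ccos m (s 0) * (1 + x ^ 2)) : ℝ) : ℂ) *
        (rot m N * (1 - x * Complex.I)) := by
    rw [vert, startPoint, show 2 * i + pha s t k = N + s 0 +
      (2 * l + pha (tail s) t j + tail s j) by rw [hN]; ring, rot_add _ (N + s 0), rot_add]
    have h1 := rot_neg_mul m (2 * l + pha (tail s) t j + tail s j)
    have h0' : (ccos m (s 0) : ℂ) ≠ 0 := by exact_mod_cast h0.ne'
    have h2 := rot_ne_zero m (s 0)
    have h3 : (1 + (x : ℂ) ^ 2) ≠ 0 := by exact_mod_cast hx'.ne'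
    rw [mul_div_assoc', div_eq_iff (mul_ne_zero (mul_ne_zero h0' h2) hx)]
    push_cast
    rw [div_mul_eq_mul_div, div_mul_eq_mul_div, eq_div_iff (mul_ne_zero h0' h3)]
    linear_combination rad m s t k * rot m N * rot m (s 0) * ccos m (s 0) *
      (1 + (x : ℂ) ^ 2) * h1 + rad m s t k * rot m N * rot m (s 0) * ccos m (s 0) * x ^ 2 *
      Complex.I_sq
  rw [e, Complex.re_ofReal_mul]
  rw [div_mul_eq_mul_div, div_eq_iff (by positivity)]
  have : (rot m N * (1 - x * Complex.I)).re = (rot m N).re + x * (rot m N).im := by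
    simp [mul_comm x]
  rw [this]
  constructor <;> intro h <;> linear_combination h

/-- The map `y ↦ y⁻¹` takes the circle through `0`, `A` and `conj A` to the line through `A` and
`conj A`, as `A` has norm one. In coordinates, the centre of the circle is `1 / (2 A.re)`. -/
theorem cospherical_iff {A y g : ℂ} (hA : A.im ≠ 0) (hA' : A.re ≠ 0)
    (hA1 : A.re ^ 2 + A.im ^ 2 = 1) (hg : g ≠ 0) (hy : y ≠ 0) :
    EuclideanGeometry.Cospherical ({g * A, 0, g * conj A, g * y} : Set ℂ) ↔
      (y⁻¹).re = A.re := by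
  have hy' : 0 < Complex.normSq y := Complex.normSq_pos.2 hy
  have hd : ∀ a b : ℂ, dist (g * a) (g * b) = ‖g‖ * dist a b := by
    intro a b
    rw [dist_eq_norm, dist_eq_norm, ← mul_sub, norm_mul]
  have hg' : ‖g‖ ≠ 0 := norm_ne_zero_iff.2 hg
  have hsq : ∀ a o : ℂ, dist a o = dist 0 o ↔
      a.re ^ 2 + a.im ^ 2 = 2 * (a.re * o.re + a.im * o.im) := by
    intro a o
    rw [← sq_eq_sq₀ dist_nonneg dist_nonneg, Complex.dist_eq, Complex.dist_eq,
      ← Complex.normSq_eq_norm_sq, ← Complex.normSq_eq_norm_sq, Complex.normSq_apply,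
      Complex.normSq_apply]
    simp only [Complex.sub_re, Complex.sub_im, Complex.zero_re, Complex.zero_im]
    constructor <;> intro h <;> linear_combination h
  rw [Complex.inv_re, div_eq_iff hy'.ne', Complex.normSq_apply]
  constructor
  · rintro ⟨o, r, h⟩
    have ho : o = g * (o / g) := by field_simp
    rw [ho] at h
    generalize o / g = u at h
    have h0 := h 0 (by simp)
    have key : ∀ a, dist (g * a) (g * u) = r → dist a u = dist 0 u := by
      intro a ha
      rw [← h0] at ha
      have : dist (g * a) (g * u) = dist (g * 0) (g * u) := by rwa [mul_zero]
      rw [hd, hd] at this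
      exact mul_left_cancel₀ hg' this
    have h1 := (hsq _ _).1 (key _ (h (g * A) (by simp)))
    have h2 := (hsq _ _).1 (key _ (h (g * conj A) (by simp)))
    have h3 := (hsq _ _).1 (key _ (h (g * y) (by simp)))
    simp only [Complex.conj_re, Complex.conj_im] at h2
    have hu : u.im = 0 := by
      have : A.im * u.im = 0 := by linear_combination (h2 - h1) / 4
      simpa [hA] using this
    rw [hu] at h1 h3
    have : 2 * A.re * u.re = 1 := by linear_combination hA1 - h1
    linear_combination -y.re * this - A.re * h3
  · intro h
    refine ⟨g * ((1 / (2 * A.re) : ℝ) : ℂ), dist 0 (g * ((1 / (2 * A.re) : ℝ) : ℂ)), ?_⟩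
    have key : ∀ a : ℂ, A.re * (a.re ^ 2 + a.im ^ 2) = a.re →
        dist (g * a) (g * ((1 / (2 * A.re) : ℝ) : ℂ)) =
          dist 0 (g * ((1 / (2 * A.re) : ℝ) : ℂ)) := by
      intro a ha
      have : dist (g * a) (g * ((1 / (2 * A.re) : ℝ) : ℂ)) =
          dist (g * 0) (g * ((1 / (2 * A.re) : ℝ) : ℂ)) := by
        rw [hd, hd, (hsq _ _).2]
        rw [Complex.ofReal_re, Complex.ofReal_im]
        field_simp
        linear_combination ha
      rwa [mul_zero] at this
    rintro p (rfl | rfl | rfl | rfl)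
    · exact key _ (by rw [hA1, mul_one])
    · rfl
    · exact key _ (by simp [hA1])
    · exact key _ (by linear_combination -h)

end

/-! ### Unions and similar copies of configurations -/

/-- Sending a point to its only line is a surjection between finite sets of the same size, hence
injective. -/
theorem ncard_incident_eq_one {P : Set ℂ} {L : Set (AffineSubspace ℝ ℂ)} (hP : P.Finite)
    (hc : P.ncard = L.ncard) (h : ∀ p ∈ P, {l | l ∈ L ∧ p ∈ l}.ncard = 1)
    (h' : ∀ l ∈ L, ∃ p ∈ P, p ∈ l) : ∀ l ∈ L, {p | p ∈ P ∧ p ∈ l}.ncard = 1 := by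
  have h1 : ∀ p : P, ∃ l, {l | l ∈ L ∧ (p : ℂ) ∈ l} = {l} := fun p =>
    Set.ncard_eq_one.1 (h p p.2)
  choose f hf using h1
  have hfL : ∀ p : P, f p ∈ L ∧ (p : ℂ) ∈ f p := fun p => by
    have : f p ∈ {l | l ∈ L ∧ (p : ℂ) ∈ l} := by
      rw [hf p]
      rfl
    exact this
  have hfu : ∀ (p : P) l, l ∈ L → (p : ℂ) ∈ l → l = f p := fun p l hl hp => by
    have : l ∈ {l | l ∈ L ∧ (p : ℂ) ∈ l} := ⟨hl, hp⟩
    rwa [hf p] at this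
  have hinj := Set.inj_on_of_surj_on_of_ncard_le (s := P) (t := L) (fun p hp => f ⟨p, hp⟩)
    (fun p hp => (hfL ⟨p, hp⟩).1)
    (fun l hl => by
      obtain ⟨p, hp, hpl⟩ := h' l hl
      exact ⟨p, hp, (hfu ⟨p, hp⟩ l hl hpl).symm⟩) hc.le
  intro l hl
  obtain ⟨p, hp, hpl⟩ := h' l hl
  refine Set.ncard_eq_one.2 ⟨p, ?_⟩
  ext q
  constructor
  · rintro ⟨hq, hql⟩
    exact hinj hq hp (by rw [← hfu ⟨q, hq⟩ l hl hql, ← hfu ⟨p, hp⟩ l hl hpl]) (hs := hP)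
  · rintro rfl
    exact ⟨hp, hpl⟩

theorem ncard_sep_union {α : Type*} {A B : Set α} (hA : A.Finite) (hB : B.Finite)
    (h : Disjoint A B) (Q : α → Prop) :
    {x | x ∈ A ∪ B ∧ Q x}.ncard = {x | x ∈ A ∧ Q x}.ncard + {x | x ∈ B ∧ Q x}.ncard := by
  rw [← Set.ncard_union_eq (h.mono (fun x hx => hx.1) (fun x hx => hx.1))
    (hA.subset fun x hx => hx.1) (hB.subset fun x hx => hx.1)]
  congr 1
  ext x
  simp only [Set.mem_ofPred_eq, Set.mem_union]
  tauto

/-- The union of two configurations, if each line of one of them passes through a point of the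
other one and each point of one of them lies on exactly one line of the other one. -/
theorem IsGeometricConfiguration.union {n k : ℕ} {P₁ P₂ : Set ℂ}
    {L₁ L₂ : Set (AffineSubspace ℝ ℂ)} (h₁ : IsGeometricConfiguration n k P₁ L₁)
    (h₂ : IsGeometricConfiguration n k P₂ L₂) (hP : Disjoint P₁ P₂) (hL : Disjoint L₁ L₂)
    (h12 : ∀ p ∈ P₁, {l | l ∈ L₂ ∧ p ∈ l}.ncard = 1)
    (h21 : ∀ p ∈ P₂, {l | l ∈ L₁ ∧ p ∈ l}.ncard = 1)
    (g12 : ∀ l ∈ L₂, ∃ p ∈ P₁, p ∈ l) (g21 : ∀ l ∈ L₁, ∃ p ∈ P₂, p ∈ l) :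
    IsGeometricConfiguration (2 * n) (k + 1) (P₁ ∪ P₂) (L₁ ∪ L₂) where
  finite_points := h₁.finite_points.union h₂.finite_points
  finite_lines := h₁.finite_lines.union h₂.finite_lines
  card_points := by
    rw [Set.ncard_union_eq hP h₁.finite_points h₂.finite_points, h₁.card_points,
      h₂.card_points, two_mul]
  card_lines := by
    rw [Set.ncard_union_eq hL h₁.finite_lines h₂.finite_lines, h₁.card_lines,
      h₂.card_lines, two_mul]
  isLine := by
    rintro l (hl | hl)
    exacts [h₁.isLine l hl, h₂.isLine l hl]
  line_incidences := by
    intro l hl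
    rw [ncard_sep_union h₁.finite_points h₂.finite_points hP]
    rcases hl with hl | hl
    · rw [h₁.line_incidences l hl, ncard_incident_eq_one h₂.finite_points
        (by rw [h₂.card_points, h₁.card_lines]) h21 g21 l hl]
    · rw [h₂.line_incidences l hl, ncard_incident_eq_one h₁.finite_points
        (by rw [h₁.card_points, h₂.card_lines]) h12 g12 l hl, add_comm]
  point_incidences := by
    intro p hp
    rw [ncard_sep_union h₁.finite_lines h₂.finite_lines hL]
    rcases hp with hp | hp
    · rw [h₁.point_incidences p hp, h12 p hp]
    · rw [h₂.point_incidences p hp, h21 p hp, add_comm]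

theorem disjoint_of_ncard_union {α : Type*} {A B : Set α} (hA : A.Finite) (hB : B.Finite)
    {n : ℕ} (hAn : A.ncard = n) (hBn : B.ncard = n) (h : (A ∪ B).ncard = 2 * n) :
    Disjoint A B := by
  have h1 := Set.ncard_union_add_ncard_inter A B hA hB
  rw [Set.disjoint_iff_inter_eq_empty, ← Set.ncard_eq_zero (hA.inter_of_left B)]
  omega

/-- If no point of the union of two configurations lies on too many lines, the union is a
configuration. -/
theorem IsGeometricConfiguration.union_of_le {n k : ℕ} {P₁ P₂ : Set ℂ}
    {L₁ L₂ : Set (AffineSubspace ℝ ℂ)} (h₁ : IsGeometricConfiguration n k P₁ L₁)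
    (h₂ : IsGeometricConfiguration n k P₂ L₂) (hP : (P₁ ∪ P₂).ncard = 2 * n)
    (hL : (L₁ ∪ L₂).ncard = 2 * n)
    (hle : ∀ p ∈ P₁ ∪ P₂, {l | l ∈ L₁ ∪ L₂ ∧ p ∈ l}.ncard ≤ k + 1)
    (h12 : ∀ p ∈ P₁, ∃ l ∈ L₂, p ∈ l) (h21 : ∀ p ∈ P₂, ∃ l ∈ L₁, p ∈ l)
    (g12 : ∀ l ∈ L₂, ∃ p ∈ P₁, p ∈ l) (g21 : ∀ l ∈ L₁, ∃ p ∈ P₂, p ∈ l) :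
    IsGeometricConfiguration (2 * n) (k + 1) (P₁ ∪ P₂) (L₁ ∪ L₂) := by
  have hLd := disjoint_of_ncard_union h₁.finite_lines h₂.finite_lines h₁.card_lines
    h₂.card_lines hL
  refine h₁.union h₂ (disjoint_of_ncard_union h₁.finite_points h₂.finite_points h₁.card_points
    h₂.card_points hP) hLd (fun p hp => ?_) (fun p hp => ?_) g12 g21
  · have h := hle p (Or.inl hp)
    rw [ncard_sep_union h₁.finite_lines h₂.finite_lines hLd, h₁.point_incidences p hp] at h
    have : 0 < {l | l ∈ L₂ ∧ p ∈ l}.ncard :=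
      (Set.ncard_pos (h₂.finite_lines.subset fun x hx => hx.1)).2 (h12 p hp)
    omega
  · have h := hle p (Or.inr hp)
    rw [ncard_sep_union h₁.finite_lines h₂.finite_lines hLd, h₂.point_incidences p hp] at h
    have : 0 < {l | l ∈ L₁ ∧ p ∈ l}.ncard :=
      (Set.ncard_pos (h₁.finite_lines.subset fun x hx => hx.1)).2 (h21 p hp)
    omega

/-- If each point of one of two configurations lies on a unique line of the other one, the union
is a configuration. -/
theorem IsGeometricConfiguration.union_of_unique {n k : ℕ} (hk : 1 < k) {P₁ P₂ : Set ℂ}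
    {L₁ L₂ : Set (AffineSubspace ℝ ℂ)} (h₁ : IsGeometricConfiguration n k P₁ L₁)
    (h₂ : IsGeometricConfiguration n k P₂ L₂)
    (h12 : ∀ p ∈ P₁, ∃! l, l ∈ L₂ ∧ p ∈ l) (h21 : ∀ p ∈ P₂, ∃! l, l ∈ L₁ ∧ p ∈ l)
    (g12 : ∀ l ∈ L₂, ∃ p ∈ P₁, p ∈ l) (g21 : ∀ l ∈ L₁, ∃ p ∈ P₂, p ∈ l) :
    IsGeometricConfiguration (2 * n) (k + 1) (P₁ ∪ P₂) (L₁ ∪ L₂) := by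
  have one : ∀ {L : Set (AffineSubspace ℝ ℂ)} {p : ℂ}, (∃! l, l ∈ L ∧ p ∈ l) →
      {l | l ∈ L ∧ p ∈ l}.ncard = 1 := by
    rintro L p ⟨l, hl, hu⟩
    exact Set.ncard_eq_one.2 ⟨l, Set.eq_singleton_iff_unique_mem.2 ⟨hl, hu⟩⟩
  have h12' := fun p hp => one (h12 p hp)
  have h21' := fun p hp => one (h21 p hp)
  refine h₁.union h₂ ?_ ?_ h12' h21' g12 g21
  · rw [Set.disjoint_left]
    intro p hp hp'
    have := h₁.point_incidences p hp
    rw [h21' p hp'] at this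
    omega
  · rw [Set.disjoint_left]
    intro l hl hl'
    have := h₁.line_incidences l hl
    rw [ncard_incident_eq_one h₁.finite_points (by rw [h₁.card_points, h₂.card_lines]) h12' g12
      l hl'] at this
    omega

theorem IsGeometricConfiguration.map {n k : ℕ} {P : Set ℂ} {L : Set (AffineSubspace ℝ ℂ)}
    (h : IsGeometricConfiguration n k P L) (e : ℂ ≃ᵃ[ℝ] ℂ) :
    IsGeometricConfiguration n k (e '' P)
      ((fun l : AffineSubspace ℝ ℂ => l.map (e : ℂ →ᵃ[ℝ] ℂ)) '' L) := by
  have hmem : ∀ (p : ℂ) (l : AffineSubspace ℝ ℂ),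
      e p ∈ l.map (e : ℂ →ᵃ[ℝ] ℂ) ↔ p ∈ l := fun p l => by
    rw [← AffineEquiv.coe_toAffineMap, AffineSubspace.mem_map_iff_mem_of_injective]
    exact e.injective
  have hinj : Function.Injective
      (fun l : AffineSubspace ℝ ℂ => l.map (e : ℂ →ᵃ[ℝ] ℂ)) := by
    intro l l' hl
    ext p
    rw [← hmem p l, ← hmem p l']
    exact iff_of_eq (congrArg (e p ∈ ·) hl)
  refine ⟨h.finite_points.image _, h.finite_lines.image _, ?_, ?_, ?_, ?_, ?_⟩
  · rw [Set.ncard_image_of_injective _ e.injective, h.card_points]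
  · rw [Set.ncard_image_of_injective _ hinj, h.card_lines]
  · rintro _ ⟨l, hl, rfl⟩
    rw [← h.isLine l hl]
    dsimp only
    rw [AffineSubspace.map_direction]
    exact LinearEquiv.finrank_map_eq e.linear _
  · rintro _ ⟨l, hl, rfl⟩
    rw [← h.line_incidences l hl,
      ← Set.ncard_image_of_injective {p | p ∈ P ∧ p ∈ l} e.injective]
    congr 1
    ext p
    constructor
    · rintro ⟨⟨q, hq, rfl⟩, hp⟩
      exact ⟨q, ⟨hq, (hmem q l).1 hp⟩, rfl⟩
    · rintro ⟨q, ⟨hq, hql⟩, rfl⟩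
      exact ⟨⟨q, hq, rfl⟩, (hmem q l).2 hql⟩
  · rintro _ ⟨p, hp, rfl⟩
    rw [← h.point_incidences p hp,
      ← Set.ncard_image_of_injective {l | l ∈ L ∧ p ∈ l} hinj]
    congr 1
    ext l
    constructor
    · rintro ⟨⟨l', hl, rfl⟩, hp'⟩
      exact ⟨l', ⟨hl, (hmem p l').1 hp'⟩, rfl⟩
    · rintro ⟨l', ⟨hl, hpl⟩, rfl⟩
      exact ⟨⟨l', hl, rfl⟩, (hmem p l').2 hpl⟩

theorem celestialVertex_eq_mul (m : ℕ) {h : ℕ} (s t : Fin h → ℕ) (z : ℂ) (j : Fin h) (i : ℤ) :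
    celestialVertex m s t z j i = z * celestialVertex m s t 1 j i := by
  unfold celestialVertex
  ring

theorem IsGeometricConfiguration.celestial_of_ne_zero {m n k h : ℕ} {s t : Fin h → ℕ}
    (hc : IsGeometricConfiguration n k (celestialPoints m s t 1) (celestialLines m s t 1))
    {z : ℂ} (hz : z ≠ 0) :
    IsGeometricConfiguration n k (celestialPoints m s t z) (celestialLines m s t z) := by
  have := hc.map ((LinearEquiv.smulOfNeZero ℂ ℂ z hz).restrictScalars ℝ).toAffineEquiv
  convert this using 1
  · ext p
    constructor
    · rintro ⟨j, i, rfl⟩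
      exact ⟨_, ⟨j, i, rfl⟩, (celestialVertex_eq_mul m s t z j i).symm⟩
    · rintro ⟨_, ⟨j, i, rfl⟩, rfl⟩
      exact ⟨j, i, (celestialVertex_eq_mul m s t z j i).symm⟩
  · have key : ∀ j i, celestialLine m s t z j i = (celestialLine m s t 1 j i).map
        (((LinearEquiv.smulOfNeZero ℂ ℂ z hz).restrictScalars ℝ).toAffineEquiv : ℂ →ᵃ[ℝ] ℂ) := by
      intro j i
      rw [celestialLine, celestialLine, AffineSubspace.map_span, Set.image_pair,
        celestialVertex_eq_mul m s t z j i, celestialVertex_eq_mul m s t z j (i + s j)]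
      rfl
    ext l
    constructor
    · rintro ⟨j, i, rfl⟩
      exact ⟨_, ⟨j, i, rfl⟩, (key j i).symm⟩
    · rintro ⟨_, ⟨j, i, rfl⟩, rfl⟩
      exact ⟨j, i, (key j i).symm⟩

/-! ### Incidences between the two copies for `x` outside the cyclotomic field -/

section

variable {m : ℕ} {s t : ℕ → ℕ}

theorem rad_mem_realCyclotomic (m : ℕ) (s t : ℕ → ℕ) (j : ℕ) :
    rad m s t j ∈ realCyclotomic m := by
  refine prod_mem fun l _ => ?_
  rw [ccos_eq_cosi, ccos_eq_cosi]
  exact div_mem (cos_mem_realCyclotomic _) (cos_mem_realCyclotomic _)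

theorem ccos_mem_realCyclotomic (m x : ℕ) : ccos m x ∈ realCyclotomic m := by
  rw [ccos_eq_cosi]
  exact cos_mem_realCyclotomic _

theorem rot_re_mem_realCyclotomic (m : ℕ) (N : ℤ) : (rot m N).re ∈ realCyclotomic m := by
  rw [rot_re]
  exact cos_mem_realCyclotomic _

theorem rot_im_mem_realCyclotomic (hm : 0 < m) (N : ℤ) : (rot m N).im ∈ realCyclotomic m := by
  rw [rot_im]
  exact sin_mem_realCyclotomic hm _

theorem Subfield.eq_zero_of_add_mul_eq_zero {K : Subfield ℝ} {x α β : ℝ} (hx : x ∉ K)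
    (hα : α ∈ K) (hβ : β ∈ K) (h : α + β * x = 0) : α = 0 ∧ β = 0 := by
  have hβ0 : β = 0 := by
    by_contra hne
    apply hx
    rw [show x = -α / β by field_simp; linear_combination h]
    exact div_mem (neg_mem hα) hβ
  rw [hβ0] at h
  exact ⟨by linear_combination h, hβ0⟩

/-- The points of the celestial construction for sequences of parameters. -/
def vertSet (m : ℕ) (s t : ℕ → ℕ) (z : ℂ) : Set ℂ := {p | ∃ j i, p = vert m s t z j i}

/-- The lines of the celestial construction for sequences of parameters. -/
def chordSet (m : ℕ) (s t : ℕ → ℕ) (z : ℂ) : Set (AffineSubspace ℝ ℂ) :=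
  {l | ∃ j i, l = chord m s t z j i}

theorem vert_tail_mem_chord (hs : ∀ j, 0 < s j ∧ 2 * s j < m) (ht : ∀ j, 2 * t j < m)
    (x : ℝ) (j : ℕ) (i : ℤ) :
    vert m (tail s) t (startPoint m s x) j i ∈ chord m s t 1 j i := by
  rw [vert_tail_mem_chord_iff hs ht x j j i i 0 (by ring), rot_zero]
  simp

/-- The condition is linear in `x` over the field, so both coefficients vanish: the rotation `rot m
N` is real, positivity makes it `1`, and the two lines have the same direction and the same distance
from the centre. -/
theorem existsUnique_chord (hs : ∀ j, 0 < s j ∧ 2 * s j < m) (ht : ∀ j, 2 * t j < m)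
    {x : ℝ} (hx : x ∉ realCyclotomic m) {p : ℂ}
    (hp : p ∈ vertSet m (tail s) t (startPoint m s x)) :
    ∃! l, l ∈ chordSet m s t 1 ∧ p ∈ l := by
  have hm : 0 < m := by have := hs 0; omega
  have hD : ∀ k, 0 < rad m s t k * ccos m (s k) := fun k =>
    mul_pos (rad_pos (fun j => (hs j).2) ht k) (ccos_pos (hs k).2)
  have hDK : ∀ k, rad m s t k * ccos m (s k) ∈ realCyclotomic m := fun k =>
    mul_mem (rad_mem_realCyclotomic _ _ _ _) (ccos_mem_realCyclotomic _ _)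
  obtain ⟨j, i, rfl⟩ := hp
  refine ⟨chord m s t 1 j i, ⟨⟨j, i, rfl⟩, vert_tail_mem_chord hs ht x j i⟩, ?_⟩
  rintro _ ⟨⟨k, l, rfl⟩, hmem⟩
  rw [vert_tail_mem_chord_iff hs ht x j k i l _ rfl] at hmem
  generalize hN : 2 * i + pha s t j + s j - (2 * l + pha s t k + s k) = N at hmem
  have hre := rot_re_mem_realCyclotomic m N
  have him := rot_im_mem_realCyclotomic hm N
  obtain ⟨h1, h2⟩ := Subfield.eq_zero_of_add_mul_eq_zero hx
    (sub_mem (mul_mem (hDK j) hre) (hDK k)) (neg_mem (mul_mem (hDK j) him))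
    (by linear_combination hmem)
  have him0 : (rot m N).im = 0 := by
    simpa [(hD j).ne'] using h2
  have hsq := rot_re_sq_add_im_sq m N
  have hpos : 0 < (rot m N).re := by
    have : 0 < rad m s t j * ccos m (s j) * (rot m N).re := by
      have := hD k
      linarith
    exact (pos_iff_pos_of_mul_pos this).1 (hD j)
  have hre1 : (rot m N).re = 1 := by
    rw [him0] at hsq
    nlinarith
  have hone : rot m N = 1 := Complex.ext (by simpa using hre1) (by simpa using him0)
  refine (chord_eq_chord hs ht one_ne_zero ?_ ?_).symm
  · rw [hre1] at h1
    linear_combination h1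
  · exact rot_eq_of_re_of_mul_eq_one (by rw [hN, hone])

theorem add_succ_of_alternating (ht2 : ∀ j, t (j + 2) = t j) (j : ℕ) : t j + t (j + 1) = t 0 + t 1 := by
  induction j with
  | zero => rfl
  | succ j ih => rw [← ih, show j + 1 + 1 = j + 2 from rfl, ht2, add_comm]

theorem mul_succ_of_alternating (ht2 : ∀ j, t (j + 2) = t j) (f : ℕ → ℝ) (j : ℕ) :
    f (t j) * f (t (j + 1)) = f (t 0) * f (t 1) := by
  induction j with
  | zero => rfl
  | succ j ih => rw [← ih, show j + 1 + 1 = j + 2 from rfl, ht2, mul_comm]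

/-- The condition does not depend on `j` or `i`: one solution `x` produces the incidences for all
classes. -/
theorem vert_add_two_mem_chord_tail_iff (hs : ∀ j, 0 < s j ∧ 2 * s j < m) (ht : ∀ j, 2 * t j < m)
    (ht2 : ∀ j, t (j + 2) = t j) (x : ℝ) (j : ℕ) (i e : ℤ) :
    vert m s t 1 (j + 2) (i + e) ∈ chord m (tail s) t (startPoint m s x) j i ↔
      (rot m (2 * e - (t 0 + t 1 : ℕ))).re + x * (rot m (2 * e - (t 0 + t 1 : ℕ))).im =
        ccos m (t 0) * ccos m (t 1) * (1 + x ^ 2) := by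
  have hr := (rad_pos (fun j => (hs j).2) ht (j + 2)).ne'
  rw [vert_mem_chord_tail_iff hs ht x j (j + 2) (i + e) i (2 * e - (t 0 + t 1 : ℕ)) (by
    rw [pha_add_two, ← add_succ_of_alternating ht2 j]
    push_cast
    ring), rad_tail_mul_ccos ht, mul_succ_of_alternating ht2 (ccos m), mul_assoc]
  exact mul_right_inj' hr

/-- Eliminating `x ^ 2` between the incidence condition and the quadratic equation leaves a linear
relation over the field. Its vanishing coefficients determine the distance and the direction of the
line from the point and `ψ`. -/
theorem existsUnique_chord_tail (hs : ∀ j, 0 < s j ∧ 2 * s j < m) (ht : ∀ j, 2 * t j < m)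
    {x : ℝ} (hx : x ∉ realCyclotomic m) {ψ : ℤ}
    (hxψ : ccos m (t 0) * ccos m (t 1) * (1 + x ^ 2) + (rot m ψ).im * x = (rot m ψ).re)
    {p : ℂ} (hp : ∃ l ∈ chordSet m (tail s) t (startPoint m s x), p ∈ l)
    (hp' : p ∈ vertSet m s t 1) :
    ∃! l, l ∈ chordSet m (tail s) t (startPoint m s x) ∧ p ∈ l := by
  have hm : 0 < m := by have := hs 0; omega
  obtain ⟨k, i, rfl⟩ := hp'
  have hr := rad_pos (fun j => (hs j).2) ht k
  have h0 := ccos_pos (hs 0).2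
  have hc : 0 < ccos m (t 0) * ccos m (t 1) := mul_pos (ccos_pos (ht 0)) (ccos_pos (ht 1))
  have key : ∀ j l, vert m s t 1 k i ∈ chord m (tail s) t (startPoint m s x) j l →
      rad m (tail s) t j * ccos m (tail s j) =
        ccos m (t 0) * ccos m (t 1) * rad m s t k / ccos m (s 0) ∧
      rot m (2 * l + pha (tail s) t j + tail s j) = rot m (2 * i + pha s t k - s 0 + ψ) := by
    intro j l hmem
    rw [vert_mem_chord_tail_iff hs ht x j k i l _ rfl] at hmem
    have hre := rot_re_mem_realCyclotomic m
      (2 * i + pha s t k - s 0 - (2 * l + pha (tail s) t j + tail s j))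
    have him := rot_im_mem_realCyclotomic hm
      (2 * i + pha s t k - s 0 - (2 * l + pha (tail s) t j + tail s j))
    have hsq := rot_re_sq_add_im_sq m
      (2 * i + pha s t k - s 0 - (2 * l + pha (tail s) t j + tail s j))
    have hre' := rot_re_mem_realCyclotomic m ψ
    have him' := rot_im_mem_realCyclotomic hm ψ
    have hsq' := rot_re_sq_add_im_sq m ψ
    have hD : 0 < rad m (tail s) t j * ccos m (tail s j) :=
      mul_pos (rad_pos (s := tail s) (fun j => (hs (j + 1)).2) ht j) (ccos_pos (hs (j + 1)).2)
    have hDK : rad m (tail s) t j * ccos m (tail s j) ∈ realCyclotomic m :=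
      mul_mem (rad_mem_realCyclotomic _ _ _ _) (ccos_mem_realCyclotomic _ _)
    have hcK : ccos m (t 0) * ccos m (t 1) ∈ realCyclotomic m :=
      mul_mem (ccos_mem_realCyclotomic _ _) (ccos_mem_realCyclotomic _ _)
    have hrK := rad_mem_realCyclotomic m s t k
    have h0K := ccos_mem_realCyclotomic m (s 0)
    have hrot : rot m (2 * i + pha s t k - s 0 + ψ) =
        rot m (2 * i + pha s t k - s 0 - (2 * l + pha (tail s) t j + tail s j)) * rot m ψ *
          rot m (2 * l + pha (tail s) t j + tail s j) := by
      rw [← rot_add, ← rot_add]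
      congr 1
      ring
    rw [hrot]
    generalize 2 * i + pha s t k - s 0 - (2 * l + pha (tail s) t j + tail s j) = N at *
    generalize rad m (tail s) t j * ccos m (tail s j) = D at *
    generalize ccos m (t 0) * ccos m (t 1) = c at *
    generalize rad m s t k = r at *
    obtain ⟨h1, h2⟩ := Subfield.eq_zero_of_add_mul_eq_zero hx
      (α := r * c * (rot m N).re - D * ccos m (s 0) * (rot m ψ).re)
      (β := r * c * (rot m N).im + D * ccos m (s 0) * (rot m ψ).im)
      (sub_mem (mul_mem (mul_mem hrK hcK) hre) (mul_mem (mul_mem hDK h0K) hre'))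
      (add_mem (mul_mem (mul_mem hrK hcK) him) (mul_mem (mul_mem hDK h0K) him'))
      (by linear_combination c * hmem + D * ccos m (s 0) * hxψ)
    -- The vanishing coefficients say that `r c` times `rot m N` and `D cos s_0` times the conjugate
    -- of `rot m ψ` agree; comparing absolute values gives this.
    have hκ : D * ccos m (s 0) = r * c := by
      have : (D * ccos m (s 0)) ^ 2 = (r * c) ^ 2 := by
        linear_combination (r * c) ^ 2 * hsq - (D * ccos m (s 0)) ^ 2 * hsq' -
          h1 * (r * c * (rot m N).re + D * ccos m (s 0) * (rot m ψ).re) -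
          h2 * (r * c * (rot m N).im - D * ccos m (s 0) * (rot m ψ).im)
      exact (pow_left_inj₀ (by positivity) (by positivity) two_ne_zero).1 this
    have hrc : r * c ≠ 0 := by positivity
    rw [hκ] at h1 h2
    have h1' : (rot m N).re = (rot m ψ).re := by
      apply mul_left_cancel₀ hrc
      linear_combination h1
    have h2' : (rot m N).im = -(rot m ψ).im := by
      apply mul_left_cancel₀ hrc
      linear_combination h2
    have hone : rot m N * rot m ψ = 1 := by
      apply Complex.ext
      · rw [Complex.mul_re, h1', h2', Complex.one_re]
        linear_combination hsq'
      · rw [Complex.mul_im, h1', h2', Complex.one_im]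
        ring
    refine ⟨?_, by rw [hone, one_mul]⟩
    rw [eq_div_iff h0.ne']
    linear_combination hκ
  obtain ⟨_, ⟨j, l, rfl⟩, hl⟩ := hp
  refine ⟨_, ⟨⟨j, l, rfl⟩, hl⟩, ?_⟩
  rintro _ ⟨⟨j', l', rfl⟩, hl'⟩
  obtain ⟨h1, h2⟩ := key _ _ hl
  obtain ⟨h3, h4⟩ := key _ _ hl'
  exact chord_eq_chord (s := tail s) (fun j => hs (j + 1)) ht
    (startPoint_ne_zero (fun j => (hs j).2) x) (h3.trans h1.symm) (h4.trans h2.symm)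

/-- The two vertices lie symmetrically about a ray from the centre, at the angle `π s_1 / m` from
it. The circle condition and the line condition are then the same linear equation for the inverse of
`w`. -/
theorem cospherical_vert_iff (hs : ∀ j, 0 < s j ∧ 2 * s j < m) (ht : ∀ j, 2 * t j < m)
    {w : ℂ} (hw : w ≠ 0) (e : ℤ) :
    EuclideanGeometry.Cospherical
      ({vert m s t 1 2 e, 0, vert m s t 1 2 (e - s 1), w} : Set ℂ) ↔
        vert m s t 1 2 e ∈ chord m (tail s) t w 0 0 := by
  have hr := rad_pos (fun j => (hs j).2) ht 2
  have hrc : (rad m s t 2 : ℂ) ≠ 0 := by exact_mod_cast hr.ne'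
  have hg : (rad m s t 2 : ℂ) * rot m (2 * e + pha s t 2 - s 1) ≠ 0 :=
    mul_ne_zero hrc (rot_ne_zero _ _)
  have hconj : conj (rot m (s 1)) = rot m (-(s 1 : ℤ)) := by
    apply Complex.ext
    · simp [rot_neg_re]
    · simp [rot_neg_im]
  have hre : (rot m (s 1)).re = ccos m (s 1) := by rw [rot_re, ccos_eq_cosi]
  have key := cospherical_iff (A := rot m (s 1)) (rot_im_pos (hs 1).1 (hs 1).2).ne'
    (by rw [hre]; exact (ccos_pos (hs 1).2).ne') (rot_re_sq_add_im_sq _ _) hg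
    (div_ne_zero hw hg)
  rw [mul_div_cancel₀ _ hg, hconj, mul_assoc, ← rot_add, mul_assoc, ← rot_add,
    show 2 * e + pha s t 2 - s 1 + s 1 = 2 * e + pha s t 2 by ring,
    show 2 * e + pha s t 2 - s 1 + -(s 1 : ℤ) = 2 * (e - s 1) + pha s t 2 by ring, hre] at key
  rw [mem_chord_iff (s := tail s) (fun j => hs (j + 1)) ht hw,
    show rad m (tail s) t 0 = 1 from rfl, show pha (tail s) t 0 = 0 from rfl,
    show tail s 0 = s 1 from rfl, vert, vert, one_mul, one_mul, key, inv_div]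
  have : rot m (-(2 * 0 + 0 + s 1)) * (rad m s t 2 * rot m (2 * e + pha s t 2) / w) =
      rad m s t 2 * rot m (2 * e + pha s t 2 - s 1) / w := by
    rw [show 2 * e + pha s t 2 - s 1 = -(2 * 0 + 0 + s 1) + (2 * e + pha s t 2) by ring,
      rot_add _ (-(2 * 0 + 0 + (s 1 : ℤ)))]
    ring
  rw [this]

end

/-! ### Cyclic parameter sequences and the general theorem -/

section

variable {m h : ℕ} [NeZero h]

/-- The periodic extension of a cyclic sequence. -/
def per (s : Fin h → ℕ) : ℕ → ℕ := fun l => s (Fin.ofNat h l)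

theorem per_val (s : Fin h → ℕ) (j : Fin h) : per s j = s j := by
  simp [per]

theorem per_add_self (s : Fin h → ℕ) (l : ℕ) : per s (l + h) = per s l := by
  unfold per
  congr 1
  ext
  simp

theorem ofNat_succ (l : ℕ) : Fin.ofNat h (l + 1) = Fin.ofNat h l + 1 := by
  ext
  simp [Fin.val_add]

theorem per_cyclicShift (s : Fin h → ℕ) : per (cyclicShift s) = tail (per s) := by
  funext l
  rw [tail, per, per, cyclicShift, ofNat_succ]

theorem per_add_two {t : Fin h → ℕ} (ht : ∀ j, t (j + 2) = t j) (l : ℕ) :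
    per t (l + 2) = per t l := by
  unfold per
  rw [← ht (Fin.ofNat h l)]
  congr 1
  ext
  change (l + 2) % h = (l % h + 2 % h) % h
  exact Nat.add_mod _ _ _

theorem celestialVertex_eq_vert (s t : Fin h → ℕ) (z : ℂ) (j : Fin h) (i : ℤ) :
    celestialVertex m s t z j i = vert m (per s) (per t) z j i := by
  have e : Finset.range (j : ℕ) = (Finset.Iio j).map Fin.valEmbedding := by
    rw [Fin.map_valEmbedding_Iio, Nat.Iio_eq_range]
  unfold celestialVertex vert rad pha rot
  rw [e, Finset.prod_map, Finset.sum_map]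
  simp only [Fin.valEmbedding_apply, per_val]
  push_cast
  rfl

theorem celestialLine_eq_chord (s t : Fin h → ℕ) (z : ℂ) (j : Fin h) (i : ℤ) :
    celestialLine m s t z j i = chord m (per s) (per t) z j i := by
  rw [celestialLine, chord, celestialVertex_eq_vert, celestialVertex_eq_vert, per_val]

theorem rad_per_self {s t : Fin h → ℕ}
    (hc : IsCelestialCohort m h (Finset.univ.val.map s) (Finset.univ.val.map t)) :
    rad m (per s) (per t) h = 1 := by
  have e := hc.cosine
  rw [Multiset.map_map, Multiset.map_map] at e
  have h1 : ∏ i, ccos m (s i) = ∏ i, ccos m (t i) := e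
  have h2 : 0 < ∏ i, ccos m (t i) := Finset.prod_pos fun i _ => ccos_pos
    (hc.right_range _ (Multiset.mem_map_of_mem t (Finset.mem_univ i))).2
  rw [rad, Finset.prod_range]
  simp only [per_val]
  rw [Finset.prod_div_distrib, h1, div_self h2.ne']

theorem pha_per_self {s t : Fin h → ℕ}
    (hc : IsCelestialCohort m h (Finset.univ.val.map s) (Finset.univ.val.map t)) :
    ∃ τ, pha (per s) (per t) h = 2 * τ := by
  have e := hc.even_sum
  change Even (∑ i, s i + ∑ i, t i) at e
  obtain ⟨n, hn⟩ := e
  refine ⟨n - ∑ i, (t i : ℤ), ?_⟩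
  rw [pha, Finset.sum_range]
  simp only [per_val]
  rw [Finset.sum_sub_distrib]
  have : (∑ i, (s i : ℤ)) + ∑ i, (t i : ℤ) = n + n := by exact_mod_cast hn
  linear_combination this

/-- The construction closes up: after `h` steps the classes repeat, with the index shifted by the
twist `τ`. -/
theorem vert_per_add_self {s t : Fin h → ℕ} {τ : ℤ} (h1 : rad m (per s) (per t) h = 1)
    (hτ : pha (per s) (per t) h = 2 * τ) (z : ℂ) (j : ℕ) (i : ℤ) :
    vert m (per s) (per t) z (j + h) i = vert m (per s) (per t) z j (i + τ) := by
  have hr : rad m (per s) (per t) (j + h) = rad m (per s) (per t) j := by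
    rw [rad, add_comm j h, Finset.prod_range_add, ← rad, h1, one_mul]
    simp only [add_comm h, per_add_self]
    rfl
  have hp : pha (per s) (per t) (j + h) = pha (per s) (per t) j + 2 * τ := by
    rw [pha, add_comm j h, Finset.sum_range_add, ← pha, hτ, add_comm]
    simp only [add_comm h, per_add_self]
    rfl
  rw [vert, vert, hr, hp]
  congr 2
  ring

theorem vert_per_eq {s t : Fin h → ℕ}
    (hc : IsCelestialCohort m h (Finset.univ.val.map s) (Finset.univ.val.map t)) (j : ℕ) :
    ∃ n : ℤ, ∀ z i, vert m (per s) (per t) z j i =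
      celestialVertex m s t z (Fin.ofNat h j) (i + n) := by
  obtain ⟨τ, hτ⟩ := pha_per_self hc
  have key : ∀ q r : ℕ, ∀ z i, vert m (per s) (per t) z (r + h * q) i =
      vert m (per s) (per t) z r (i + q * τ) := by
    intro q r z
    induction q with
    | zero => simp
    | succ q ih =>
      intro i
      rw [mul_add, mul_one, ← add_assoc, vert_per_add_self (rad_per_self hc) hτ, ih]
      congr 1
      push_cast
      ring
  refine ⟨(j / h : ℕ) * τ, fun z i => ?_⟩
  rw [celestialVertex_eq_vert, ← key]
  congr 1
  exact (Nat.mod_add_div j h).symm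

theorem celestialPoints_eq_vertSet {s t : Fin h → ℕ}
    (hc : IsCelestialCohort m h (Finset.univ.val.map s) (Finset.univ.val.map t)) (z : ℂ) :
    celestialPoints m s t z = vertSet m (per s) (per t) z := by
  ext p
  constructor
  · rintro ⟨j, i, rfl⟩
    exact ⟨j, i, celestialVertex_eq_vert s t z j i⟩
  · rintro ⟨j, i, rfl⟩
    obtain ⟨n, hn⟩ := vert_per_eq hc j
    exact ⟨_, _, hn z i⟩

theorem celestialLines_eq_chordSet {s t : Fin h → ℕ}
    (hc : IsCelestialCohort m h (Finset.univ.val.map s) (Finset.univ.val.map t)) (z : ℂ) :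
    celestialLines m s t z = chordSet m (per s) (per t) z := by
  ext l
  constructor
  · rintro ⟨j, i, rfl⟩
    exact ⟨j, i, celestialLine_eq_chord s t z j i⟩
  · rintro ⟨j, i, rfl⟩
    obtain ⟨n, hn⟩ := vert_per_eq hc j
    refine ⟨Fin.ofNat h j, i + n, ?_⟩
    rw [chord, celestialLine, hn, hn, per, add_right_comm]

/-- Multiply the cyclic product by its shift by one; each pair of neighbours contributes the same
factor, whether `h` is odd or even. -/
theorem prod_mul_prod_alternating {t : Fin h → ℕ} (ht : ∀ j, t (j + 2) = t j) (f : ℕ → ℝ) :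
    (∏ i, f (t i)) * ∏ i, f (t i) = (f (t 0) * f (t 1)) ^ h := by
  have e : ∏ i, f (t i) = ∏ i, f (t (i + 1)) :=
    (Fintype.prod_equiv (Equiv.addRight 1) _ _ fun i => rfl).symm
  conv_lhs => rw [e, ← e]
  conv_lhs => enter [2]; rw [e]
  rw [← Finset.prod_mul_distrib]
  have : ∀ i : Fin h, f (t i) * f (t (i + 1)) = f (t 0) * f (t 1) := by
    intro i
    have h1 := mul_succ_of_alternating (t := per t) (per_add_two ht) f i
    rw [per_val] at h1
    rw [show per t (i + 1) = t (i + 1) by rw [per, ofNat_succ]; simp,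
      show per t 0 = t 0 from rfl, show per t 1 = t 1 by rfl] at h1
    exact h1
  rw [Finset.prod_congr rfl fun i _ => this i]
  simp

/-- The squares have the geometric mean `|c|`, so not all of them can exceed it. -/
theorem exists_sq_le_abs {f : Fin h → ℝ} {c : ℝ} (hf : (∏ i, f i) * ∏ i, f i = c ^ h) :
    ∃ i, f i ^ 2 ≤ |c| := by
  by_contra! hlt
  have h1 : |c| ^ h = ∏ i, f i ^ 2 := by
    rw [← abs_pow, ← hf, ← sq, Finset.prod_pow, abs_of_nonneg (sq_nonneg _)]
  rcases (abs_nonneg c).eq_or_lt with h0 | h0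
  · rw [← h0, zero_pow (NeZero.ne h)] at h1
    have : 0 < ∏ i, f i ^ 2 := Finset.prod_pos fun i _ => (abs_nonneg c).trans_lt (hlt i)
    linarith
  · have := Finset.prod_lt_prod_of_nonempty (s := (Finset.univ : Finset (Fin h)))
      (f := fun _ => |c|) (g := fun i => f i ^ 2) (fun _ _ => h0) (fun i _ => hlt i)
      Finset.univ_nonempty
    rw [← h1] at this
    simp at this

theorem exists_le_sq {f : Fin h → ℝ} {c : ℝ} (hf0 : ∀ i, f i ≠ 0)
    (hf : (∏ i, f i) * ∏ i, f i = c ^ h) : ∃ i, c ≤ f i ^ 2 := by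
  by_contra! hlt
  have h1 : c ^ h = ∏ i, f i ^ 2 := by
    rw [← hf, ← sq, Finset.prod_pow]
  have := Finset.prod_lt_prod_of_nonempty (s := (Finset.univ : Finset (Fin h)))
    (f := fun i => f i ^ 2) (g := fun _ => c)
    (fun i _ => by have := hf0 i; positivity) (fun i _ => hlt i) Finset.univ_nonempty
  rw [← h1] at this
  simp at this

theorem exists_irrational_root_of_cohort {s t : Fin h → ℕ}
    (hc : IsCelestialCohort m h (Finset.univ.val.map s) (Finset.univ.val.map t))
    (hst : ∀ i j, s i ≠ t j) (ht : ∀ j, t (j + 2) = t j) :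
    ∃ (ψ : ℕ) (x : ℝ), Even (ψ + (t 0 + t 1)) ∧ x ∉ realCyclotomic m ∧
      cosi m (t 0) * cosi m (t 1) * (1 + x ^ 2) + Real.sin (Real.pi * ψ / m) * x =
        cosi m ψ := by
  have hs : ∀ i, 0 < s i ∧ 2 * s i < m := fun i =>
    hc.left_range _ (Multiset.mem_map_of_mem s (Finset.mem_univ i))
  have ht' : ∀ i, 0 < t i ∧ 2 * t i < m := fun i =>
    hc.right_range _ (Multiset.mem_map_of_mem t (Finset.mem_univ i))
  have hm : 0 < m := by have := hs 0; omega
  have heq : ∏ i, ccos m (s i) = ∏ i, ccos m (t i) := by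
    have e := hc.cosine
    rwa [Multiset.map_map, Multiset.map_map] at e
  have key : ∀ k : ℕ, k.Coprime (4 * m) →
      (∏ i, cosi m (k * s i)) * ∏ i, cosi m (k * s i) =
        (cosi m (k * t 0) * cosi m (k * t 1)) ^ h := fun k hk => by
    rw [prod_cosi_galois hm hk s t heq]
    exact prod_mul_prod_alternating ht fun x => cosi m (k * x)
  refine exists_irrational_root (ht' 0).1 (ht' 1).1 (ht' 0).2 (ht' 1).2 (fun k hk => ?_) ?_
  · obtain ⟨i, hi⟩ := exists_sq_le_abs (key k hk)
    exact ⟨s i, (hs i).1, (hs i).2, hst i 0, hst i 1, hi⟩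
  · have hk := key 1 (Nat.coprime_one_left _)
    simp only [Nat.cast_one, one_mul] at hk
    obtain ⟨i, hi⟩ := exists_le_sq
      (fun i => (cosi_pos hm (by positivity) (by have := (hs i).2; omega)).ne') hk
    exact ⟨s i, (hs i).1, (hs i).2, hst i 0, hst i 1, hi⟩

theorem isNestingChoice_iff {s t : Fin h → ℕ}
    (hc : IsCelestialCohort m h (Finset.univ.val.map s) (Finset.univ.val.map t))
    (ht : ∀ j, t (j + 2) = t j) :
    ∃ n : ℤ, ∀ d w, IsNestingChoice m s t d w ↔ ∃ x : ℝ, w = startPoint m (per s) x ∧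
      (rot m (2 * (d + n) - (t 0 + t 1 : ℕ))).re +
        x * (rot m (2 * (d + n) - (t 0 + t 1 : ℕ))).im =
          ccos m (t 0) * ccos m (t 1) * (1 + x ^ 2) := by
  have hs : ∀ j, 0 < per s j ∧ 2 * per s j < m := fun i =>
    hc.left_range _ (Multiset.mem_map_of_mem s (Finset.mem_univ (Fin.ofNat h i)))
  have ht' : ∀ j, 2 * per t j < m := fun i =>
    (hc.right_range _ (Multiset.mem_map_of_mem t (Finset.mem_univ (Fin.ofNat h i)))).2
  obtain ⟨n, hn⟩ := vert_per_eq hc 2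
  have hv : ∀ i, celestialVertex m s t 1 2 i = vert m (per s) (per t) 1 2 (i + -n) := fun i => by
    rw [hn]
    congr 1
    ring
  refine ⟨-n, fun d w => ?_⟩
  unfold IsNestingChoice
  rw [celestialLine_eq_chord, show ((0 : Fin h) : ℕ) = 0 from rfl, mem_chord_zero_iff hs ht', hv,
    hv, show s 1 = per s 1 from rfl,
    show d - (per s 1 : ℤ) + -n = d + -n - per s 1 by ring]
  have key : ∀ x, w = startPoint m (per s) x → (EuclideanGeometry.Cospherical
      ({vert m (per s) (per t) 1 2 (d + -n), 0, vert m (per s) (per t) 1 2 (d + -n - per s 1), w} :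
        Set ℂ) ↔ (rot m (2 * (d + -n) - (t 0 + t 1 : ℕ))).re +
        x * (rot m (2 * (d + -n) - (t 0 + t 1 : ℕ))).im =
          ccos m (t 0) * ccos m (t 1) * (1 + x ^ 2)) := by
    rintro x rfl
    rw [cospherical_vert_iff hs ht' (startPoint_ne_zero (fun j => (hs j).2) x)]
    have := vert_add_two_mem_chord_tail_iff hs ht' (per_add_two ht) x 0 0 (d + -n)
    rw [zero_add, zero_add] at this
    exact this
  constructor
  · rintro ⟨⟨x, hx⟩, h⟩
    exact ⟨x, hx, (key x hx).1 h⟩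
  · rintro ⟨x, hx, h⟩
    exact ⟨⟨x, hx⟩, (key x hx).2 h⟩

theorem nestingProduces_of_alternating {s t : Fin h → ℕ} (hst : ∀ i j, s i ≠ t j)
    (ht : ∀ j, t (j + 2) = t j) (h₁ : IsCelestialConfiguration m s t)
    (h₂ : IsCelestialConfiguration m (cyclicShift s) t) :
    NestingProduces (2 * m * h) m s t := by
  have hc := h₁.cohort
  have hs : ∀ j, 0 < per s j ∧ 2 * per s j < m := fun i =>
    hc.left_range _ (Multiset.mem_map_of_mem s (Finset.mem_univ (Fin.ofNat h i)))
  have ht' : ∀ j, 2 * per t j < m := fun i =>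
    (hc.right_range _ (Multiset.mem_map_of_mem t (Finset.mem_univ (Fin.ofNat h i)))).2
  have hw : ∀ x, startPoint m (per s) x ≠ 0 := startPoint_ne_zero fun j => (hs j).2
  obtain ⟨n, hn⟩ := isNestingChoice_iff hc ht
  have e1 : celestialPoints m s t 1 = vertSet m (per s) (per t) 1 :=
    celestialPoints_eq_vertSet hc 1
  have e2 : celestialLines m s t 1 = chordSet m (per s) (per t) 1 :=
    celestialLines_eq_chordSet hc 1
  have e3 : ∀ w, celestialPoints m (cyclicShift s) t w =
      vertSet m (tail (per s)) (per t) w := fun w => by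
    rw [celestialPoints_eq_vertSet h₂.cohort, per_cyclicShift]
  have e4 : ∀ w, celestialLines m (cyclicShift s) t w =
      chordSet m (tail (per s)) (per t) w := fun w => by
    rw [celestialLines_eq_chordSet h₂.cohort, per_cyclicShift]
  have c₁ := h₁.configuration
  have c₂ := fun x => h₂.configuration.celestial_of_ne_zero (hw x)
  rw [e1, e2] at c₁
  simp only [e3, e4] at c₂
  have g21 : ∀ x, ∀ l ∈ chordSet m (per s) (per t) 1,
      ∃ p ∈ vertSet m (tail (per s)) (per t) (startPoint m (per s) x), p ∈ l := by
    rintro x _ ⟨j, i, rfl⟩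
    exact ⟨_, ⟨j, i, rfl⟩, vert_tail_mem_chord hs ht' x j i⟩
  have h21 : ∀ x, ∀ p ∈ vertSet m (tail (per s)) (per t) (startPoint m (per s) x),
      ∃ l ∈ chordSet m (per s) (per t) 1, p ∈ l := by
    rintro x _ ⟨j, i, rfl⟩
    exact ⟨_, ⟨j, i, rfl⟩, vert_tail_mem_chord hs ht' x j i⟩
  have hmem : ∀ x d, (rot m (2 * (d + n) - (t 0 + t 1 : ℕ))).re +
      x * (rot m (2 * (d + n) - (t 0 + t 1 : ℕ))).im =
        ccos m (t 0) * ccos m (t 1) * (1 + x ^ 2) → ∀ (j : ℕ) (i : ℤ),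
      vert m (per s) (per t) 1 (j + 2) (i + (d + n)) ∈
        chord m (tail (per s)) (per t) (startPoint m (per s) x) j i := fun x d hx j i =>
    (vert_add_two_mem_chord_tail_iff hs ht' (per_add_two ht) x j i (d + n)).2 hx
  obtain ⟨τ, hτ⟩ := pha_per_self hc
  have hvert : ∀ p ∈ vertSet m (per s) (per t) 1, ∃ (j : ℕ) (i : ℤ),
      p = vert m (per s) (per t) 1 (j + 2) i := by
    rintro _ ⟨k, i, rfl⟩
    have hh : 1 ≤ h := Nat.one_le_iff_ne_zero.2 (NeZero.ne h)
    -- Two turns around the cycle, so that the subtraction of 2 is harmless even for `h = 1`.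
    refine ⟨k + h + h - 2, i - τ - τ, ?_⟩
    rw [show k + h + h - 2 + 2 = k + h + h by omega, vert_per_add_self (rad_per_self hc) hτ,
      vert_per_add_self (rad_per_self hc) hτ]
    congr 1
    ring
  have h12 : ∀ x d, (rot m (2 * (d + n) - (t 0 + t 1 : ℕ))).re +
      x * (rot m (2 * (d + n) - (t 0 + t 1 : ℕ))).im =
        ccos m (t 0) * ccos m (t 1) * (1 + x ^ 2) → ∀ p ∈ vertSet m (per s) (per t) 1,
      ∃ l ∈ chordSet m (tail (per s)) (per t) (startPoint m (per s) x), p ∈ l := by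
    intro x d hx p hp
    obtain ⟨j, i, rfl⟩ := hvert p hp
    refine ⟨_, ⟨j, i - (d + n), rfl⟩, ?_⟩
    have := hmem x d hx j (i - (d + n))
    rwa [sub_add_cancel] at this
  have g12 : ∀ x d, (rot m (2 * (d + n) - (t 0 + t 1 : ℕ))).re +
      x * (rot m (2 * (d + n) - (t 0 + t 1 : ℕ))).im =
        ccos m (t 0) * ccos m (t 1) * (1 + x ^ 2) →
      ∀ l ∈ chordSet m (tail (per s)) (per t) (startPoint m (per s) x),
        ∃ p ∈ vertSet m (per s) (per t) 1, p ∈ l := by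
    rintro x d hx _ ⟨j, i, rfl⟩
    exact ⟨_, ⟨j + 2, i + (d + n), rfl⟩, hmem x d hx j i⟩
  have hn' : 2 * m * h = 2 * (m * h) := by ring
  rw [hn']
  unfold NestingProduces nestingPoints nestingLines
  simp only [e1, e2, e3, e4]
  constructor
  · obtain ⟨ψ, x, ⟨q, hq⟩, hx, hxψ⟩ := exists_irrational_root_of_cohort hc hst ht
    have hxψ' : ccos m (per t 0) * ccos m (per t 1) * (1 + x ^ 2) + (rot m ψ).im * x =
        (rot m ψ).re := by
      rw [rot_re, rot_im, ccos_eq_cosi, ccos_eq_cosi]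
      exact hxψ
    -- The parity of `ψ` enters here: `ψ + t_0 + t_1 = 2 q`, and `d = t_0 + t_1 - q - n` is the
    -- index for which the angle of the quadratic equation is `-ψ`.
    have hN : 2 * ((t 0 + t 1 : ℕ) - q - n + n : ℤ) - (t 0 + t 1 : ℕ) = -ψ := by
      omega
    have hd : (rot m (2 * ((t 0 + t 1 : ℕ) - q - n + n) - (t 0 + t 1 : ℕ))).re +
        x * (rot m (2 * ((t 0 + t 1 : ℕ) - q - n + n) - (t 0 + t 1 : ℕ))).im =
        ccos m (t 0) * ccos m (t 1) * (1 + x ^ 2) := by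
      rw [hN, rot_neg_re, rot_neg_im, ← hxψ']
      change _ = ccos m (per t 0) * ccos m (per t 1) * (1 + x ^ 2)
      ring
    refine ⟨(t 0 + t 1 : ℕ) - q - n, startPoint m (per s) x, (hn _ _).2 ⟨x, rfl, hd⟩, ?_⟩
    exact c₁.union_of_unique (by norm_num) (c₂ x)
      (fun p hp => existsUnique_chord_tail hs ht' hx hxψ' (h12 x _ hd p hp) hp)
      (fun p hp => existsUnique_chord hs ht' hx hp) (g12 x _ hd) (g21 x)
  · intro d w hdw hP hL hle
    obtain ⟨x, rfl, hd⟩ := (hn d w).1 hdw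
    exact c₁.union_of_le (c₂ x) hP hL hle (h12 x d hd) (h21 x) (g12 x d hd) (g21 x)

end

/-! ### The configurations with `m = 9` -/

/-- Labels with different incidences belong to different points or lines, so all counts can be made
in the finite relation `R`. -/
theorem IsGeometricConfiguration.of_incidence {ι : Type*} [Fintype ι] [DecidableEq ι]
    {P : ι → ℂ} {L : ι → AffineSubspace ℝ ℂ} {R : ι → ι → Prop} [DecidableRel R] {k : ℕ}
    (hR : ∀ a b, P a ∈ L b ↔ R a b) (hL : ∀ b, Module.finrank ℝ (L b).direction = 1)
    (hp : ∀ a a', (∀ b, R a b ↔ R a' b) → a = a')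
    (hl : ∀ b b', (∀ a, R a b ↔ R a b') → b = b')
    (hcl : ∀ b, (Finset.univ.filter fun a => R a b).card = k)
    (hcp : ∀ a, (Finset.univ.filter fun b => R a b).card = k) :
    IsGeometricConfiguration (Fintype.card ι) k (Set.range P) (Set.range L) := by
  have hPi : Function.Injective P := fun a a' h => hp a a' fun b => by
    rw [← hR, ← hR, h]
  have hLi : Function.Injective L := fun b b' h => hl b b' fun a => by
    rw [← hR, ← hR, h]
  refine ⟨Set.finite_range P, Set.finite_range L, ?_, ?_, ?_, ?_, ?_⟩
  · rw [← Set.image_univ, Set.ncard_image_of_injective _ hPi, Set.ncard_univ,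
      Nat.card_eq_fintype_card]
  · rw [← Set.image_univ, Set.ncard_image_of_injective _ hLi, Set.ncard_univ,
      Nat.card_eq_fintype_card]
  · rintro _ ⟨b, rfl⟩
    exact hL b
  · rintro _ ⟨b, rfl⟩
    rw [← hcl b, ← Set.ncard_coe_finset, ← Set.ncard_image_of_injective _ hPi]
    congr 1
    ext p
    constructor
    · rintro ⟨⟨a, rfl⟩, h⟩
      exact ⟨a, by simpa [← hR] using h, rfl⟩
    · rintro ⟨a, h, rfl⟩
      exact ⟨⟨a, rfl⟩, by simpa [← hR] using h⟩
  · rintro _ ⟨a, rfl⟩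
    rw [← hcp a, ← Set.ncard_coe_finset, ← Set.ncard_image_of_injective _ hLi]
    congr 1
    ext l
    constructor
    · rintro ⟨⟨b, rfl⟩, h⟩
      exact ⟨b, by simpa [← hR] using h, rfl⟩
    · rintro ⟨b, h, rfl⟩
      exact ⟨⟨b, rfl⟩, by simpa [← hR] using h⟩

theorem vert_mem_chord_iff {m : ℕ} {s t : ℕ → ℕ} (hs : ∀ j, 0 < s j ∧ 2 * s j < m)
    (ht : ∀ j, 2 * t j < m) (j k : ℕ) (i l : ℤ) :
    vert m s t 1 k i ∈ chord m s t 1 j l ↔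
      rad m s t k * cosi m (2 * i + pha s t k - (2 * l + pha s t j + s j)) =
        rad m s t j * ccos m (s j) := by
  rw [mem_chord_iff hs ht one_ne_zero, div_one, ← rot_re]
  have : rot m (-(2 * l + pha s t j + s j)) * vert m s t 1 k i =
      rad m s t k * rot m (2 * i + pha s t k - (2 * l + pha s t j + s j)) := by
    rw [vert, sub_eq_neg_add, rot_add _ (-(2 * l + pha s t j + s j))]
    ring
  rw [this, Complex.re_ofReal_mul]

theorem vert_emod {m : ℕ} (hm : 0 < m) (s t : ℕ → ℕ) (z : ℂ) (j : ℕ) (i : ℤ) :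
    vert m s t z j (i % m) = vert m s t z j i := by
  have hm' : (m : ℂ) ≠ 0 := by exact_mod_cast hm.ne'
  have h1 : rot m (2 * m * (i / m)) = 1 := by
    rw [rot, Complex.exp_eq_one_iff]
    refine ⟨i / m, ?_⟩
    push_cast
    field_simp
  rw [vert, vert]
  conv_rhs => rw [← Int.emod_add_mul_ediv i m]
  rw [show 2 * (i % m + m * (i / m)) + pha s t j = 2 * (i % m) + pha s t j + 2 * m * (i / m) by
    ring, rot_add _ (2 * (i % m) + pha s t j), h1, mul_one]

theorem vert_injective_left {m : ℕ} {s t : ℕ → ℕ} (hs : ∀ j, 0 < s j ∧ 2 * s j < m)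
    (ht : ∀ j, 2 * t j < m) (j : ℕ) (i : ℤ) :
    vert m s t 1 j i ≠ vert m s t 1 j (i + s j) := by
  have hm : 0 < m := by have := hs 0; omega
  have hr := rad_pos (fun j => (hs j).2) ht j
  intro h
  rw [vert, vert, one_mul, mul_right_inj' (by exact_mod_cast hr.ne'),
    show 2 * (i + s j) + pha s t j = 2 * i + pha s t j + (2 * s j : ℕ) by push_cast; ring,
    rot_add _ (2 * i + pha s t j), eq_comm, mul_eq_left₀ (rot_ne_zero _ _)] at h
  have h1 := congrArg Complex.re h
  rw [rot_re, Complex.one_re] at h1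
  have h2 : cosi m (2 * s j : ℕ) < cosi m 0 := by
    apply cosi_lt_cosi hm
    · exact le_rfl
    · have := hs j
      omega
    · have := hs j
      omega
  rw [h1] at h2
  simp [cosi] at h2

theorem finrank_direction_chord {m : ℕ} {s t : ℕ → ℕ} (hs : ∀ j, 0 < s j ∧ 2 * s j < m)
    (ht : ∀ j, 2 * t j < m) (j : ℕ) (i : ℤ) :
    Module.finrank ℝ (chord m s t 1 j i).direction = 1 := by
  rw [chord, direction_affineSpan, vectorSpan_pair]
  exact finrank_span_singleton (vsub_ne_zero.2 (vert_injective_left hs ht j i))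

/-- The incidences between the points and the lines of `9#(s_0, 3; s_1, 3; s_2, 3)`. -/
def IsNineIncident (s : Fin 3 → ℕ) (a b : Fin 3 × Fin 9) : Prop :=
  (a.1 = b.1 ∧ ((a.2 : ℕ) % 9 = b.2 % 9 ∨ (a.2 : ℕ) % 9 = (b.2 + s b.1) % 9)) ∨
    -- `b.1 / 2` is 1 for the last class and 0 otherwise: closing the cycle shifts the index by the
    -- twist `(7 - 9) / 2 = -1`.
    (a.1 = b.1 + 1 ∧ ((a.2 + b.1 / 2 : ℕ) % 9 = b.2 % 9 ∨
      (a.2 + b.1 / 2 : ℕ) % 9 = (b.2 + 3) % 9))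

instance (s : Fin 3 → ℕ) : DecidableRel (IsNineIncident s) := fun _ _ =>
  inferInstanceAs (Decidable (_ ∨ _))

theorem cosi_nine_eq_iff (N y : ℤ) :
    cosi 9 N = cosi 9 y ↔ (N - y) % 18 = 0 ∨ (N + y) % 18 = 0 := by
  constructor
  · intro h
    obtain ⟨j, hj | hj⟩ := cosi_eq_cosi (by norm_num) h
    · left
      push_cast at hj
      omega
    · right
      push_cast at hj
      omega
  · rintro (h | h)
    · rw [show N = y + 2 * (9 : ℕ) * ((N - y) / 18) by push_cast; omega,
        cosi_add_two_mul (by norm_num)]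
    · rw [show N = -y + 2 * (9 : ℕ) * ((N + y) / 18) by push_cast; omega,
        cosi_add_two_mul (by norm_num), cosi_neg]

/-- With three classes only `v_{j+2}` could meet the lines `L_j` unintentionally, and `hne` forbids
this. -/
theorem mul_eq_iff_of_fin_three {r D c : Fin 3 → ℝ} {x e : ℝ} (hr : ∀ k, r k ≠ 0)
    (hD : ∀ j, D j = r j * c j) (hD' : ∀ j, D j = r (j + 1) * e) (hne : ∀ j, r (j + 2) * x ≠ D j)
    (k j : Fin 3) : r k * x = D j ↔ (k = j ∧ x = c j) ∨ (k = j + 1 ∧ x = e) := by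
  have hk : k = j ∨ k = j + 1 ∨ k = j + 2 := by decide +revert
  rcases hk with rfl | rfl | rfl
  · have : k ≠ k + 1 := by decide +revert
    rw [hD, mul_right_inj' (hr k)]
    tauto
  · have : j + 1 ≠ j := by decide +revert
    rw [hD', mul_right_inj' (hr _)]
    tauto
  · have h1 : j + 2 ≠ j := by decide +revert
    have h2 : j + 2 ≠ j + 1 := by decide +revert
    have := hne j
    tauto

theorem isCelestialConfiguration_nine {s t : Fin 3 → ℕ} (ht : ∀ j, t j = 3)
    (hc : IsCelestialCohort 9 3 (Finset.univ.val.map s) (Finset.univ.val.map t))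
    (hsum : s 0 + s 1 + s 2 = 7)
    (hne : ∀ (j : Fin 3) (N : ℤ), rad 9 (per s) (per t) (j + 2 : Fin 3) * cosi 9 N ≠
      rad 9 (per s) (per t) j * ccos 9 (s j))
    (hp : ∀ a a', (∀ b, IsNineIncident s a b ↔ IsNineIncident s a' b) → a = a')
    (hl : ∀ b b', (∀ a, IsNineIncident s a b ↔ IsNineIncident s a b') → b = b')
    (hcl : ∀ b, (Finset.univ.filter fun a => IsNineIncident s a b).card = 4)
    (hcp : ∀ a, (Finset.univ.filter fun b => IsNineIncident s a b).card = 4) :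
    IsCelestialConfiguration 9 s t := by
  have hs : ∀ j, 0 < per s j ∧ 2 * per s j < 9 := fun i =>
    hc.left_range _ (Multiset.mem_map_of_mem s (Finset.mem_univ (Fin.ofNat 3 i)))
  have ht' : ∀ j, 2 * per t j < 9 := fun i =>
    (hc.right_range _ (Multiset.mem_map_of_mem t (Finset.mem_univ (Fin.ofNat 3 i)))).2
  have p1 : pha (per s) (per t) 1 = s 0 - 3 := by
    rw [pha, Finset.sum_range_one, show per t 0 = t 0 from rfl, ht]
    rfl
  have p2 : pha (per s) (per t) 2 = s 0 - 3 + (s 1 - 3) := by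
    rw [pha_succ, p1, show per t 1 = t 1 from rfl, ht]
    rfl
  have h3 := (ccos_pos (m := 9) (x := 3) (by norm_num)).ne'
  have hsucc : ∀ j : Fin 3, rad 9 (per s) (per t) (j + 1 : ℕ) * cosi 9 3 =
      rad 9 (per s) (per t) j * ccos 9 (s j) := by
    intro j
    rw [rad_succ, per_val, per_val, ht, show (3 : ℤ) = (3 : ℕ) by rfl, ← ccos_eq_cosi]
    field_simp
  have hR : ∀ (k j : Fin 3) (N : ℤ), rad 9 (per s) (per t) k * cosi 9 N =
      rad 9 (per s) (per t) j * ccos 9 (s j) ↔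
        (k = j ∧ cosi 9 N = cosi 9 (s j)) ∨ (k = j + 1 ∧ cosi 9 N = cosi 9 3) := fun k j N =>
    mul_eq_iff_of_fin_three (r := fun k : Fin 3 => rad 9 (per s) (per t) k)
      (D := fun j => rad 9 (per s) (per t) j * ccos 9 (s j)) (c := fun j => cosi 9 (s j))
      (fun k => (rad_pos (fun j => (hs j).2) ht' k).ne') (fun j => by rw [ccos_eq_cosi])
      (fun j => by
        rw [← hsucc]
        fin_cases j
        · rfl
        · rfl
        · change rad 9 (per s) (per t) 3 * _ = rad 9 (per s) (per t) 0 * _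
          rw [rad_per_self hc]
          rfl) (fun j => hne j N) k j
  refine ⟨hc, ?_⟩
  have key := IsGeometricConfiguration.of_incidence
    (P := fun a : Fin 3 × Fin 9 => vert 9 (per s) (per t) 1 a.1 (a.2 : ℕ))
    (L := fun b : Fin 3 × Fin 9 => chord 9 (per s) (per t) 1 b.1 (b.2 : ℕ))
    (R := IsNineIncident s) (k := 4) ?_
    (fun b => finrank_direction_chord hs ht' _ _) hp hl hcl hcp
  · have hmod : ∀ i : ℤ, ∃ r : Fin 9, ((r : ℕ) : ℤ) = i % (9 : ℕ) := fun i =>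
      ⟨⟨(i % 9).toNat, by omega⟩, by push_cast; omega⟩
    convert key using 1
    · simp
    · ext p
      constructor
      · rintro ⟨j, i, rfl⟩
        obtain ⟨r, hr⟩ := hmod i
        refine ⟨(j, r), ?_⟩
        dsimp only
        rw [hr, vert_emod (by norm_num), celestialVertex_eq_vert]
      · rintro ⟨⟨j, r⟩, rfl⟩
        exact ⟨j, (r : ℕ), (celestialVertex_eq_vert _ _ _ _ _).symm⟩
    · ext l
      constructor
      · rintro ⟨j, i, rfl⟩
        obtain ⟨r, hr⟩ := hmod i
        refine ⟨(j, r), ?_⟩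
        dsimp only
        rw [celestialLine_eq_chord, chord, chord, hr, vert_emod (by norm_num),
          ← vert_emod (by norm_num) _ _ _ _ (i % (9 : ℕ) + _), Int.emod_add_emod,
          vert_emod (by norm_num)]
      · rintro ⟨⟨j, r⟩, rfl⟩
        exact ⟨j, (r : ℕ), (celestialLine_eq_chord _ _ _ _ _).symm⟩
  · rintro ⟨k, i⟩ ⟨j, l⟩
    rw [vert_mem_chord_iff hs ht', per_val, hR, cosi_nine_eq_iff, cosi_nine_eq_iff]
    have := i.2
    have := l.2
    fin_cases k <;> fin_cases j <;>
      simp [IsNineIncident, p1, p2, show pha (per s) (per t) 0 = 0 from rfl] <;> omega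

theorem cosi_nine_three : cosi 9 3 = 1 / 2 := by
  rw [cosi, ← Real.cos_pi_div_three]
  congr 1
  push_cast
  ring

theorem cosi_nine_mul : 8 * cosi 9 1 * cosi 9 2 * cosi 9 4 = 1 := by
  have h1 := two_mul_cosi_mul_cosi 9 1 2
  have h2 := two_mul_cosi_mul_cosi 9 3 4
  have h3 := two_mul_cosi_mul_cosi 9 1 4
  have h4 : cosi 9 (3 + 4) = -cosi 9 2 := by
    rw [cosi, cosi, ← Real.cos_pi_sub]
    congr 1
    push_cast
    ring
  have h5 : cosi 9 (1 + 4) = -cosi 9 4 := by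
    rw [cosi, cosi, ← Real.cos_pi_sub]
    congr 1
    push_cast
    ring
  rw [show (1 : ℤ) + 2 = 3 by norm_num, show (2 : ℤ) - 1 = 1 by norm_num, cosi_nine_three] at h1
  rw [h5, show (4 : ℤ) - 1 = 3 by norm_num, cosi_nine_three] at h3
  linear_combination 4 * cosi 9 4 * h1 + 2 * h3

/-- The numbers strictly between `cos 80°` and `cos 60°` are no cosines of multiples of `20°`. -/
theorem cosi_nine_ne {v : ℝ} (h4 : cosi 9 4 < v) (h3 : v < 1 / 2) (N : ℤ) : cosi 9 N ≠ v := by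
  have key : ∃ n : ℤ, 0 ≤ n ∧ n ≤ 9 ∧ cosi 9 N = cosi 9 n := by
    by_cases h : N % 18 ≤ 9
    · exact ⟨N % 18, by omega, h, (cosi_nine_eq_iff _ _).2 (by omega)⟩
    · exact ⟨18 - N % 18, by omega, by omega, (cosi_nine_eq_iff _ _).2 (by omega)⟩
  obtain ⟨n, h0, h9, hn⟩ := key
  rw [hn]
  rcases le_or_gt n 3 with h | h
  · have := cosi_le_cosi (m := 9) (by norm_num) h0 h (by norm_num)
    rw [cosi_nine_three] at this
    exact (h3.trans_le this).ne'
  · have := cosi_le_cosi (m := 9) (x := 4) (by norm_num) (by norm_num) h (by exact_mod_cast h9)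
    exact (this.trans_lt h4).ne

theorem cosi_nine_bounds : 1 / 2 < cosi 9 2 ∧ 1 / 2 < cosi 9 1 ∧ cosi 9 2 < 1 ∧ cosi 9 1 < 1 ∧
    0 < cosi 9 4 ∧ 1 < 2 * cosi 9 1 * cosi 9 2 := by
  have h0 : cosi 9 0 = 1 := by simp [cosi]
  have h1 : cosi 9 1 < cosi 9 0 := cosi_lt_cosi (by norm_num) (by norm_num) (by norm_num)
    (by norm_num)
  have h2 : cosi 9 2 < cosi 9 1 := cosi_lt_cosi (by norm_num) (by norm_num) (by norm_num)
    (by norm_num)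
  have h3 : cosi 9 3 < cosi 9 2 := cosi_lt_cosi (by norm_num) (by norm_num) (by norm_num)
    (by norm_num)
  have h4 : 0 < cosi 9 4 := cosi_pos (by norm_num) (by norm_num) (by norm_num)
  have h5 := two_mul_cosi_mul_cosi 9 1 2
  rw [show (1 : ℤ) + 2 = 3 by norm_num, show (2 : ℤ) - 1 = 1 by norm_num] at h5
  rw [cosi_nine_three] at h3 h5
  rw [h0] at h1
  refine ⟨?_, ?_, ?_, ?_, ?_, ?_⟩ <;> linarith

theorem isCelestialConfiguration_nine_four_two_one :
    IsCelestialConfiguration 9 ![4, 2, 1] ![3, 3, 3] := by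
  have hm := cosi_nine_mul
  obtain ⟨hb, ha, hb1, ha1, hd, hab⟩ := cosi_nine_bounds
  have h3 : ccos 9 3 = 1 / 2 := by rw [ccos_eq_cosi]; exact cosi_nine_three
  have e1 : ccos 9 1 = cosi 9 1 := ccos_eq_cosi 9 1
  have e2 : ccos 9 2 = cosi 9 2 := ccos_eq_cosi 9 2
  have e4 : ccos 9 4 = cosi 9 4 := ccos_eq_cosi 9 4
  have r0 : rad 9 (per ![4, 2, 1]) (per ![3, 3, 3]) 0 = 1 := rfl
  have r1 : rad 9 (per ![4, 2, 1]) (per ![3, 3, 3]) 1 = 2 * cosi 9 4 := by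
    rw [rad_succ, r0]
    change 1 * (ccos 9 4 / ccos 9 3) = _
    rw [h3, e4]
    ring
  have r2 : rad 9 (per ![4, 2, 1]) (per ![3, 3, 3]) 2 = 4 * cosi 9 2 * cosi 9 4 := by
    rw [rad_succ, r1]
    change _ * (ccos 9 2 / ccos 9 3) = _
    rw [h3, e2]
    ring
  have hd4 : 4 * cosi 9 4 < 1 := by nlinarith
  refine isCelestialConfiguration_nine (by decide)
    ⟨rfl, rfl, by decide, by decide, by decide, ?_⟩ rfl ?_ (by decide +kernel)
    (by decide +kernel) (by decide +kernel) (by decide +kernel)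
  · change ∏ i : Fin 3, ccos 9 (![4, 2, 1] i) = ∏ i : Fin 3, ccos 9 (![3, 3, 3] i)
    rw [Fin.prod_univ_three, Fin.prod_univ_three]
    change ccos 9 4 * ccos 9 2 * ccos 9 1 = ccos 9 3 * ccos 9 3 * ccos 9 3
    rw [h3, e1, e2, e4]
    linear_combination hm / 8
  · intro j N
    have hN := Real.abs_cos_le_one (Real.pi * N / (9 : ℕ))
    -- In the three cases an unintended incidence needs a cosine equal to `2 cos 20° cos 80°`, `2
    -- cos 40° cos 80°` or `2 cos 20° cos 40°`. The first two lie strictly between `cos 80°` and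
    -- `1/2`, the last one exceeds `1`.
    fin_cases j
    · change rad _ _ _ 2 * _ ≠ rad _ _ _ 0 * ccos 9 4
      rw [r2, r0, e4]
      intro h
      apply cosi_nine_ne (v := 2 * cosi 9 1 * cosi 9 4) (by nlinarith) (by nlinarith) N
      linear_combination 2 * cosi 9 1 * h - cosi 9 N * hm
    · change rad _ _ _ 0 * _ ≠ rad _ _ _ 1 * ccos 9 2
      rw [r0, r1, e2, one_mul]
      exact cosi_nine_ne (by nlinarith) (by nlinarith) N
    · change rad _ _ _ 1 * _ ≠ rad _ _ _ 2 * ccos 9 1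
      rw [r1, r2, e1]
      intro h
      have h' : cosi 9 N ≤ 1 := (abs_le.1 hN).2
      nlinarith

theorem isCelestialConfiguration_nine_two_one_four :
    IsCelestialConfiguration 9 ![2, 1, 4] ![3, 3, 3] := by
  have hm := cosi_nine_mul
  obtain ⟨hb, ha, hb1, ha1, hd, hab⟩ := cosi_nine_bounds
  have h3 : ccos 9 3 = 1 / 2 := by rw [ccos_eq_cosi]; exact cosi_nine_three
  have e1 : ccos 9 1 = cosi 9 1 := ccos_eq_cosi 9 1
  have e2 : ccos 9 2 = cosi 9 2 := ccos_eq_cosi 9 2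
  have e4 : ccos 9 4 = cosi 9 4 := ccos_eq_cosi 9 4
  have r0 : rad 9 (per ![2, 1, 4]) (per ![3, 3, 3]) 0 = 1 := rfl
  have r1 : rad 9 (per ![2, 1, 4]) (per ![3, 3, 3]) 1 = 2 * cosi 9 2 := by
    rw [rad_succ, r0]
    change 1 * (ccos 9 2 / ccos 9 3) = _
    rw [h3, e2]
    ring
  have r2 : rad 9 (per ![2, 1, 4]) (per ![3, 3, 3]) 2 = 4 * cosi 9 1 * cosi 9 2 := by
    rw [rad_succ, r1]
    change _ * (ccos 9 1 / ccos 9 3) = _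
    rw [h3, e1]
    ring
  have hd4 : 4 * cosi 9 4 < 1 := by nlinarith
  refine isCelestialConfiguration_nine (by decide)
    ⟨rfl, rfl, by decide, by decide, by decide, ?_⟩ rfl ?_ (by decide +kernel)
    (by decide +kernel) (by decide +kernel) (by decide +kernel)
  · change ∏ i : Fin 3, ccos 9 (![2, 1, 4] i) = ∏ i : Fin 3, ccos 9 (![3, 3, 3] i)
    rw [Fin.prod_univ_three, Fin.prod_univ_three]
    change ccos 9 2 * ccos 9 1 * ccos 9 4 = ccos 9 3 * ccos 9 3 * ccos 9 3
    rw [h3, e1, e2, e4]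
    linear_combination hm / 8
  · intro j N
    have hN := Real.abs_cos_le_one (Real.pi * N / (9 : ℕ))
    -- The same three forbidden values occur, in the order `2 cos 40° cos 80°`, `2 cos 20° cos 40°`,
    -- `2 cos 20° cos 80°`.
    fin_cases j
    · change rad _ _ _ 2 * _ ≠ rad _ _ _ 0 * ccos 9 2
      rw [r2, r0, e2]
      intro h
      apply cosi_nine_ne (v := 2 * cosi 9 2 * cosi 9 4) (by nlinarith) (by nlinarith) N
      linear_combination 2 * cosi 9 4 * h - cosi 9 N * hm
    · change rad _ _ _ 0 * _ ≠ rad _ _ _ 1 * ccos 9 1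
      rw [r0, r1, e1, one_mul]
      have h' : cosi 9 N ≤ 1 := (abs_le.1 hN).2
      intro h
      linarith
    · change rad _ _ _ 1 * _ ≠ rad _ _ _ 2 * ccos 9 4
      rw [r1, r2, e4]
      intro h
      apply cosi_nine_ne (v := 2 * cosi 9 1 * cosi 9 4) (by nlinarith) (by nlinarith) N
      apply mul_left_cancel₀ (by linarith : cosi 9 2 ≠ 0)
      linear_combination h / 2

theorem mainTheorem11 :
    (∀ (m h : ℕ) [NeZero h] (S T : Multiset ℕ), IsCelestialCohort m h S T →
      (∀ x ∈ S, x ∉ T) →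
      (Odd h → ∃ a : ℕ, T = Multiset.replicate h a) →
      (Even h → ∃ a b : ℕ, T = Multiset.replicate (h / 2) a + Multiset.replicate (h / 2) b) →
      ∀ s t : Fin h → ℕ, Finset.univ.val.map s = S → Finset.univ.val.map t = T →
        (∀ j, t (j + 2) = t j) →
        IsCelestialConfiguration m s t → IsCelestialConfiguration m (cyclicShift s) t →
        NestingProduces (2 * m * h) m s t) ∧
    (∀ m s₁ s₂ s₃ a : ℕ, a ≠ s₁ → a ≠ s₂ → a ≠ s₃ →
      IsCelestialConfiguration m ![s₁, s₂, s₃] ![a, a, a] →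
      IsCelestialConfiguration m ![s₂, s₃, s₁] ![a, a, a] →
      NestingProduces (6 * m) m ![s₁, s₂, s₃] ![a, a, a]) ∧
    (∀ m s₁ s₂ s₃ s₄ a b : ℕ, (∀ x ∈ [s₁, s₂, s₃, s₄], x ≠ a ∧ x ≠ b) →
      IsCelestialConfiguration m ![s₁, s₂, s₃, s₄] ![a, b, a, b] →
      IsCelestialConfiguration m ![s₂, s₃, s₄, s₁] ![a, b, a, b] →
      NestingProduces (8 * m) m ![s₁, s₂, s₃, s₄] ![a, b, a, b]) ∧
    (IsCelestialConfiguration 9 ![4, 2, 1] ![3, 3, 3] ∧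
      IsCelestialConfiguration 9 ![2, 1, 4] ![3, 3, 3] ∧
      NestingProduces 54 9 ![4, 2, 1] ![3, 3, 3]) := by
  have hshift3 : ∀ s₁ s₂ s₃ : ℕ, cyclicShift ![s₁, s₂, s₃] = ![s₂, s₃, s₁] := fun s₁ s₂ s₃ => by
    funext j
    fin_cases j <;> rfl
  have hshift4 : ∀ s₁ s₂ s₃ s₄ : ℕ,
      cyclicShift ![s₁, s₂, s₃, s₄] = ![s₂, s₃, s₄, s₁] := fun s₁ s₂ s₃ s₄ => by
    funext j
    fin_cases j <;> rfl
  have h3 : ∀ m s₁ s₂ s₃ a : ℕ, a ≠ s₁ → a ≠ s₂ → a ≠ s₃ →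
      IsCelestialConfiguration m ![s₁, s₂, s₃] ![a, a, a] →
      IsCelestialConfiguration m ![s₂, s₃, s₁] ![a, a, a] →
      NestingProduces (6 * m) m ![s₁, s₂, s₃] ![a, a, a] := by
    intro m s₁ s₂ s₃ a h₁ h₂ h₃ c₁ c₂
    rw [show 6 * m = 2 * m * 3 by ring]
    refine nestingProduces_of_alternating (fun i j => ?_) (fun j => ?_) c₁ ?_
    · fin_cases i <;> fin_cases j
      exacts [h₁.symm, h₁.symm, h₁.symm, h₂.symm, h₂.symm, h₂.symm, h₃.symm, h₃.symm, h₃.symm]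
    · fin_cases j <;> rfl
    · rwa [hshift3]
  refine ⟨?_, h3, ?_, isCelestialConfiguration_nine_four_two_one,
    isCelestialConfiguration_nine_two_one_four,
    h3 9 4 2 1 3 (by norm_num) (by norm_num) (by norm_num)
      isCelestialConfiguration_nine_four_two_one isCelestialConfiguration_nine_two_one_four⟩
  · rintro m h _ S T - hST - - s t rfl rfl ht c₁ c₂
    refine nestingProduces_of_alternating (fun i j hij => ?_) ht c₁ c₂
    exact hST (s i) (Multiset.mem_map_of_mem s (Finset.mem_univ_val i))
      (hij ▸ Multiset.mem_map_of_mem t (Finset.mem_univ_val j))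
  · intro m s₁ s₂ s₃ s₄ a b hx c₁ c₂
    rw [show 8 * m = 2 * m * 4 by ring]
    simp only [List.mem_cons, List.not_mem_nil, or_false, forall_eq_or_imp, forall_eq] at hx
    refine nestingProduces_of_alternating (fun i j => ?_) (fun j => ?_) c₁ ?_
    · fin_cases i <;> fin_cases j <;> simp [hx]
    · fin_cases j <;> rfl
    · rwa [hshift4]
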